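/- Conventions. Locally convex spaces are real and Hausdorff, and manifolds are Hausdorff. If $E,G$ are locally convex spaces and $V\subseteq E$ is open, a continuous map $f\colon V\to G$ is $C^0$; it is $C^{n+1}$ if all directional derivatives $df(p,v)=\lim_{h\to 0}h^{-1}(f(p+hv)-f(p))$ ($p\in V$, $v\in E$) exist and $df\colon V\times E\to G$ is $C^n$ (Keller's $C^n_c$-calculus). Manifolds modelled over $E$, their tangent bundles, vector fields and Lie brackets are defined with this calculus in the usual way. Let $r\in\mathbb N$, $r\ge 2$, let $M$ be a $C^r$-manifold modelled over a locally convex space $E$, and let $F\subseteq E$ be a vector subspace that is a Banach space in the induced topology (that is, its topology is given by a complete norm) and has a topological vector complement $H$, $E=F\oplus H$. Let $D\subseteq TM$ be a subbundle with typical fibre $F$, i.e. every point has an open neighbourhood $U$ with a local trivialization $TU\to U\times E$ of $TM$ (of class $C^{r-1}$ with inverse of class $C^{r-1}$, fibrewise an isomorphism of topological vector spaces) mapping $D\cap TU$ onto $U\times F$. Let $D$ be involutive: for every open $U\subseteq M$ and all $C^{r-1}$-vector fields $Y,Z$ on $U$ with values in $D$, also $[Y,Z]$ has values in $D$. Assume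 that for every $p_0\in M$ there are an open neighbourhood $U\subseteq M$ of $p_0$ and a $C^{r-1}$-map $X\colon U\times F\to TU$ with $X(p,v)\in T_pM$ for all $(p,v)$ such that 1. $v\mapsto X(p,v)$ is linear for every $p\in U$; 2. $X(p,v)\in D_p$ for all $p\in U$, $v\in F$; 3. $X(p_0,\cdot)\colon F\to D_{p_0}$ is an isomorphism of topological vector spaces; 4. $X$ provides a local flow with parameters: there are an open set $\Omega\subseteq\mathbb R\times U\times F$ containing $\{0\}\times U\times F$ and a $C^r$-map $\Phi\colon\Omega\to U$ with $\Phi(0,x,v)=x$ and $\frac{\partial}{\partial t}\big|_{t=0}\Phi(t,x,v)=X(x,v)$ for all $x\in U$, $v\in F$, such that all $x\in U$, $v\in F$ have neighbourhoods $W$ and $V$, and there is an open symmetric interval $I\ni 0$, with $I\times W\times V\subseteq\Omega$, with $(t,\Phi(s,y,w),w)\in\Omega$ for all $s,t\in I$, $y\in W$, $w\in V$, and with $\Phi(t,\Phi(s,y,w),w)=\Phi(t+s,y,w)$ whenever moreover $s+t\in I$. Then $D$ is a Frobenius distribution: $M$ has an atlas of Frobenius charts for $D$, i.e. of charts $\varphi\colon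 U_\varphi\to V_1\times V_2$ of the $C^r$-manifold $M$ with $V_1\subseteq F$ and $V_2\subseteq H$ open (where $F\times H$ is identified with $E$) such that for every $\overline y\in V_2$ the submanifold $S_{\overline y}=\{\varphi^{-1}(x,\overline y):x\in V_1\}$ of $M$ is an integral manifold of $D$. Here an integral manifold of $D$ is a connected immersed submanifold $N\subseteq M$ modelled over $F$ with $T_pN=D_p$ for all $p\in N$; and an immersed submanifold modelled over $F$ is a subset $N\subseteq M$ with the structure of a $C^r$-manifold modelled over $F$ such that the inclusion $N\to M$ is continuous and around each $p\in N$ there are a chart $\varphi\colon U_\varphi\to V_\varphi$ of $N$ and a chart $\psi\colon U_\psi\to V_\psi$ of $M$ with $U_\varphi\subseteq U_\psi$ and $\psi(\varphi^{-1}(x))=x$ for all $x\in V_\varphi$. -/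

import Mathlib

open Filter Topology Set

namespace KellerFrobenius

universe u v w

section Calculus

/-- The directional derivative `lim_{h → 0} (f (p + h • v) - f p) / h`. It is only used at points
where the limit exists and in Hausdorff spaces, where the limit is unique. -/
noncomputable def dirDeriv {E : Type u} [AddCommGroup E] [Module ℝ E]
    {G : Type v} [AddCommGroup G] [Module ℝ G] [TopologicalSpace G]
    (f : E → G) (p v : E) : G :=
  limUnder (𝓝[≠] (0 : ℝ)) fun h : ℝ => h⁻¹ • (f (p + h • v) - f p)

/-- Keller's `C^n_c`-maps on an open set `U`: `C^0` means continuous, and `f` is `C^{n+1}` if it is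
continuous, all directional derivatives `df (p, v)`, `p ∈ U`, exist, and `df` is `C^n` (in
particular continuous) on `U × E`. -/
def KellerOn {G : Type v} [AddCommGroup G] [Module ℝ G] [TopologicalSpace G] :
    (n : ℕ) → {E : Type u} → [AddCommGroup E] → [Module ℝ E] → [TopologicalSpace E] →
      (f : E → G) → (U : Set E) → Prop
  | 0, _, _, _, _, f, U => ContinuousOn f U
  | n + 1, E, _, _, _, f, U => ContinuousOn f U ∧ ∃ df : E × E → G,
      (∀ p ∈ U, ∀ v : E,
        Tendsto (fun h : ℝ => h⁻¹ • (f (p + h • v) - f p)) (𝓝[≠] 0) (𝓝 (df (p, v)))) ∧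
      KellerOn n df (U ×ˢ univ)

end Calculus

section Manifolds

/-- The charts of the given atlas are `C^r`-compatible: `M` is a `C^r`-manifold modelled
over `E`. -/
def IsCrManifold (r : ℕ) (E : Type u) [AddCommGroup E] [Module ℝ E] [TopologicalSpace E]
    (M : Type v) [TopologicalSpace M] [ChartedSpace E M] : Prop :=
  ∀ e ∈ atlas E M, ∀ e' ∈ atlas E M,
    KellerOn r (e' ∘ e.symm) (e.target ∩ e.symm ⁻¹' e'.source)

variable {E : Type u} [AddCommGroup E] [Module ℝ E] [TopologicalSpace E]
  {M : Type v} [TopologicalSpace M] [ChartedSpace E M]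

/-- `φ` is a chart of the `C^r`-manifold `M`, that is, a member of its maximal `C^r`-atlas. -/
def IsCrChart (r : ℕ) (φ : OpenPartialHomeomorph M E) : Prop :=
  ∀ e ∈ atlas E M,
    KellerOn r (φ ∘ e.symm) (e.target ∩ e.symm ⁻¹' φ.source) ∧
    KellerOn r (e ∘ φ.symm) (φ.target ∩ φ.symm ⁻¹' e.source)

/-- The tangent space `T_p M`. As for Mathlib's tangent spaces, a tangent vector at `p` is given by
its coordinates in the preferred chart `chartAt E p`; so `T_p M` is a copy of the topological
vector space `E`. Its coordinates in any other chart around `p` are given by `toChart`. -/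
abbrev TSpace (E : Type u) {M : Type v} (_p : M) : Type u := E

/-- `dφ : T_p M → E`: the coordinates in the chart `φ` of a tangent vector at `p`. -/
noncomputable def toChart (φ : OpenPartialHomeomorph M E) (p : M) (ξ : TSpace E p) : E :=
  dirDeriv (φ ∘ (chartAt E p).symm) (chartAt E p p) ξ

/-- The inverse of `toChart φ p`: the tangent vector at `p` whose coordinates in `φ` are `y`. -/
noncomputable def ofChart (φ : OpenPartialHomeomorph M E) (p : M) (y : E) : TSpace E p :=
  dirDeriv (chartAt E p ∘ φ.symm) (φ p) y

/-- The local representative of a vector field in a chart. -/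
noncomputable def localRep (φ : OpenPartialHomeomorph M E) (X : (p : M) → TSpace E p) : E → E :=
  fun y => toChart φ (φ.symm y) (X (φ.symm y))

/-- `X` is a vector field of class `C^k` on the open set `U` (only its values on `U` matter). -/
def IsCrVectorFieldOn (k : ℕ) (X : (p : M) → TSpace E p) (U : Set M) : Prop :=
  ∀ e ∈ atlas E M, KellerOn k (localRep e X) (e.target ∩ e.symm ⁻¹' U)

/-- The Lie bracket, `[X, Y] = dY(X) - dX(Y)` in local coordinates. -/
noncomputable def lieBracket (X Y : (p : M) → TSpace E p) (p : M) : TSpace E p :=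
  let e := chartAt E p
  dirDeriv (localRep e Y) (e p) (localRep e X (e p)) -
    dirDeriv (localRep e X) (e p) (localRep e Y (e p))

/-- The distribution `D` is a subbundle of `TM` (a bundle of class `C^k`) with typical fibre `F`:
around every point there is a local trivialization `ψ : TU → U × E` of `TM` of class `C^k`,
with inverse of class `C^k`, that maps `D ∩ TU` onto `U × F`. -/
def IsSubbundle (k : ℕ) (F : Submodule ℝ E) (D : (p : M) → Submodule ℝ (TSpace E p)) : Prop :=
  ∀ p : M, ∃ U : Set M, IsOpen U ∧ p ∈ U ∧ ∃ ψ : (q : M) → (TSpace E q ≃L[ℝ] E),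
    (∀ e ∈ atlas E M,
      KellerOn k (fun z : E × E => ψ (e.symm z.1) (ofChart e (e.symm z.1) z.2))
        ((e.target ∩ e.symm ⁻¹' U) ×ˢ univ) ∧
      KellerOn k (fun z : E × E => toChart e (e.symm z.1) ((ψ (e.symm z.1)).symm z.2))
        ((e.target ∩ e.symm ⁻¹' U) ×ˢ univ)) ∧
    ∀ q ∈ U, ∀ ξ : TSpace E q, ξ ∈ D q ↔ ψ q ξ ∈ F

/-- `D` is involutive, for vector fields of class `C^k` on open subsets of `M`. -/
def IsInvolutive (k : ℕ) (D : (p : M) → Submodule ℝ (TSpace E p)) : Prop :=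
  ∀ (U : Set M) (X Y : (p : M) → TSpace E p), IsOpen U →
    IsCrVectorFieldOn k X U → IsCrVectorFieldOn k Y U →
    (∀ p ∈ U, X p ∈ D p) → (∀ p ∈ U, Y p ∈ D p) →
    ∀ p ∈ U, lieBracket X Y p ∈ D p

end Manifolds

section Parameters

variable {E : Type u} [AddCommGroup E] [Module ℝ E] [TopologicalSpace E]
  {M : Type v} [TopologicalSpace M] [ChartedSpace E M]
  {P : Type u} [AddCommGroup P] [Module ℝ P] [TopologicalSpace P]

/-- `X : U × P → TU` is a vector field of class `C^k` with parameters in `P` on the open set `U`. -/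
def IsCrParamVectorFieldOn (k : ℕ) (X : (p : M) → P → TSpace E p) (U : Set M) : Prop :=
  ∀ e ∈ atlas E M,
    KellerOn k (fun z : E × P => toChart e (e.symm z.1) (X (e.symm z.1) z.2))
      ((e.target ∩ e.symm ⁻¹' U) ×ˢ univ)

variable (E) in
/-- `Φ : Ω → M` is a map of class `C^r` on the open set `Ω ⊆ ℝ × M × P`. -/
def IsCrFlowMapOn (r : ℕ) (Φ : ℝ × M × P → M) (Ω : Set (ℝ × M × P)) : Prop :=
  ContinuousOn Φ Ω ∧
  ∀ e ∈ atlas E M, ∀ e' ∈ atlas E M,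
    KellerOn r (fun z : ℝ × E × P => e' (Φ (z.1, e.symm z.2.1, z.2.2)))
      {z | z.2.1 ∈ e.target ∧ (z.1, e.symm z.2.1, z.2.2) ∈ Ω ∧
        Φ (z.1, e.symm z.2.1, z.2.2) ∈ e'.source}

variable (E) in
/-- `Φ : Ω → U` is a local `C^r`-`ℝ`-action with parameters in `P` on the open set `U ⊆ M`. -/
structure IsLocalAction (r : ℕ) (U : Set M) (Φ : ℝ × M × P → M) (Ω : Set (ℝ × M × P)) :
    Prop where
  isOpen : IsOpen Ω
  subset : ∀ z ∈ Ω, z.2.1 ∈ U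
  mapsTo : ∀ z ∈ Ω, Φ z ∈ U
  contDiff : IsCrFlowMapOn E r Φ Ω
  zero_mem : ∀ x ∈ U, ∀ p : P, ((0 : ℝ), x, p) ∈ Ω
  map_zero : ∀ x ∈ U, ∀ p : P, Φ (0, x, p) = x
  map_add : ∀ x ∈ U, ∀ p : P, ∃ ε > (0 : ℝ), ∃ W ∈ 𝓝 x, ∃ V ∈ 𝓝 p,
    (∀ t ∈ Ioo (-ε) ε, ∀ y ∈ W, ∀ q ∈ V, (t, y, q) ∈ Ω) ∧
    (∀ t ∈ Ioo (-ε) ε, ∀ s ∈ Ioo (-ε) ε, ∀ y ∈ W, ∀ q ∈ V, (t, Φ (s, y, q), q) ∈ Ω) ∧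
    (∀ t ∈ Ioo (-ε) ε, ∀ s ∈ Ioo (-ε) ε, t + s ∈ Ioo (-ε) ε → ∀ y ∈ W, ∀ q ∈ V,
      Φ (t, Φ (s, y, q), q) = Φ (t + s, y, q))

/-- The vector field with parameters `X` on `U` provides a local flow with parameters: there is a
local `C^r`-`ℝ`-action with parameters on `U` with `∂/∂t|_{t = 0} Φ(t, x, p) = X(x, p)`; the
derivative is taken in the preferred chart at `x`, which is how tangent vectors are represented. -/
def ProvidesLocalFlow (r : ℕ) (U : Set M) (X : (p : M) → P → TSpace E p) : Prop :=
  ∃ (Φ : ℝ × M × P → M) (Ω : Set (ℝ × M × P)), IsLocalAction E r U Φ Ω ∧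
    ∀ x ∈ U, ∀ p : P,
      Tendsto (fun t : ℝ => t⁻¹ • (chartAt E x (Φ (t, x, p)) - chartAt E x x))
        (𝓝[≠] 0) (𝓝 (X x p))

end Parameters

/-- The topological vector space `F` is a Banach space: its topology is given by a complete
norm. -/
def IsBanach (F : Type u) [AddCommGroup F] [Module ℝ F] [TopologicalSpace F] : Prop :=
  ∃ (B : Type u) (_ : NormedAddCommGroup B) (_ : NormedSpace ℝ B),
    CompleteSpace B ∧ Nonempty (B ≃L[ℝ] F)

section Frobenius

variable {E : Type u} [AddCommGroup E] [Module ℝ E] [TopologicalSpace E]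
  {M : Type v} [TopologicalSpace M] [ChartedSpace E M]

/-- The manifold `N` modelled over the subspace `F` of `E`, with the injection `ι : N → M` as its
inclusion, is an immersed submanifold (of class `C^r`) of `M`. -/
structure IsImmersedSubmanifold (r : ℕ) (F : Submodule ℝ E)
    (N : Type w) [TopologicalSpace N] [ChartedSpace F N] (ι : N → M) : Prop where
  isManifold : IsCrManifold r F N
  injective : Function.Injective ι
  continuous : Continuous ι
  exists_charts : ∀ p : N, ∃ (φ : OpenPartialHomeomorph N F) (ψ : OpenPartialHomeomorph M E),
    IsCrChart r φ ∧ IsCrChart r ψ ∧ p ∈ φ.source ∧ ι p ∈ ψ.source ∧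
    (∀ q ∈ φ.source, ι q ∈ ψ.source) ∧
    ∀ x ∈ φ.target, ψ (ι (φ.symm x)) = (x : E)

/-- The tangent map `T_p ι : T_p N → T_{ι p} M`. -/
noncomputable def tangentMapIncl (F : Submodule ℝ E)
    {N : Type w} [TopologicalSpace N] [ChartedSpace F N] (ι : N → M) (p : N)
    (ξ : TSpace F p) : TSpace E (ι p) :=
  dirDeriv (chartAt E (ι p) ∘ ι ∘ (chartAt F p).symm) (chartAt F p p) ξ

/-- `N` is an integral manifold of `D`: a connected immersed submanifold with `T_p N = D_p` for all
`p` in `N`. -/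
structure IsIntegralManifold (r : ℕ) (F : Submodule ℝ E) (D : (p : M) → Submodule ℝ (TSpace E p))
    (N : Type w) [TopologicalSpace N] [ChartedSpace F N] (ι : N → M) : Prop where
  immersed : IsImmersedSubmanifold r F N ι
  connected : ConnectedSpace N
  tangent : ∀ p : N, range (tangentMapIncl F ι p) = (D (ι p) : Set (TSpace E (ι p)))

/-- The slice `{φ⁻¹(x, y) : x ∈ V₁}`, where `(x, y)` stands for `x + y` in `E = F ⊕ H`. -/
def slice (φ : OpenPartialHomeomorph M E) {F : Submodule ℝ E} (V₁ : Set F) (y : E) : Set M :=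
  {p | ∃ x ∈ V₁, p = φ.symm ((x : E) + y)}

/-- `φ` is a Frobenius chart for `D` with respect to the decomposition `E = F ⊕ H`: its image is
`V₁ × V₂`, and every slice, as a submanifold of `M` (so with the topology induced by `M`, which
determines its manifold structure as an immersed submanifold), is an integral manifold of `D`. -/
def IsFrobeniusChart (r : ℕ) (F H : Submodule ℝ E) (D : (p : M) → Submodule ℝ (TSpace E p))
    (φ : OpenPartialHomeomorph M E) : Prop :=
  IsCrChart r φ ∧ ∃ (V₁ : Set F) (V₂ : Set H), IsOpen V₁ ∧ IsOpen V₂ ∧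
    φ.target = {z | ∃ x ∈ V₁, ∃ y ∈ V₂, z = (x : E) + (y : E)} ∧
    ∀ y ∈ V₂, ∃ _ : ChartedSpace F (slice φ V₁ (y : E)),
      IsIntegralManifold r F D (slice φ V₁ (y : E)) Subtype.val

/-- `D` is a Frobenius distribution: `M` has an atlas of Frobenius charts for `D`. -/
def IsFrobeniusDistribution (r : ℕ) (F H : Submodule ℝ E)
    (D : (p : M) → Submodule ℝ (TSpace E p)) : Prop :=
  ∃ A : Set (OpenPartialHomeomorph M E), (∀ φ ∈ A, IsFrobeniusChart r F H D φ) ∧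
    ∀ p : M, ∃ φ ∈ A, p ∈ φ.source

end Frobenius

end KellerFrobenius

open KellerFrobenius

/-!
Let `X (·, v)`, `v` in the Banach space `B ≃ F`, be the given vector fields near `p₀`. In a chart
at `p₀` they span `D`, and their flow `Φ` with parameter `v` is a `C^r`-map between open subsets of
locally convex spaces. For a small fixed time `τ`, the inverse of the Frobenius chart is
`ψ (v, y) = Φ (τ, x₀ + y, v)`, with `y` in a complement of `D p₀`; so the slices are the images of
`v ↦ Φ (τ, x, v)`. The two things to be shown are that these images are tangent to `D`, and that
`ψ` is a local diffeomorphism, although neither uniqueness for differential equations nor an inverse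
function theorem is available in `E`.

*Tangency.* By involutivity, `[X_v, X_w] = X_{c(v, w)}`, where `c` takes its values in `B` and depends
continuously on the point (`exists_bracket_coefficients`). If `w` solves the linear equation
`w' = w₀ - c (v, w)`, `w 0 = 0`, in the Banach space `B` along a flow line of `X_v`, then
`t ↦ X (·, w t)` solves the linearised equation that the derivative of `Φ` with respect to the
parameter in the direction `w₀` has to solve. Solutions of the linearised equation are unique in
spite of `E` being merely locally convex: the derivative of the given flow moves them back to a
constant curve, by the group law and the symmetry of second derivatives
(`IsFlow.eq_deriv_of_linearised`). Hence the derivative is `X (·, w τ)`, a vector in `D`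
(`IsParamFlow.exists_deriv_param_eq`).

*Invertibility.* To find `(v, y)` with `ψ (v, y) = z`, it is enough to find `v` such that
`Φ (-τ, z, v)` lies in `x₀ + H`; then `y` can be read off. This is an equation in `B`, whose
derivative in `v` at `v = 0` is `-τ` times an isomorphism, as the flow of `X (·, 0) = 0` is constant.
It is solved by an implicit function theorem with locally convex parameters and Banach values
(`exists_implicit_function`), which rests on the fact that a family of operators on `B` that is
jointly `C^1` is continuous in the operator norm and that the family of its inverses is of the same
class (`exists_inverse_family`). The same fact shows that the derivatives of `ψ` in the directions of
`B` exhaust `D`. This gives `IsParamFlow.exists_straightening`.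

The passage between the manifold and the model space uses that the Lie bracket may be computed in
any chart (`IsCrManifold.toChart_lieBracket`), and that a chart with product image whose derivatives
in the directions of `F` span `D` is a Frobenius chart (`IsCrChart.isFrobeniusChart`).
-/

namespace KellerFrobenius

universe u v w

/-! ### Directional derivatives -/

section Basic
variable {E : Type u} [AddCommGroup E] [Module ℝ E]
  {G : Type v} [AddCommGroup G] [Module ℝ G] [TopologicalSpace G]

/-- `f` has the directional derivative `y` at `p` in the direction `v`. For a curve `f : ℝ → G`
and `v = 1` this is the ordinary derivative. -/
def HasDirDeriv (f : E → G) (p v : E) (y : G) : Prop :=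
  Tendsto (fun h : ℝ => h⁻¹ • (f (p + h • v) - f p)) (𝓝[≠] 0) (𝓝 y)

theorem HasDirDeriv.unique [T2Space G] {f : E → G} {p v : E} {y z : G}
    (hy : HasDirDeriv f p v y) (hz : HasDirDeriv f p v z) : y = z :=
  tendsto_nhds_unique hy hz

theorem HasDirDeriv.dirDeriv_eq [T2Space G] {f : E → G} {p v : E} {y : G}
    (hy : HasDirDeriv f p v y) : dirDeriv f p v = y :=
  Tendsto.limUnder_eq hy

theorem hasDirDeriv_iff_hasDerivAt {N : Type v} [NormedAddCommGroup N] [NormedSpace ℝ N]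
    {f : ℝ → N} {t : ℝ} {y : N} : HasDirDeriv f t 1 y ↔ HasDerivAt f y t := by
  rw [hasDerivAt_iff_tendsto_slope_zero, HasDirDeriv]
  simp

theorem HasDirDeriv.clm_comp [TopologicalSpace E] {G' : Type w} [AddCommGroup G'] [Module ℝ G']
    [TopologicalSpace G'] {f : E → G} {p v : E} {y : G} (hf : HasDirDeriv f p v y)
    (L : G →L[ℝ] G') : HasDirDeriv (fun x => L (f x)) p v (L y) := by
  have := (L.continuous.tendsto y).comp hf
  refine this.congr fun h => ?_
  simp

theorem HasDirDeriv.prodMk {G' : Type w} [AddCommGroup G'] [Module ℝ G']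
    [TopologicalSpace G'] {f : E → G} {g : E → G'} {p v : E} {y : G} {z : G'}
    (hf : HasDirDeriv f p v y) (hg : HasDirDeriv g p v z) :
    HasDirDeriv (fun x => (f x, g x)) p v (y, z) :=
  Tendsto.prodMk_nhds hf hg

theorem HasDirDeriv.add [ContinuousAdd G] {f g : E → G} {p v : E} {y z : G}
    (hf : HasDirDeriv f p v y) (hg : HasDirDeriv g p v z) :
    HasDirDeriv (fun x => f x + g x) p v (y + z) := by
  refine (Tendsto.add hf hg).congr fun h => ?_
  rw [← smul_add]
  beta_reduce
  congr 1
  abel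

theorem HasDirDeriv.sub [IsTopologicalAddGroup G] {f g : E → G} {p v : E} {y z : G}
    (hf : HasDirDeriv f p v y) (hg : HasDirDeriv g p v z) :
    HasDirDeriv (fun x => f x - g x) p v (y - z) := by
  refine (Tendsto.sub hf hg).congr fun h => ?_
  rw [← smul_sub]
  beta_reduce
  congr 1
  abel

theorem hasDirDeriv_const (c : G) (p v : E) : HasDirDeriv (fun _ : E => c) p v 0 := by
  simpa [HasDirDeriv] using tendsto_const_nhds

theorem tendsto_line [TopologicalSpace E] [ContinuousAdd E] [ContinuousSMul ℝ E] (p v : E) :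
    Tendsto (fun h : ℝ => p + h • v) (𝓝 0) (𝓝 p) := by
  have : Continuous fun h : ℝ => p + h • v := by fun_prop
  simpa using this.tendsto 0

theorem HasDirDeriv.congr_of_eventuallyEq [TopologicalSpace E] [ContinuousAdd E]
    [ContinuousSMul ℝ E] {f g : E → G} {p v : E} {y : G}
    (hf : HasDirDeriv f p v y) (hfg : f =ᶠ[𝓝 p] g) : HasDirDeriv g p v y := by
  refine Tendsto.congr' ?_ hf
  have h1 : ∀ᶠ h : ℝ in 𝓝[≠] 0, f (p + h • v) = g (p + h • v) :=
    ((tendsto_line p v).mono_left nhdsWithin_le_nhds).eventually hfg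
  filter_upwards [h1] with h hh
  rw [hh, hfg.self_of_nhds]

theorem mem_Ioo_of_mem_uIcc {ε t T : ℝ} (hT : T ∈ Ioo (-ε) ε) (ht : t ∈ uIcc 0 T) :
    t ∈ Ioo (-ε) ε := by
  have h0 : (0 : ℝ) ∈ Ioo (-ε) ε := ⟨by linarith [hT.1, hT.2], by linarith [hT.1, hT.2]⟩
  exact ordConnected_Ioo.uIcc_subset h0 hT ht

/-- A continuous linear map is its own derivative. -/
theorem hasDirDeriv_clm [TopologicalSpace E] (L : E →L[ℝ] G) (p v : E) :
    HasDirDeriv L p v (L v) := by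
  refine tendsto_const_nhds.congr' ?_
  filter_upwards [self_mem_nhdsWithin] with h hh
  have : h ≠ 0 := hh
  simp [smul_smul, this]

/-- Along a line `s ↦ p + s • v`, directional derivatives are derivatives of curves. -/
theorem HasDirDeriv.line {f : E → G} {p v : E} {t : ℝ} {y : G}
    (h : HasDirDeriv f (p + t • v) v y) : HasDirDeriv (fun s : ℝ => f (p + s • v)) t 1 y := by
  refine h.congr fun s => ?_
  simp [add_smul, add_assoc]

variable [IsTopologicalAddGroup G] [ContinuousSMul ℝ G] [LocallyConvexSpace ℝ G]

theorem exists_isClosed_convex_nhds (y : G) {S : Set G} (hS : S ∈ 𝓝 y) :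
    ∃ K ⊆ S, K ∈ 𝓝 y ∧ IsClosed K ∧ Convex ℝ K := by
  obtain ⟨T, hT, hTc, hTS⟩ := exists_mem_nhds_isClosed_subset hS
  obtain ⟨C, ⟨hC, hCc⟩, hCT⟩ := (LocallyConvexSpace.convex_basis (𝕜 := ℝ) y).mem_iff.1 hT
  exact ⟨closure C, (hTc.closure_subset_iff.2 hCT).trans hTS, mem_of_superset hC subset_closure,
    isClosed_closure, hCc.closure⟩

/-- Mean value theorem: if the derivatives of a curve lie in a closed convex set, then so does
its difference quotient. -/
theorem slope_mem_of_hasDirDeriv {γ γ' : ℝ → G} {a b : ℝ} (hab : a < b)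
    (hγ : ∀ t ∈ Icc a b, HasDirDeriv γ t 1 (γ' t)) {K : Set G} (hKc : IsClosed K)
    (hK : Convex ℝ K) (hmem : ∀ t ∈ Icc a b, γ' t ∈ K) : (b - a)⁻¹ • (γ b - γ a) ∈ K := by
  -- separate the slope from `K` by a functional and apply the scalar mean value theorem
  by_contra hn
  obtain ⟨ℓ, c, hlt, hgt⟩ := geometric_hahn_banach_closed_point hK hKc hn
  have hd : ∀ t ∈ Icc a b, HasDerivAt (fun s => ℓ (γ s)) (ℓ (γ' t)) t := fun t ht =>
    hasDirDeriv_iff_hasDerivAt.1 ((hγ t ht).clm_comp ℓ)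
  obtain ⟨t, ht, hteq⟩ := exists_hasDerivAt_eq_slope (fun s => ℓ (γ s)) (fun s => ℓ (γ' s)) hab
    (fun t ht => (hd t ht).continuousAt.continuousWithinAt)
    (fun t ht => hd t (Ioo_subset_Icc_self ht))
  have h1 := hlt _ (hmem t (Ioo_subset_Icc_self ht))
  have h2 : ℓ ((b - a)⁻¹ • (γ b - γ a)) = ℓ (γ' t) := by
    rw [hteq]; simp [div_eq_inv_mul]
  rw [h2] at hgt
  exact lt_asymm h1 hgt

theorem slope_mem_of_hasDirDeriv_uIcc {γ γ' : ℝ → G} {h : ℝ} (h0 : h ≠ 0)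
    (hγ : ∀ t ∈ uIcc 0 h, HasDirDeriv γ t 1 (γ' t)) {K : Set G} (hKc : IsClosed K)
    (hK : Convex ℝ K) (hmem : ∀ t ∈ uIcc 0 h, γ' t ∈ K) : h⁻¹ • (γ h - γ 0) ∈ K := by
  rcases lt_or_gt_of_ne h0 with hh | hh
  · rw [uIcc_of_ge hh.le] at hγ hmem
    have := slope_mem_of_hasDirDeriv hh hγ hKc hK hmem
    convert this using 1
    rw [zero_sub, inv_neg, neg_smul, ← smul_neg, neg_sub]
  · rw [uIcc_of_le hh.le] at hγ hmem
    simpa using slope_mem_of_hasDirDeriv hh hγ hKc hK hmem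

theorem eq_of_hasDirDeriv_zero [T2Space G] {γ : ℝ → G} {T : ℝ}
    (hγ : ∀ t ∈ uIcc 0 T, HasDirDeriv γ t 1 0) : γ T = γ 0 := by
  rcases eq_or_ne T 0 with rfl | hT
  · rfl
  have := slope_mem_of_hasDirDeriv_uIcc hT hγ (K := {0}) isClosed_singleton (convex_singleton _)
    (fun _ _ => rfl)
  rw [mem_singleton_iff, smul_eq_zero_iff_right (inv_ne_zero hT), sub_eq_zero] at this
  exact this

end Basic

/-! ### Maps of class `C^1` -/

section C1

variable {E : Type u} [AddCommGroup E] [Module ℝ E] [TopologicalSpace E]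
  {G : Type v} [AddCommGroup G] [Module ℝ G] [TopologicalSpace G]

/-- `f` is a `C^1`-map with derivative `df` on the open set `U`. -/
structure IsC1On (f : E → G) (df : E × E → G) (U : Set E) : Prop where
  isOpen : IsOpen U
  continuousOn : ContinuousOn f U
  hasDirDeriv : ∀ p ∈ U, ∀ v : E, HasDirDeriv f p v (df (p, v))
  continuousOn_deriv : ContinuousOn df (U ×ˢ univ)

theorem IsC1On.mono {f : E → G} {df : E × E → G} {U V : Set E} (h : IsC1On f df U)
    (hV : IsOpen V) (hVU : V ⊆ U) : IsC1On f df V :=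
  ⟨hV, h.continuousOn.mono hVU, fun p hp => h.hasDirDeriv p (hVU hp),
    h.continuousOn_deriv.mono (prod_mono hVU Subset.rfl)⟩

theorem IsC1On.continuousAt_deriv {f : E → G} {df : E × E → G} {U : Set E} (h : IsC1On f df U)
    {x : E} (hx : x ∈ U) (u : E) : ContinuousAt df (x, u) :=
  h.continuousOn_deriv.continuousAt ((h.isOpen.prod isOpen_univ).mem_nhds ⟨hx, trivial⟩)

theorem IsC1On.continuousAt {f : E → G} {df : E × E → G} {U : Set E} (h : IsC1On f df U)
    {x : E} (hx : x ∈ U) : ContinuousAt f x :=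
  h.continuousOn.continuousAt (h.isOpen.mem_nhds hx)

variable [IsTopologicalAddGroup E] [ContinuousSMul ℝ E]
  [IsTopologicalAddGroup G] [ContinuousSMul ℝ G] [LocallyConvexSpace ℝ G]
  {f : E → G} {df : E × E → G} {U : Set E}

/-- If `df` has a property near `(x, u)`, then it has it along all short segments near `x` with
directions near `u`. -/
theorem eventually_segment {x u : E} {P : E × E → Prop} (hP : ∀ᶠ q in 𝓝 (x, u), P q) :
    ∀ᶠ q : ℝ × E × E in 𝓝 (0, x, u), ∀ t ∈ uIcc 0 q.1, P (q.2.1 + t • q.2.2, q.2.2) := by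
  have hc : Continuous fun q : ℝ × E × E => (q.2.1 + q.1 • q.2.2, q.2.2) := by fun_prop
  have h1 : ∀ᶠ q : ℝ × E × E in 𝓝 (0, x, u), P (q.2.1 + q.1 • q.2.2, q.2.2) := by
    have := hc.tendsto (0, x, u)
    simp only [zero_smul, add_zero] at this
    exact this.eventually hP
  rw [nhds_prod_eq] at h1 ⊢
  obtain ⟨pa, ha, pb, hb, hab⟩ := eventually_prod_iff.1 h1
  obtain ⟨δ, hδ, hball⟩ := Metric.eventually_nhds_iff.1 ha
  refine eventually_prod_iff.2 ⟨fun t => |t| < δ, ?_, pb, hb, ?_⟩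
  · exact Metric.eventually_nhds_iff.2 ⟨δ, hδ, fun t ht => by simpa using ht⟩
  · intro t ht q hq s hs
    refine hab (x := s) (hball ?_) hq
    have : |s - 0| ≤ |t - 0| := abs_sub_left_of_mem_uIcc hs
    simp only [sub_zero] at this
    simpa using this.trans_lt ht

/-- The derivative of a `C^1`-map is a strict one: base point and direction may vary along with
the step. -/
theorem IsC1On.tendsto_strict (h : IsC1On f df U) {x : E} (hx : x ∈ U) (u : E) :
    Tendsto (fun q : ℝ × E × E => q.1⁻¹ • (f (q.2.1 + q.1 • q.2.2) - f q.2.1))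
      (𝓝[≠] 0 ×ˢ 𝓝 (x, u)) (𝓝 (df (x, u))) := by
  intro S hS
  obtain ⟨K, hKS, hK, hKc, hKconv⟩ := exists_isClosed_convex_nhds _ hS
  have h1 : ∀ᶠ q : E × E in 𝓝 (x, u), q.1 ∈ U ∧ df q ∈ K :=
    (continuousAt_fst.eventually (h.isOpen.mem_nhds hx)).and
      ((h.continuousAt_deriv hx u).eventually hK)
  have h2 := eventually_segment h1
  rw [nhds_prod_eq] at h2
  have h3 := h2.filter_mono (prod_mono_left (𝓝 (x, u)) (nhdsWithin_le_nhds (s := {(0 : ℝ)}ᶜ)))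
  have h4 : ∀ᶠ q : ℝ × E × E in 𝓝[≠] 0 ×ˢ 𝓝 (x, u), q.1 ≠ 0 :=
    (eventually_mem_nhdsWithin (s := {(0 : ℝ)}ᶜ)).prod_inl _
  rw [mem_map]
  filter_upwards [h3, h4] with q hq hq0
  refine hKS ?_
  have := slope_mem_of_hasDirDeriv_uIcc (γ := fun t => f (q.2.1 + t • q.2.2))
    (γ' := fun t => df (q.2.1 + t • q.2.2, q.2.2)) hq0
    (fun t ht => (h.hasDirDeriv _ (hq t ht).1 _).line) hKc hKconv (fun t ht => (hq t ht).2)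
  simpa using this

theorem IsC1On.tendsto_of_tendsto (h : IsC1On f df U) {x : E} (hx : x ∈ U) {u : E}
    {α : Type*} {l : Filter α} {s : α → ℝ} {y w : α → E} (hs : Tendsto s l (𝓝[≠] 0))
    (hy : Tendsto y l (𝓝 x)) (hw : Tendsto w l (𝓝 u)) :
    Tendsto (fun a => (s a)⁻¹ • (f (y a + s a • w a) - f (y a))) l (𝓝 (df (x, u))) :=
  (h.tendsto_strict hx u).comp (hs.prodMk (hy.prodMk_nhds hw))

/-- Chain rule for directional derivatives. -/
theorem IsC1On.hasDirDeriv_comp (h : IsC1On f df U) {P : Type w} [AddCommGroup P] [Module ℝ P]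
    {g : P → E} {p v : P} {y : E} (hg : HasDirDeriv g p v y) (hp : g p ∈ U) :
    HasDirDeriv (fun x => f (g x)) p v (df (g p, y)) := by
  refine (h.tendsto_of_tendsto hp tendsto_id tendsto_const_nhds hg).congr' ?_
  filter_upwards [self_mem_nhdsWithin] with s hs
  have : s ≠ 0 := hs
  simp [smul_smul, this]

variable [T2Space G]

theorem IsC1On.deriv_add (h : IsC1On f df U) {x : E} (hx : x ∈ U) (u v : E) :
    df (x, u + v) = df (x, u) + df (x, v) := by
  -- strictness allows the second of the two steps to start at `x + s • u`
  have h1 := h.tendsto_of_tendsto hx tendsto_id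
    ((tendsto_line x u).mono_left (nhdsWithin_le_nhds (s := {(0 : ℝ)}ᶜ)))
    (tendsto_const_nhds (x := v))
  refine tendsto_nhds_unique (h.hasDirDeriv x hx (u + v))
    ((Tendsto.add (h.hasDirDeriv x hx u) h1).congr ?_)
  intro s
  simp only [id]
  rw [← smul_add, smul_add s, ← add_assoc]
  congr 1
  abel

omit [IsTopologicalAddGroup E] [ContinuousSMul ℝ E] [IsTopologicalAddGroup G]
  [LocallyConvexSpace ℝ G] in
theorem IsC1On.deriv_smul (h : IsC1On f df U) {x : E} (hx : x ∈ U) (c : ℝ) (u : E) :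
    df (x, c • u) = c • df (x, u) := by
  rcases eq_or_ne c 0 with rfl | hc
  · refine (h.hasDirDeriv x hx _).unique ?_
    simp [HasDirDeriv]
  have h1 : Tendsto (fun s : ℝ => s * c) (𝓝[≠] 0) (𝓝[≠] 0) := by
    refine tendsto_nhdsWithin_iff.2 ⟨?_, ?_⟩
    · have : Continuous fun s : ℝ => s * c := by fun_prop
      simpa using (this.tendsto 0).mono_left nhdsWithin_le_nhds
    · filter_upwards [self_mem_nhdsWithin] with s hs
      exact mul_ne_zero hs hc
  refine (h.hasDirDeriv x hx _).unique ?_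
  have := ((h.hasDirDeriv x hx u).comp h1).const_smul c
  refine this.congr fun s => ?_
  simp only [Function.comp, smul_smul, mul_inv]
  congr 1
  field_simp

theorem IsC1On.isLinearMap (h : IsC1On f df U) {x : E} (hx : x ∈ U) :
    IsLinearMap ℝ fun u => df (x, u) :=
  ⟨h.deriv_add hx, h.deriv_smul hx⟩

theorem IsC1On.deriv_zero (h : IsC1On f df U) {x : E} (hx : x ∈ U) : df (x, 0) = 0 :=
  (h.isLinearMap hx).map_zero

theorem IsC1On.deriv_sub (h : IsC1On f df U) {x : E} (hx : x ∈ U) (u v : E) :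
    df (x, u - v) = df (x, u) - df (x, v) :=
  (h.isLinearMap hx).map_sub u v

theorem IsC1On.deriv_neg (h : IsC1On f df U) {x : E} (hx : x ∈ U) (u : E) :
    df (x, -u) = -df (x, u) :=
  (h.isLinearMap hx).map_neg u

/-- The derivative at a point as a continuous linear map. -/
theorem IsC1On.exists_clm (h : IsC1On f df U) {x : E} (hx : x ∈ U) :
    ∃ L : E →L[ℝ] G, ∀ u, L u = df (x, u) :=
  ⟨⟨(h.isLinearMap hx).mk' _, by
    have : ContinuousOn (fun u => df (x, u)) univ :=
      h.continuousOn_deriv.comp (by fun_prop) (fun u _ => ⟨hx, trivial⟩)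
    exact continuousOn_univ.1 this⟩, fun u => rfl⟩

/-- Symmetry of second derivatives. -/
theorem IsC1On.second_deriv_symm (h : IsC1On f df U) {ddf : (E × E) × (E × E) → G}
    (h2 : IsC1On df ddf (U ×ˢ univ)) {x : E} (hx : x ∈ U) (u v : E) :
    ddf ((x, u), (v, 0)) = ddf ((x, v), (u, 0)) := by
  -- Both sides are limits of the same second difference quotient, up to exchanging `u` and `v`.
  have key : ∀ (ℓ : StrongDual ℝ G) (u v : E), Tendsto (fun t : ℝ => t⁻¹ * (t⁻¹ *
      ℓ (f (x + t • u + t • v) - f (x + t • u) - f (x + t • v) + f x)))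
      (𝓝[>] 0) (𝓝 (ℓ (ddf ((x, v), (u, 0))))) := by
    intro ℓ u v
    have hU : ∀ᶠ t : ℝ in 𝓝 0, ∀ s ∈ uIcc 0 t, x + t • u + s • v ∈ U ∧ x + s • v ∈ U := by
      have h1 : ∀ᶠ q : E × E in 𝓝 (x, v), q.1 ∈ U := continuousAt_fst.eventually
        (h.isOpen.mem_nhds hx)
      have h3 := eventually_segment h1
      have h4 : Tendsto (fun t : ℝ => (t, x + t • u, v)) (𝓝 0) (𝓝 (0, x, v)) :=
        tendsto_id.prodMk_nhds ((tendsto_line x u).prodMk_nhds tendsto_const_nhds)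
      have h5 : Tendsto (fun t : ℝ => (t, x, v)) (𝓝 0) (𝓝 (0, x, v)) :=
        tendsto_id.prodMk_nhds (tendsto_const_nhds.prodMk_nhds tendsto_const_nhds)
      filter_upwards [h4.eventually h3, h5.eventually h3] with t ht ht' s hs
      exact ⟨ht s hs, ht' s hs⟩
    -- mean value theorem for `s ↦ f (x + t • u + s • v) - f (x + s • v)`
    have hex : ∀ᶠ t : ℝ in 𝓝[>] 0, ∃ s ∈ Ioo 0 t,
        ℓ (df (x + t • u + s • v, v) - df (x + s • v, v)) =
          t⁻¹ * ℓ (f (x + t • u + t • v) - f (x + t • u) - f (x + t • v) + f x) := by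
      filter_upwards [self_mem_nhdsWithin, nhdsWithin_le_nhds hU] with t ht htU
      have ht0 : 0 < t := ht
      rw [uIcc_of_le ht0.le] at htU
      have hd : ∀ s ∈ Icc 0 t, HasDerivAt (fun s => ℓ (f (x + t • u + s • v) - f (x + s • v)))
          (ℓ (df (x + t • u + s • v, v) - df (x + s • v, v))) s := fun s hs =>
        hasDirDeriv_iff_hasDerivAt.1
          ((((h.hasDirDeriv _ (htU s hs).1 v).line).sub
            ((h.hasDirDeriv _ (htU s hs).2 v).line)).clm_comp ℓ)
      obtain ⟨s, hs, hseq⟩ := exists_hasDerivAt_eq_slope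
        (fun s => ℓ (f (x + t • u + s • v) - f (x + s • v))) _ ht0
        (fun s hs => (hd s hs).continuousAt.continuousWithinAt)
        (fun s hs => hd s (Ioo_subset_Icc_self hs))
      refine ⟨s, hs, ?_⟩
      rw [hseq]
      simp only [sub_zero, zero_smul, add_zero, div_eq_inv_mul, ← map_sub]
      congr 2
      abel
    choose! s hs hseq using fun (t : ℝ) (ht : ∃ s ∈ Ioo 0 t,
        ℓ (df (x + t • u + s • v, v) - df (x + s • v, v)) =
          t⁻¹ * ℓ (f (x + t • u + t • v) - f (x + t • u) - f (x + t • v) + f x)) => ht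
    have hs0 : Tendsto s (𝓝[>] 0) (𝓝 0) := by
      refine tendsto_of_tendsto_of_tendsto_of_le_of_le' tendsto_const_nhds
        (tendsto_id.mono_left nhdsWithin_le_nhds) ?_ ?_
      · filter_upwards [hex] with t ht using (hs t ht).1.le
      · filter_upwards [hex] with t ht using (hs t ht).2.le
    have h6 := h2.tendsto_of_tendsto (x := (x, v)) (u := (u, 0)) ⟨hx, trivial⟩
      (l := 𝓝[>] 0) (s := fun t => t) (y := fun t => (x + s t • v, v)) (w := fun _ => (u, 0))
      (tendsto_id.mono_left (nhdsGT_le_nhdsNE 0))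
      (((tendsto_line x v).comp hs0).prodMk_nhds tendsto_const_nhds) tendsto_const_nhds
    refine ((ℓ.continuous.tendsto _).comp h6).congr' ?_
    filter_upwards [hex] with t ht
    rw [← hseq t ht]
    simp [add_right_comm]
  by_contra hne
  obtain ⟨ℓ, hℓ⟩ := geometric_hahn_banach_point_point hne
  refine hℓ.ne (tendsto_nhds_unique (key ℓ v u) ((key ℓ u v).congr fun t => ?_))
  congr 4
  rw [add_right_comm]
  abel

end C1

/-! ### Maps of class `C^n` -/

section KellerOn

variable {E : Type u} [AddCommGroup E] [Module ℝ E] [TopologicalSpace E]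
  {G : Type v} [AddCommGroup G] [Module ℝ G] [TopologicalSpace G]

theorem KellerOn.continuousOn {n : ℕ} {f : E → G} {U : Set E} (h : KellerOn n f U) :
    ContinuousOn f U := by
  cases n with
  | zero => exact h
  | succ n => exact h.1

theorem KellerOn.exists_deriv {n : ℕ} {f : E → G} {U : Set E} (h : KellerOn (n + 1) f U)
    (hU : IsOpen U) : ∃ df, IsC1On f df U ∧ KellerOn n df (U ×ˢ univ) := by
  obtain ⟨hf, df, hd, hdf⟩ := h
  exact ⟨df, ⟨hU, hf, hd, hdf.continuousOn⟩, hdf⟩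

theorem IsC1On.kellerOn {n : ℕ} {f : E → G} {df : E × E → G} {U : Set E} (h : IsC1On f df U)
    (hd : KellerOn n df (U ×ˢ univ)) : KellerOn (n + 1) f U :=
  ⟨h.continuousOn, df, h.hasDirDeriv, hd⟩

theorem IsC1On.dirDeriv_eq [T2Space G] {f : E → G} {df : E × E → G} {U : Set E}
    (h : IsC1On f df U) {x : E} (hx : x ∈ U) (v : E) : dirDeriv f x v = df (x, v) :=
  (h.hasDirDeriv x hx v).dirDeriv_eq

theorem KellerOn.congr [ContinuousAdd E] [ContinuousSMul ℝ E] {n : ℕ} {f g : E → G} {U : Set E}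
    (h : KellerOn n f U) (hU : IsOpen U) (hfg : EqOn f g U) : KellerOn n g U := by
  cases n with
  | zero => exact ContinuousOn.congr h hfg.symm
  | succ n =>
    obtain ⟨hf, df, hd, hdf⟩ := h
    exact ⟨hf.congr hfg.symm, df, fun p hp v => HasDirDeriv.congr_of_eventuallyEq (hd p hp v)
      (hfg.eventuallyEq_of_mem (hU.mem_nhds hp)), hdf⟩

theorem KellerOn.deriv [ContinuousAdd E] [ContinuousSMul ℝ E] [T2Space G] {n : ℕ} {f : E → G}
    {df : E × E → G} {U : Set E} (h : KellerOn (n + 1) f U) (hf : IsC1On f df U) :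
    KellerOn n df (U ×ˢ univ) := by
  obtain ⟨_, dg, hd, hdg⟩ := h
  exact hdg.congr (hf.isOpen.prod isOpen_univ)
    fun q hq => HasDirDeriv.unique (hd q.1 hq.1 q.2) (hf.hasDirDeriv q.1 hq.1 q.2)

theorem KellerOn.mono {n : ℕ} : ∀ {E : Type u} [AddCommGroup E] [Module ℝ E] [TopologicalSpace E]
    {f : E → G} {U V : Set E}, KellerOn n f U → V ⊆ U → KellerOn n f V := by
  induction n with
  | zero => intro E _ _ _ f U V h hV; exact ContinuousOn.mono h hV
  | succ n ih =>
    intro E _ _ _ f U V h hV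
    obtain ⟨hf, df, hd, hdf⟩ := h
    exact ⟨hf.mono hV, df, fun p hp => hd p (hV hp), ih hdf (prod_mono hV Subset.rfl)⟩

theorem KellerOn.of_succ {n : ℕ} : ∀ {E : Type u} [AddCommGroup E] [Module ℝ E]
    [TopologicalSpace E] {f : E → G} {U : Set E}, KellerOn (n + 1) f U → KellerOn n f U := by
  induction n with
  | zero => intro E _ _ _ f U h; exact h.1
  | succ n ih =>
    intro E _ _ _ f U h
    obtain ⟨hf, df, hd, hdf⟩ := h
    exact ⟨hf, df, hd, ih hdf⟩

theorem KellerOn.of_le {m n : ℕ} {f : E → G} {U : Set E} (h : KellerOn n f U) (hmn : m ≤ n) :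
    KellerOn m f U := by
  induction n, hmn using Nat.le_induction with
  | base => exact h
  | succ n _ ih => exact ih h.of_succ

theorem kellerOn_clm {n : ℕ} : ∀ {E : Type u} [AddCommGroup E] [Module ℝ E] [TopologicalSpace E]
    (L : E →L[ℝ] G) (U : Set E), KellerOn n L U := by
  induction n with
  | zero => intro E _ _ _ L U; exact L.continuous.continuousOn
  | succ n ih =>
    intro E _ _ _ L U
    exact ⟨L.continuous.continuousOn, fun q => L q.2, fun p _ v => hasDirDeriv_clm L p v,
      ih (L.comp (ContinuousLinearMap.snd ℝ E E)) _⟩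

theorem kellerOn_const {n : ℕ} : ∀ {E : Type u} [AddCommGroup E] [Module ℝ E] [TopologicalSpace E]
    (c : G) (U : Set E), KellerOn n (fun _ => c) U := by
  have h0 : ∀ (n : ℕ) {E : Type u} [AddCommGroup E] [Module ℝ E] [TopologicalSpace E]
      (U : Set E), KellerOn n (fun _ : E => (0 : G)) U := fun n {E} _ _ _ U =>
    kellerOn_clm (0 : E →L[ℝ] G) U
  intro E _ _ _ c U
  cases n with
  | zero => exact continuousOn_const
  | succ n => exact ⟨continuousOn_const, fun _ => 0, fun p _ v => hasDirDeriv_const c p v, h0 n _⟩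

theorem KellerOn.prodMk {G' : Type w} [AddCommGroup G'] [Module ℝ G'] [TopologicalSpace G']
    {n : ℕ} : ∀ {E : Type u} [AddCommGroup E] [Module ℝ E] [TopologicalSpace E]
    {f : E → G} {g : E → G'} {U : Set E}, KellerOn n f U → KellerOn n g U →
      KellerOn n (fun x => (f x, g x)) U := by
  induction n with
  | zero => intro E _ _ _ f g U hf hg; exact ContinuousOn.prodMk hf hg
  | succ n ih =>
    intro E _ _ _ f g U hf hg
    obtain ⟨hf, df, hdf, hdf'⟩ := hf
    obtain ⟨hg, dg, hdg, hdg'⟩ := hg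
    exact ⟨hf.prodMk hg, fun q => (df q, dg q),
      fun p hp v => HasDirDeriv.prodMk (hdf p hp v) (hdg p hp v), ih hdf' hdg'⟩

theorem KellerOn.clm_comp {G' : Type w} [AddCommGroup G'] [Module ℝ G'] [TopologicalSpace G']
    (L : G →L[ℝ] G') {n : ℕ} : ∀ {E : Type u} [AddCommGroup E] [Module ℝ E] [TopologicalSpace E]
    {f : E → G} {U : Set E}, KellerOn n f U → KellerOn n (fun x => L (f x)) U := by
  induction n with
  | zero => intro E _ _ _ f U hf; exact L.continuous.comp_continuousOn hf
  | succ n ih =>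
    intro E _ _ _ f U hf
    obtain ⟨hf, df, hdf, hdf'⟩ := hf
    exact ⟨L.continuous.comp_continuousOn hf, fun q => L (df q),
      fun p hp v => HasDirDeriv.clm_comp (hdf p hp v) L, ih hdf'⟩

theorem KellerOn.sub [IsTopologicalAddGroup G] {n : ℕ} {f g : E → G} {U : Set E}
    (hf : KellerOn n f U) (hg : KellerOn n g U) : KellerOn n (fun x => f x - g x) U :=
  (hf.prodMk hg).clm_comp (ContinuousLinearMap.fst ℝ G G - ContinuousLinearMap.snd ℝ G G)

theorem KellerOn.add [IsTopologicalAddGroup G] {n : ℕ} {f g : E → G} {U : Set E}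
    (hf : KellerOn n f U) (hg : KellerOn n g U) : KellerOn n (fun x => f x + g x) U :=
  (hf.prodMk hg).clm_comp (ContinuousLinearMap.fst ℝ G G + ContinuousLinearMap.snd ℝ G G)

omit [TopologicalSpace E] in
/-- With an embedding `L` of a factor of a product, this computes partial derivatives. -/
theorem HasDirDeriv.comp_affine {P : Type w} [AddCommGroup P] [Module ℝ P] {f : E → G}
    (L : P →ₗ[ℝ] E) (c : E) {p v : P} {y : G} (h : HasDirDeriv f (c + L p) (L v) y) :
    HasDirDeriv (fun x => f (c + L x)) p v y := by
  refine h.congr fun s => ?_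
  simp [add_assoc]

theorem KellerOn.comp_affine {n : ℕ} : ∀ {P : Type w} [AddCommGroup P] [Module ℝ P]
    [TopologicalSpace P] {E : Type u} [AddCommGroup E] [Module ℝ E] [TopologicalSpace E]
    [ContinuousAdd E] {f : E → G} {U : Set E} (_ : KellerOn n f U) (L : P →L[ℝ] E) (c : E)
    {V : Set P} (_ : ∀ x ∈ V, c + L x ∈ U), KellerOn n (fun x => f (c + L x)) V := by
  induction n with
  | zero =>
    intro P _ _ _ E _ _ _ _ f U hf L c V hV
    exact ContinuousOn.comp hf (by fun_prop) hV
  | succ n ih =>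
    intro P _ _ _ E _ _ _ _ f U hf L c V hV
    obtain ⟨hf, df, hdf, hdf'⟩ := hf
    refine ⟨ContinuousOn.comp hf (by fun_prop) hV, fun q => df (c + L q.1, L q.2),
      fun p hp v => HasDirDeriv.comp_affine (L : P →ₗ[ℝ] E) c (hdf _ (hV p hp) (L v)), ?_⟩
    have := ih hdf' (L.prodMap L) (c, 0) (V := V ×ˢ univ) (fun x hx => ⟨hV _ hx.1, trivial⟩)
    simpa [Prod.map] using this

theorem KellerOn.comp_clm {P : Type w} [AddCommGroup P] [Module ℝ P] [TopologicalSpace P]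
    [ContinuousAdd E] {n : ℕ} {f : E → G} {U : Set E} (h : KellerOn n f U) (L : P →L[ℝ] E)
    {V : Set P} (hV : ∀ x ∈ V, L x ∈ U) : KellerOn n (fun x => f (L x)) V := by
  simpa using h.comp_affine L 0 (V := V) (by simpa using hV)

theorem IsC1On.comp_affine {P : Type w} [AddCommGroup P] [Module ℝ P]
    [TopologicalSpace P] [ContinuousAdd E] {f : E → G} {df : E × E → G} {U : Set E}
    (h : IsC1On f df U) (L : P →L[ℝ] E) (c : E) {V : Set P} (hVo : IsOpen V)
    (hV : ∀ x ∈ V, c + L x ∈ U) :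
    IsC1On (fun x => f (c + L x)) (fun q => df (c + L q.1, L q.2)) V where
  isOpen := hVo
  continuousOn := h.continuousOn.comp (by fun_prop) hV
  hasDirDeriv p hp v := HasDirDeriv.comp_affine (L : P →ₗ[ℝ] E) c (h.hasDirDeriv _ (hV p hp) (L v))
  continuousOn_deriv := h.continuousOn_deriv.comp (by fun_prop) fun q hq => ⟨hV _ hq.1, trivial⟩

variable [IsTopologicalAddGroup G] [ContinuousSMul ℝ G] [LocallyConvexSpace ℝ G]

/-- Compositions of `C^n`-maps are `C^n`. -/
theorem KellerOn.comp {n : ℕ} : ∀ {P : Type w} [AddCommGroup P] [Module ℝ P] [TopologicalSpace P]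
    [ContinuousAdd P]
    {E : Type u} [AddCommGroup E] [Module ℝ E] [TopologicalSpace E]
    [IsTopologicalAddGroup E] [ContinuousSMul ℝ E] {g : E → G} {V : Set E} {f : P → E} {U : Set P}
    (_ : KellerOn n g V) (_ : KellerOn n f U) (_ : IsOpen V) (_ : MapsTo f U V),
      KellerOn n (fun x => g (f x)) U := by
  induction n with
  | zero =>
    intro P _ _ _ _ E _ _ _ _ _ g V f U hg hf _ hfU
    exact ContinuousOn.comp hg hf hfU
  | succ n ih =>
    intro P _ _ _ _ E _ _ _ _ _ g V f U hg hf hV hfU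
    obtain ⟨dg, hg1, hdg⟩ := hg.exists_deriv hV
    have hfn := hf.of_succ
    obtain ⟨hfc, df, hdf, hdf'⟩ := hf
    refine ⟨hg1.continuousOn.comp hfc hfU, fun q => dg (f q.1, df q),
      fun p hp v => hg1.hasDirDeriv_comp (hdf p hp v) (hfU hp), ?_⟩
    exact ih hdg ((hfn.comp_clm (ContinuousLinearMap.fst ℝ P P) (fun x hx => hx.1)).prodMk hdf')
      (hV.prod isOpen_univ) (fun q hq => ⟨hfU hq.1, trivial⟩)

end KellerOn

/-! ### Families of operators on a Banach space -/

section OperatorFamilies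

variable {P : Type u} [AddCommGroup P] [Module ℝ P] [TopologicalSpace P]
  [IsTopologicalAddGroup P] [ContinuousSMul ℝ P]
  {B : Type v} [NormedAddCommGroup B] [NormedSpace ℝ B]
  {B' : Type w} [NormedAddCommGroup B'] [NormedSpace ℝ B']

/-- A family of linear maps between normed spaces that is jointly `C^1` is continuous in the
operator norm. The reason is that the partial derivative of `A` with respect to `p` vanishes at
`b = 0` in the direction `0`, so that it is bounded by `1` for all directions near `0` and all `b`
in some ball: this uniform bound makes the mean value theorem work uniformly in `b`. -/
theorem eventually_norm_sub_le_of_isC1On {A : P × B → B'} {dA : (P × B) × (P × B) → B'} {U : Set P}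
    (hA : IsC1On A dA (U ×ˢ univ)) (hlin : ∀ p ∈ U, IsLinearMap ℝ fun b => A (p, b))
    {p₀ : P} (hp₀ : p₀ ∈ U) {ε : ℝ} (hε : 0 < ε) :
    ∀ᶠ p in 𝓝 p₀, p ∈ U ∧ ∀ b, ‖A (p, b) - A (p₀, b)‖ ≤ ε * ‖b‖ := by
  have hmem : ((p₀, (0 : B)) : P × B) ∈ U ×ˢ (univ : Set B) := ⟨hp₀, trivial⟩
  have h1 : ∀ᶠ z : (P × B) × (P × B) in 𝓝 ((p₀, 0), (0, 0)), z.1 ∈ U ×ˢ (univ : Set B) ∧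
      ‖dA z‖ ≤ 1 := by
    refine (continuousAt_fst.eventually (hA.isOpen.mem_nhds hmem)).and ?_
    have h2 := (hA.continuousAt_deriv hmem 0).norm.tendsto
    have h3 : dA ((p₀, 0), 0) = 0 := hA.deriv_zero hmem
    rw [h3, norm_zero] at h2
    exact h2.eventually (eventually_le_nhds one_pos)
  have h2 : ∀ᶠ z : (P × P) × B in 𝓝 ((p₀, 0), 0), (z.1.1, z.2) ∈ U ×ˢ (univ : Set B) ∧
      ‖dA ((z.1.1, z.2), (z.1.2, 0))‖ ≤ 1 := by
    have hc : Continuous fun z : (P × P) × B => ((z.1.1, z.2), (z.1.2, (0 : B))) := by fun_prop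
    exact (hc.tendsto ((p₀, 0), 0)).eventually h1
  rw [nhds_prod_eq] at h2
  obtain ⟨pa, ha, pb, hb, hab⟩ := eventually_prod_iff.1 h2
  obtain ⟨ρ, hρ, hball⟩ := Metric.eventually_nhds_iff.1 hb
  have h3 := eventually_segment ha
  rw [nhds_prod_eq] at h3
  obtain ⟨qa, hqa, qb, hqb, hqab⟩ := eventually_prod_iff.1 h3
  -- `p` is reached from `p₀` with the step `η` in the direction `η⁻¹ • (p - p₀)`, which is small
  obtain ⟨η, ⟨hη0, hηε⟩, hη⟩ : ∃ η ∈ Ioo 0 (ε * (ρ / 2)), qa η :=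
    (Filter.Eventually.and (Ioo_mem_nhdsGT (show (0 : ℝ) < ε * (ρ / 2) by positivity))
      (nhdsWithin_le_nhds hqa : ∀ᶠ t in 𝓝[>] (0 : ℝ), qa t)).exists
  have h4 : Tendsto (fun p : P => (p₀, η⁻¹ • (p - p₀))) (𝓝 p₀) (𝓝 (p₀, 0)) := by
    have : Continuous fun p : P => (p₀, η⁻¹ • (p - p₀)) := by fun_prop
    simpa using this.tendsto p₀
  have hU : IsOpen U := by
    have := hA.isOpen.preimage (f := fun p : P => (p, (0 : B))) (by fun_prop)
    simpa [preimage] using this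
  filter_upwards [h4.eventually hqb, hU.mem_nhds hp₀] with p hp hpU
  refine ⟨hpU, fun b => ?_⟩
  have h5 : ∀ b : B, ‖b‖ < ρ → ‖A (p, b) - A (p₀, b)‖ ≤ η := by
    intro b hb
    have hseg := hqab hη hp
    have hbb : dist b 0 < ρ := by simpa using hb
    have hder : ∀ t ∈ uIcc 0 η, HasDirDeriv (fun t : ℝ => A (p₀ + t • (η⁻¹ • (p - p₀)), b)) t 1
        (dA ((p₀ + t • (η⁻¹ • (p - p₀)), b), (η⁻¹ • (p - p₀), 0))) := by
      intro t ht
      have h6 := (hab (hseg t ht) (hball hbb)).1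
      have h7 := hA.hasDirDeriv (p₀ + t • (η⁻¹ • (p - p₀)), b) h6 (η⁻¹ • (p - p₀), 0)
      have h8 := HasDirDeriv.line (p := (p₀, b)) (v := (η⁻¹ • (p - p₀), (0 : B))) (t := t)
        (f := A) (by simpa using h7)
      simpa using h8
    have := slope_mem_of_hasDirDeriv_uIcc hη0.ne' hder Metric.isClosed_closedBall
      (convex_closedBall (0 : B') 1)
      (fun t ht => by simpa using (hab (hseg t ht) (hball hbb)).2)
    simp only [smul_smul, mul_inv_cancel₀ hη0.ne', one_smul, zero_smul, add_zero,
      add_sub_cancel, zero_mul, mem_closedBall_zero_iff, norm_smul, norm_inv, Real.norm_eq_abs,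
      abs_of_pos hη0] at this
    rwa [inv_mul_le_iff₀ hη0, mul_one] at this
  rcases eq_or_ne b 0 with rfl | hb0
  · simp [(hlin p hpU).map_zero, (hlin p₀ hp₀).map_zero]
  have hbn : 0 < ‖b‖ := norm_pos_iff.2 hb0
  set s : ℝ := ρ / 2 / ‖b‖ with hs
  have hs0 : 0 < s := by positivity
  have h6 := h5 (s • b) (by
    rw [norm_smul, Real.norm_eq_abs, abs_of_pos hs0, hs, div_mul_cancel₀ _ hbn.ne']
    linarith)
  rw [(hlin p hpU).map_smul, (hlin p₀ hp₀).map_smul, ← smul_sub, norm_smul, Real.norm_eq_abs,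
    abs_of_pos hs0] at h6
  have h7 : s * ‖A (p, b) - A (p₀, b)‖ ≤ s * (ε * ‖b‖) := by
    refine h6.trans (hηε.le.trans_eq ?_)
    rw [hs]
    field_simp
  exact le_of_mul_le_mul_left h7 hs0

variable [CompleteSpace B]

/-- The pointwise inverse of a family of operators on a Banach space that is jointly `C^1` and the
identity at `p₀` is, near `p₀`, as smooth as the family. -/
theorem exists_inverse_family {A : P × B → B} {dA : (P × B) × (P × B) → B} {U : Set P}
    (hA : IsC1On A dA (U ×ˢ univ)) (hlin : ∀ p ∈ U, IsLinearMap ℝ fun b => A (p, b))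
    {p₀ : P} (hp₀ : p₀ ∈ U) (hA₀ : ∀ b, A (p₀, b) = b) :
    ∃ V ⊆ U, IsOpen V ∧ p₀ ∈ V ∧ (∀ p ∈ V, ∀ b, ‖A (p, b) - b‖ ≤ 1 / 2 * ‖b‖) ∧
      ∃ J : P × B → B, (∀ p ∈ V, IsLinearMap ℝ fun b => J (p, b)) ∧
      (∀ p ∈ V, ∀ b, A (p, J (p, b)) = b ∧ J (p, A (p, b)) = b) ∧
      ∀ k, KellerOn (k + 1) A (U ×ˢ univ) → KellerOn (k + 1) J (V ×ˢ univ) := by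
  obtain ⟨V, hVs, hV, hpV⟩ := _root_.mem_nhds_iff.1
    (eventually_norm_sub_le_of_isC1On hA hlin hp₀ (ε := 1 / 2) (by norm_num))
  have hVU : V ⊆ U := fun p hp => (hVs hp).1
  have hVn : ∀ p ∈ V, ∀ b, ‖A (p, b) - b‖ ≤ 1 / 2 * ‖b‖ := fun p hp b => by
    simpa [hA₀] using (hVs hp).2 b
  have hex : ∀ p ∈ V, ∃ S : B →L[ℝ] B, ∀ b, A (p, S b) = b ∧ S (A (p, b)) = b := by
    intro p hp
    have hl := hlin p (hVU hp)
    let T : B →L[ℝ] B := LinearMap.mkContinuous (LinearMap.id - hl.mk' _) (1 / 2) fun b => by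
      rw [LinearMap.sub_apply, LinearMap.id_apply, IsLinearMap.mk'_apply, norm_sub_rev]
      exact hVn p hp b
    have hT : ‖T‖ < 1 :=
      (LinearMap.mkContinuous_norm_le _ (by norm_num) _).trans_lt (by norm_num)
    have hTA : ∀ b, ((Units.oneSub T hT : (B →L[ℝ] B)ˣ) : B →L[ℝ] B) b = A (p, b) := by
      intro b
      simp [T]
    refine ⟨((Units.oneSub T hT)⁻¹ : (B →L[ℝ] B)ˣ), fun b => ⟨?_, ?_⟩⟩
    · rw [← hTA, ← mul_apply_eq_comp, Units.mul_inv, one_apply_eq_self]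
    · rw [← hTA, ← mul_apply_eq_comp, Units.inv_mul, one_apply_eq_self]
  choose! S hS using hex
  refine ⟨V, hVU, hV, hpV, hVn, fun z => S z.1 z.2, fun p _ => (S p).toLinearMap.isLinear,
    hS, ?_⟩
  have hSn : ∀ p ∈ V, ∀ b, ‖S p b‖ ≤ 2 * ‖b‖ := by
    intro p hp b
    have h1 := hVn p hp (S p b)
    rw [(hS p hp b).1] at h1
    have h2 := norm_le_norm_add_norm_sub b (S p b)
    linarith
  have hopen : IsOpen (V ×ˢ (univ : Set B)) := hV.prod isOpen_univ
  have hcont : ContinuousOn (fun z : P × B => S z.1 z.2) (V ×ˢ univ) := by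
    rintro ⟨p₁, b₁⟩ ⟨hp₁, -⟩
    refine ContinuousAt.continuousWithinAt ?_
    rw [ContinuousAt, tendsto_iff_norm_sub_tendsto_zero]
    have hAc : ContinuousAt A (p₁, S p₁ b₁) := hA.continuousAt ⟨hVU hp₁, trivial⟩
    have h1 : Tendsto (fun z : P × B => (z.1, S p₁ b₁)) (𝓝 (p₁, b₁)) (𝓝 (p₁, S p₁ b₁)) :=
      continuousAt_fst.tendsto.prodMk_nhds tendsto_const_nhds
    have h2 : Tendsto (fun z : P × B => 2 * ‖z.2 - A (z.1, S p₁ b₁)‖) (𝓝 (p₁, b₁)) (𝓝 0) := by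
      have h3 := ((continuousAt_snd (p := (p₁, b₁))).tendsto.sub
        (hAc.tendsto.comp h1)).norm.const_mul 2
      simpa [(hS p₁ hp₁ b₁).1] using h3
    refine squeeze_zero' (Eventually.of_forall fun _ => norm_nonneg _) ?_ h2
    filter_upwards [continuousAt_fst.eventually (hV.mem_nhds hp₁)] with z hz
    have h4 : S z.1 z.2 - S p₁ b₁ = S z.1 (z.2 - A (z.1, S p₁ b₁)) := by
      rw [map_sub, (hS z.1 hz _).2]
    simp only [h4]
    exact hSn z.1 hz _
  -- the derivative of the inverse, in terms of the inverse: this gives the smoothness inductively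
  let dJ : (P × B) × (P × B) → B := fun z =>
    S z.1.1 (z.2.2 - dA ((z.1.1, S z.1.1 z.1.2), (z.2.1, 0)))
  have hder : ∀ z ∈ V ×ˢ (univ : Set B), ∀ v : P × B,
      HasDirDeriv (fun z : P × B => S z.1 z.2) z v (dJ (z, v)) := by
    rintro ⟨p, b⟩ ⟨hp, -⟩ ⟨q, c⟩
    have h1 := hA.hasDirDeriv (p, S p b) ⟨hVU hp, trivial⟩ (q, 0)
    have h2 : Tendsto (fun h : ℝ => (p + h • q,
        c - h⁻¹ • (A ((p, S p b) + h • (q, 0)) - A (p, S p b)))) (𝓝[≠] 0)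
        (𝓝 (p, c - dA ((p, S p b), (q, 0)))) :=
      ((tendsto_line p q).mono_left nhdsWithin_le_nhds).prodMk_nhds (tendsto_const_nhds.sub h1)
    have h3 := (hcont.continuousAt (hopen.mem_nhds (x := (p, c - dA ((p, S p b), (q, 0))))
      ⟨hp, trivial⟩)).tendsto.comp h2
    refine h3.congr' ?_
    filter_upwards [self_mem_nhdsWithin, ((tendsto_line p q).mono_left
      nhdsWithin_le_nhds).eventually (hV.mem_nhds hp)] with h hh hpV
    have hh0 : h ≠ 0 := hh
    have h4 : S (p + h • q) (A (p + h • q, S p b)) = S p b := (hS _ hpV _).2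
    simp only [Function.comp, Prod.smul_mk, Prod.mk_add_mk, smul_zero, add_zero, map_sub, map_smul,
      map_add, (hS p hp b).1, h4, smul_sub, smul_add, smul_smul, inv_mul_cancel₀ hh0, one_smul]
    abel
  intro k hk
  have hdA := hk.deriv hA
  have step : ∀ j ≤ k + 1, KellerOn j (fun z : P × B => S z.1 z.2) (V ×ˢ univ) := by
    intro j
    induction j with
    | zero => intro _; exact hcont
    | succ j ih =>
      intro hj
      have hJ := ih (by omega)
      refine ⟨hcont, dJ, hder, ?_⟩
      have e1 : KellerOn j (fun z : (P × B) × (P × B) => z.1.1) ((V ×ˢ univ) ×ˢ univ) :=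
        kellerOn_clm ((ContinuousLinearMap.fst ℝ P B).comp
          (ContinuousLinearMap.fst ℝ (P × B) (P × B))) _
      have e2 : KellerOn j (fun z : (P × B) × (P × B) => z.2.2) ((V ×ˢ univ) ×ˢ univ) :=
        kellerOn_clm ((ContinuousLinearMap.snd ℝ P B).comp
          (ContinuousLinearMap.snd ℝ (P × B) (P × B))) _
      have e3 : KellerOn j (fun z : (P × B) × (P × B) => (z.2.1, (0 : B)))
          ((V ×ˢ univ) ×ˢ univ) :=
        kellerOn_clm ((ContinuousLinearMap.inl ℝ P B).comp ((ContinuousLinearMap.fst ℝ P B).comp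
          (ContinuousLinearMap.snd ℝ (P × B) (P × B)))) _
      have e4 : KellerOn j (fun z : (P × B) × (P × B) => S z.1.1 z.1.2) ((V ×ˢ univ) ×ˢ univ) :=
        hJ.comp_clm (ContinuousLinearMap.fst ℝ (P × B) (P × B)) (fun z hz => hz.1)
      have e5 := (hdA.of_le (show j ≤ k by omega)).comp ((e1.prodMk e4).prodMk e3)
        (hA.isOpen.prod isOpen_univ) (fun z hz => ⟨⟨hVU hz.1.1, trivial⟩, trivial⟩)
      exact hJ.comp (e1.prodMk (e2.sub e5)) hopen (fun z hz => ⟨hz.1.1, trivial⟩)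
  exact step (k + 1) le_rfl

end OperatorFamilies

/-! ### Implicit functions with values in a Banach space -/

section Implicit

variable {P : Type u} [AddCommGroup P] [Module ℝ P] [TopologicalSpace P]
  [IsTopologicalAddGroup P] [ContinuousSMul ℝ P]
  {B : Type v} [NormedAddCommGroup B] [NormedSpace ℝ B] [CompleteSpace B]

/-- Implicit function theorem for maps from a product of a topological vector space of parameters
and a Banach space to this Banach space. For fixed `p`, the equation is solved by contraction; the
solution is differentiated by means of `‖b - c‖ ≤ 2 * ‖G (p, b) - G (p, c)‖`. -/
theorem exists_implicit_function {k : ℕ} {G : P × B → B} {dG : (P × B) × (P × B) → B}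
    {U : Set (P × B)} (hG : IsC1On G dG U) (hk : KellerOn (k + 2) G U) {p₀ : P}
    (hU : (p₀, 0) ∈ U) (hG0 : G (p₀, 0) = 0) (hdG0 : ∀ w, dG ((p₀, 0), (0, w)) = w) :
    ∃ N : Set P, IsOpen N ∧ p₀ ∈ N ∧ ∃ ρ > 0, N ×ˢ Metric.ball 0 ρ ⊆ U ∧ ∃ lam : P → B,
      KellerOn (k + 2) lam N ∧ ∀ p ∈ N, lam p ∈ Metric.ball 0 ρ ∧ G (p, lam p) = 0 ∧
        ∀ b ∈ Metric.ball (0 : B) ρ, G (p, b) = 0 → b = lam p := by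
  -- the partial derivative in the Banach direction and its inverse
  set A : (P × B) × B → B := fun z => dG (z.1, (0, z.2)) with hAdef
  have hdG : KellerOn (k + 1) dG (U ×ˢ univ) := hk.deriv hG
  have hAk : KellerOn (k + 1) A (U ×ˢ univ) :=
    hdG.comp_clm ((ContinuousLinearMap.id ℝ (P × B)).prodMap (ContinuousLinearMap.inr ℝ P B))
      (fun z hz => ⟨hz.1, trivial⟩)
  obtain ⟨dA, hA, -⟩ := hAk.exists_deriv (hG.isOpen.prod isOpen_univ)
  have hAlin : ∀ z ∈ U, IsLinearMap ℝ fun b => A (z, b) := fun z hz =>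
    ⟨fun b c => by
      have := hG.deriv_add hz (0, b) (0, c)
      simpa [hAdef] using this, fun r b => by
      have := hG.deriv_smul hz r (0, b)
      simpa [hAdef] using this⟩
  obtain ⟨V, hVU, hV, hpV, hVn, J, hJlin, hJ, hJk⟩ :=
    exists_inverse_family hA hAlin hU (fun b => hdG0 b)
  have hJk := hJk k hAk
  obtain ⟨N₁, hN₁, V₁, hV₁, hNV⟩ := mem_nhds_prod_iff.1 (hV.mem_nhds hpV)
  obtain ⟨ρ, hρ, hρV⟩ := Metric.mem_nhds_iff.1 hV₁
  have hsub : ∀ p ∈ N₁, ∀ b ∈ Metric.ball (0 : B) ρ, (p, b) ∈ V := fun p hp b hb =>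
    hNV ⟨hp, hρV hb⟩
  have hsmall : ∀ᶠ p in 𝓝 p₀, ‖G (p, 0)‖ < ρ / 4 := by
    have h1 : Tendsto (fun p : P => (p, (0 : B))) (𝓝 p₀) (𝓝 (p₀, 0)) :=
      tendsto_id.prodMk_nhds tendsto_const_nhds
    have h2 := ((hG.continuousAt hU).tendsto.comp h1).norm
    simp only [hG0, norm_zero] at h2
    exact h2.eventually (gt_mem_nhds (show (0 : ℝ) < ρ / 4 by positivity))
  obtain ⟨N, hNs, hN, hpN⟩ := _root_.mem_nhds_iff.1 (inter_mem hN₁ hsmall)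
  have hNV' : ∀ p ∈ N, ∀ b ∈ Metric.ball (0 : B) ρ, (p, b) ∈ V := fun p hp =>
    hsub p (hNs hp).1
  -- `b ↦ G (p, b)` differs from the identity by a contraction
  have hcontr : ∀ p ∈ N, ∀ b ∈ Metric.ball (0 : B) ρ, ∀ c ∈ Metric.ball (0 : B) ρ,
      ‖G (p, b) - G (p, c) - (b - c)‖ ≤ 1 / 2 * ‖b - c‖ := by
    intro p hp b hb c hc
    have hseg : ∀ t ∈ Icc (0 : ℝ) 1, c + t • (b - c) ∈ Metric.ball (0 : B) ρ := fun t ht =>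
      (convex_ball (0 : B) ρ).add_smul_sub_mem hc hb ht
    have hder : ∀ t ∈ Icc (0 : ℝ) 1, HasDirDeriv (fun t : ℝ => G (p, c + t • (b - c))) t 1
        (A ((p, c + t • (b - c)), b - c)) := by
      intro t ht
      have h1 := hG.hasDirDeriv _ (hVU (hNV' p hp _ (hseg t ht))) (0, b - c)
      have h2 := HasDirDeriv.line (p := (p, c)) (v := ((0 : P), b - c)) (t := t) (f := G)
        (by simpa using h1)
      simpa using h2
    have h3 := slope_mem_of_hasDirDeriv one_pos hder Metric.isClosed_closedBall
      (convex_closedBall (b - c) (1 / 2 * ‖b - c‖)) (fun t ht => by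
        rw [mem_closedBall_iff_norm]
        exact hVn _ (hNV' p hp _ (hseg t ht)) _)
    rw [mem_closedBall_iff_norm] at h3
    simpa using h3
  have hexp : ∀ p ∈ N, ∀ b ∈ Metric.ball (0 : B) ρ, ∀ c ∈ Metric.ball (0 : B) ρ,
      ‖b - c‖ ≤ 2 * ‖G (p, b) - G (p, c)‖ := by
    intro p hp b hb c hc
    have h1 := hcontr p hp b hb c hc
    have h2 := norm_le_norm_add_norm_sub (G (p, b) - G (p, c)) (b - c)
    linarith
  have hex : ∀ p ∈ N, ∃ b ∈ Metric.ball (0 : B) ρ, G (p, b) = 0 := by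
    intro p hp
    have happ : ApproximatesLinearOn (fun b => G (p, b)) (ContinuousLinearMap.id ℝ B)
        (Metric.ball 0 ρ) (1 / 2) := fun b hb c hc => by
      simpa using hcontr p hp b hb c hc
    have hsurj := happ.surjOn_closedBall_of_nonlinearRightInverse
      ⟨id, 1, fun y => by simp, fun y => rfl⟩ (ε := ρ / 2) (b := 0) (by positivity)
      (Metric.closedBall_subset_ball (by linarith))
    obtain ⟨b, hb, hb0⟩ := hsurj (show (0 : B) ∈ _ by
      rw [mem_closedBall_iff_norm, zero_sub, norm_neg]
      have h1 : ‖G (p, 0)‖ < ρ / 4 := (hNs hp).2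
      refine h1.le.trans (le_of_eq ?_)
      simp
      ring)
    exact ⟨b, Metric.closedBall_subset_ball (by linarith) hb, hb0⟩
  choose! lam hlam hlam0 using hex
  have hcont : ContinuousOn lam N := by
    intro p₁ hp₁
    refine ContinuousAt.continuousWithinAt ?_
    rw [ContinuousAt, tendsto_iff_norm_sub_tendsto_zero]
    have h1 : Tendsto (fun p : P => (p, lam p₁)) (𝓝 p₁) (𝓝 (p₁, lam p₁)) :=
      tendsto_id.prodMk_nhds tendsto_const_nhds
    have h2 := (((hG.continuousAt (hVU (hNV' p₁ hp₁ _ (hlam p₁ hp₁)))).tendsto.comp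
      h1).norm).const_mul 2
    simp only [hlam0 p₁ hp₁, norm_zero, mul_zero] at h2
    refine squeeze_zero' (Eventually.of_forall fun _ => norm_nonneg _) ?_ h2
    filter_upwards [hN.mem_nhds hp₁] with p hp
    have := hexp p hp _ (hlam p hp) _ (hlam p₁ hp₁)
    simpa [hlam0 p hp] using this
  have hder : ∀ p ∈ N, ∀ q : P,
      HasDirDeriv lam p q (-J ((p, lam p), dG ((p, lam p), (q, 0)))) := by
    intro p hp q
    have hpV := hNV' p hp _ (hlam p hp)
    set μ := -J ((p, lam p), dG ((p, lam p), (q, 0))) with hμ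
    have hzero : dG ((p, lam p), (q, μ)) = 0 := by
      have h1 := hG.deriv_add (hVU hpV) (q, 0) (0, μ)
      have h2 : dG ((p, lam p), (0, μ)) = -dG ((p, lam p), (q, 0)) := by
        change A ((p, lam p), μ) = _
        rw [hμ, (hAlin _ (hVU hpV)).map_neg, (hJ _ hpV _).1]
      rw [h2] at h1
      simpa using h1
    have h1 := (hG.hasDirDeriv _ (hVU hpV) (q, μ)).norm.const_mul 2
    rw [hzero, norm_zero, mul_zero] at h1
    rw [HasDirDeriv, tendsto_iff_norm_sub_tendsto_zero]
    refine squeeze_zero' (Eventually.of_forall fun _ => norm_nonneg _) ?_ h1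
    filter_upwards [self_mem_nhdsWithin,
      ((tendsto_line p q).mono_left nhdsWithin_le_nhds).eventually (hN.mem_nhds hp),
      ((tendsto_line (lam p) μ).mono_left nhdsWithin_le_nhds).eventually
        (Metric.isOpen_ball.mem_nhds (hlam p hp))] with h hh hpN hball
    have hh0 : h ≠ 0 := hh
    have h2 := hexp _ hpN _ (hlam _ hpN) _ hball
    rw [hlam0 _ hpN, zero_sub, norm_neg] at h2
    have h3 : h⁻¹ • (lam (p + h • q) - lam p) - μ =
        h⁻¹ • (lam (p + h • q) - (lam p + h • μ)) := by
      simp only [smul_sub, smul_add, smul_smul, inv_mul_cancel₀ hh0, one_smul]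
      abel
    rw [h3, norm_smul, hlam0 p hp, sub_zero, norm_smul, mul_left_comm]
    exact mul_le_mul_of_nonneg_left (by simpa using h2) (norm_nonneg _)
  refine ⟨N, hN, hpN, ρ, hρ, fun z hz => hVU (hNV' z.1 hz.1 z.2 hz.2), lam, ?_,
    fun p hp => ⟨hlam p hp, hlam0 p hp, fun b hb hb0 => ?_⟩⟩
  · have step : ∀ j ≤ k + 2, KellerOn j lam N := by
      intro j
      induction j with
      | zero => intro _; exact hcont
      | succ j ih =>
        intro hj
        have hl := ih (by omega)
        refine ⟨hcont, fun z => -J ((z.1, lam z.1), dG ((z.1, lam z.1), (z.2, 0))), hder, ?_⟩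
        have e1 : KellerOn j (fun z : P × P => z.1) (N ×ˢ univ) :=
          kellerOn_clm (ContinuousLinearMap.fst ℝ P P) _
        have e2 : KellerOn j (fun z : P × P => (z.2, (0 : B))) (N ×ˢ univ) :=
          kellerOn_clm ((ContinuousLinearMap.inl ℝ P B).comp (ContinuousLinearMap.snd ℝ P P)) _
        have e3 := e1.prodMk (hl.comp_clm (ContinuousLinearMap.fst ℝ P P)
          (V := N ×ˢ univ) (fun z hz => hz.1))
        have hm : MapsTo (fun z : P × P => (z.1, lam z.1)) (N ×ˢ univ) V := fun z hz =>
          hNV' z.1 hz.1 _ (hlam z.1 hz.1)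
        have e4 := (hdG.of_le (show j ≤ k + 1 by omega)).comp (e3.prodMk e2)
          (hG.isOpen.prod isOpen_univ) (fun z hz => ⟨hVU (hm hz), trivial⟩)
        have e5 := (hJk.of_le (show j ≤ k + 1 by omega)).comp (e3.prodMk e4)
          (hV.prod isOpen_univ) (fun z hz => ⟨hm hz, trivial⟩)
        exact e5.clm_comp (-ContinuousLinearMap.id ℝ B)
    exact step (k + 2) le_rfl
  · have := hexp p hp b hb _ (hlam p hp)
    rw [hb0, hlam0 p hp, sub_zero, norm_zero, mul_zero] at this
    exact sub_eq_zero.1 (norm_le_zero_iff.1 this)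

end Implicit

/-! ### Linear differential equations -/

section LinearODE

variable {B : Type u} [NormedAddCommGroup B] [NormedSpace ℝ B] [CompleteSpace B]

/-- Linear differential equations whose coefficients are only strongly continuous in time. For
`K * T ≤ 1 / 2` solutions stay in the ball of radius `2 * T * ‖w₀‖`, and a single application of
the Picard–Lindelöf theorem suffices. -/
theorem exists_linear_ode_solution {c : ℝ → B → B} {T K : ℝ} (hT : 0 < T) (hK : 0 ≤ K)
    (hKT : K * T ≤ 1 / 2)
    (hlin : ∀ t ∈ Icc (-T) T, IsLinearMap ℝ (c t))
    (hcont : ∀ w, ContinuousOn (fun t => c t w) (Icc (-T) T))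
    (hbound : ∀ t ∈ Icc (-T) T, ∀ w, ‖c t w‖ ≤ K * ‖w‖) (w₀ : B) :
    ∃ w : ℝ → B, w 0 = 0 ∧ ∀ t ∈ Ioo (-T) T, HasDerivAt w (w₀ - c t (w t)) t := by
  have hT0 : (0 : ℝ) ∈ Icc (-T) T := ⟨by linarith, hT.le⟩
  have hPL : IsPicardLindelof (fun t w => w₀ - c t w) (⟨0, hT0⟩ : Icc (-T) T) (0 : B)
      (Real.toNNReal (2 * T * ‖w₀‖)) 0 (Real.toNNReal (2 * ‖w₀‖)) (Real.toNNReal K) := by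
    refine ⟨fun t ht => ?_, fun w _ => continuousOn_const.sub (hcont w), fun t ht w hw => ?_, ?_⟩
    · refine LipschitzOnWith.of_dist_le_mul fun x _ y _ => ?_
      rw [dist_eq_norm, dist_eq_norm, sub_sub_sub_cancel_left, ← (hlin t ht).map_sub,
        Real.coe_toNNReal _ hK, norm_sub_rev x y]
      exact hbound t ht _
    · rw [mem_closedBall_zero_iff, Real.coe_toNNReal _ (by positivity)] at hw
      rw [Real.coe_toNNReal _ (by positivity)]
      have h1 := hbound t ht w
      have h2 := norm_sub_le w₀ (c t w)
      have h3 : K * ‖w‖ ≤ K * (2 * T * ‖w₀‖) := mul_le_mul_of_nonneg_left hw hK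
      have h4 : K * (2 * T * ‖w₀‖) ≤ ‖w₀‖ := by nlinarith [norm_nonneg w₀]
      linarith
    · rw [Real.coe_toNNReal _ (by positivity), Real.coe_toNNReal _ (by positivity)]
      simp only [sub_zero, zero_sub, neg_neg, max_self, NNReal.coe_zero]
      linarith
  obtain ⟨w, hw0, hw⟩ := hPL.exists_eq_forall_mem_Icc_hasDerivWithinAt₀
  exact ⟨w, hw0, fun t ht => (hw t (Ioo_subset_Icc_self ht)).hasDerivAt (Icc_mem_nhds ht.1 ht.2)⟩

end LinearODE

/-! ### Local flows -/

section Shift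

variable {E : Type u} [AddCommGroup E] [Module ℝ E]
  {G : Type v} [AddCommGroup G] [Module ℝ G] [TopologicalSpace G]

theorem HasDirDeriv.of_linear_right {P : Type w} [AddCommGroup P] [Module ℝ P] {A : P × E → G}
    {p : P} (h : IsLinearMap ℝ fun b => A (p, b)) (b w : E) :
    HasDirDeriv A (p, b) (0, w) (A (p, w)) := by
  refine tendsto_const_nhds.congr' ?_
  filter_upwards [self_mem_nhdsWithin] with s hs
  have hs0 : s ≠ 0 := hs
  have h1 : A (p, b + s • w) = A (p, b) + s • A (p, w) := by
    rw [← h.map_smul, ← h.map_add]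
  simp [h1, smul_smul, hs0]

theorem HasDirDeriv.shift {g : ℝ → G} {t : ℝ} {y : G} (h : HasDirDeriv (fun s => g (t + s)) 0 1 y) :
    HasDirDeriv g t 1 y := by
  simpa [HasDirDeriv] using h

theorem HasDirDeriv.unshift {g : ℝ → G} {t : ℝ} {y : G} (h : HasDirDeriv g t 1 y) :
    HasDirDeriv (fun s => g (t + s)) 0 1 y := by
  simpa [HasDirDeriv] using h

end Shift

section SecondDerivative

variable {E : Type u} [AddCommGroup E] [Module ℝ E] [TopologicalSpace E]
  [IsTopologicalAddGroup E] [ContinuousSMul ℝ E]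
  {G : Type v} [AddCommGroup G] [Module ℝ G] [TopologicalSpace G]
  [IsTopologicalAddGroup G] [ContinuousSMul ℝ G] [LocallyConvexSpace ℝ G] [T2Space G]

omit [IsTopologicalAddGroup E] [ContinuousSMul ℝ E] [IsTopologicalAddGroup G]
  [ContinuousSMul ℝ G] [LocallyConvexSpace ℝ G] in
/-- The partial derivative of a map that is linear in the second variable. -/
theorem IsC1On.deriv_of_linear_right {P : Type w} [AddCommGroup P] [Module ℝ P]
    [TopologicalSpace P] {A : P × E → G} {dA : (P × E) × (P × E) → G} {U : Set (P × E)}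
    (hA : IsC1On A dA U) {p : P} (h : IsLinearMap ℝ fun b => A (p, b)) {b : E}
    (hp : (p, b) ∈ U) (w : E) : dA ((p, b), (0, w)) = A (p, w) :=
  (hA.hasDirDeriv _ hp _).unique (HasDirDeriv.of_linear_right h b w)

theorem IsC1On.second_deriv_right {f : E → G} {df : E × E → G} {U : Set E} (h : IsC1On f df U)
    {ddf : (E × E) × (E × E) → G} (h2 : IsC1On df ddf (U ×ˢ univ)) {x : E} (hx : x ∈ U)
    (v w : E) : ddf ((x, v), (0, w)) = df (x, w) :=
  h2.deriv_of_linear_right (h.isLinearMap hx) ⟨hx, trivial⟩ w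

end SecondDerivative

section Flow

variable {Z : Type u} [AddCommGroup Z] [Module ℝ Z] [TopologicalSpace Z]

/-- `Φ` is a local flow of the vector field `X`, defined for times in `(-ε, ε)` and initial values
in `W₀`. The group law is required for initial values in the smaller set `W₁` only, whose points
stay in `W₀`. -/
structure IsFlow (ε : ℝ) (W₀ W₁ : Set Z) (Φ : ℝ × Z → Z) (X : Z → Z) : Prop where
  isOpen₀ : IsOpen W₀
  isOpen₁ : IsOpen W₁
  subset : W₁ ⊆ W₀
  mapsTo : ∀ t ∈ Ioo (-ε) ε, ∀ z ∈ W₁, Φ (t, z) ∈ W₀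
  map_zero : ∀ z ∈ W₀, Φ (0, z) = z
  map_add : ∀ t ∈ Ioo (-ε) ε, ∀ s ∈ Ioo (-ε) ε, t + s ∈ Ioo (-ε) ε → ∀ z ∈ W₁,
    Φ (t, Φ (s, z)) = Φ (t + s, z)
  hasDirDeriv_zero : ∀ z ∈ W₀, HasDirDeriv (fun t => Φ (t, z)) 0 1 (X z)

variable {ε : ℝ} {W₀ W₁ : Set Z} {Φ : ℝ × Z → Z} {X : Z → Z}
  {dΦ : (ℝ × Z) × (ℝ × Z) → Z}

theorem IsFlow.hasDirDeriv (h : IsFlow ε W₀ W₁ Φ X) {z : Z} (hz : z ∈ W₁) {t : ℝ}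
    (ht : t ∈ Ioo (-ε) ε) : HasDirDeriv (fun s => Φ (s, z)) t 1 (X (Φ (t, z))) := by
  have h1 := h.hasDirDeriv_zero _ (h.mapsTo t ht z hz)
  refine h1.congr' ?_
  have h0 : (0 : ℝ) ∈ Ioo (-ε) ε := ⟨by linarith [ht.1, ht.2], by linarith [ht.1, ht.2]⟩
  have h2 : ∀ᶠ s : ℝ in 𝓝 0, s ∈ Ioo (-ε) ε := Ioo_mem_nhds h0.1 h0.2
  have h3 : ∀ᶠ s : ℝ in 𝓝 0, s + t ∈ Ioo (-ε) ε := by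
    have : Tendsto (fun s : ℝ => s + t) (𝓝 0) (𝓝 t) := by
      simpa using (continuous_add_const t).tendsto (0 : ℝ)
    exact this.eventually (Ioo_mem_nhds ht.1 ht.2)
  filter_upwards [nhdsWithin_le_nhds h2, nhdsWithin_le_nhds h3] with s hs hs'
  simp only [smul_eq_mul, mul_one, zero_add]
  rw [h.map_add s hs t ht hs' z hz, h.map_zero _ (h.mapsTo t ht z hz), add_comm]

variable [IsTopologicalAddGroup Z] [ContinuousSMul ℝ Z] [LocallyConvexSpace ℝ Z] [T2Space Z]

omit [LocallyConvexSpace ℝ Z] in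
theorem IsFlow.deriv_zero_right (h : IsFlow ε W₀ W₁ Φ X) (hε : 0 < ε)
    (hΦ : IsC1On Φ dΦ (Ioo (-ε) ε ×ˢ W₀)) {z : Z} (hz : z ∈ W₀) (η : Z) :
    dΦ ((0, z), (0, η)) = η := by
  have h1 := HasDirDeriv.comp_affine (ContinuousLinearMap.inr ℝ ℝ Z : Z →ₗ[ℝ] ℝ × Z) ((0 : ℝ), (0 : Z))
    (p := z) (v := η) (f := Φ) (by simpa using hΦ.hasDirDeriv (0, z) ⟨⟨by linarith, hε⟩, hz⟩ (0, η))
  refine h1.unique ((hasDirDeriv_clm (ContinuousLinearMap.id ℝ Z) z η).congr_of_eventuallyEq ?_)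
  filter_upwards [h.isOpen₀.mem_nhds hz] with y hy
  simp [h.map_zero y hy]

omit [IsTopologicalAddGroup Z] [ContinuousSMul ℝ Z] [LocallyConvexSpace ℝ Z] in
theorem IsFlow.deriv_zero_left (h : IsFlow ε W₀ W₁ Φ X) (hε : 0 < ε)
    (hΦ : IsC1On Φ dΦ (Ioo (-ε) ε ×ˢ W₀)) {z : Z} (hz : z ∈ W₀) :
    dΦ ((0, z), (1, 0)) = X z := by
  have h1 := HasDirDeriv.comp_affine (ContinuousLinearMap.inl ℝ ℝ Z : ℝ →ₗ[ℝ] ℝ × Z) ((0 : ℝ), z)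
    (p := 0) (v := 1) (f := Φ) (by simpa using hΦ.hasDirDeriv (0, z) ⟨⟨by linarith, hε⟩, hz⟩ (1, 0))
  exact h1.unique (by simpa using h.hasDirDeriv_zero z hz)

/-- The chain rule applied to the group law. -/
theorem IsFlow.deriv_add (h : IsFlow ε W₀ W₁ Φ X)
    (hΦ : IsC1On Φ dΦ (Ioo (-ε) ε ×ˢ W₀)) {t s : ℝ} (ht : t ∈ Ioo (-ε) ε) (hs : s ∈ Ioo (-ε) ε)
    (hts : t + s ∈ Ioo (-ε) ε) {z : Z} (hz : z ∈ W₁) (η : Z) :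
    dΦ ((t + s, z), (0, η)) = dΦ ((t, Φ (s, z)), (0, dΦ ((s, z), (0, η)))) := by
  have hline : ∀ r ∈ Ioo (-ε) ε, HasDirDeriv (fun y => Φ (r, y)) z η (dΦ ((r, z), (0, η))) := by
    intro r hr
    have h1 := HasDirDeriv.comp_affine (ContinuousLinearMap.inr ℝ ℝ Z : Z →ₗ[ℝ] ℝ × Z)
      (r, (0 : Z)) (p := z) (v := η) (f := Φ)
      (by simpa using hΦ.hasDirDeriv (r, z) ⟨hr, h.subset hz⟩ (0, η))
    simpa using h1
  have h1 := hΦ.hasDirDeriv_comp (g := fun y => (t, Φ (s, y)))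
    ((hasDirDeriv_const t z η).prodMk (hline s hs)) ⟨ht, h.mapsTo s hs z hz⟩
  refine (hline _ hts).unique (h1.congr_of_eventuallyEq ?_)
  filter_upwards [h.isOpen₁.mem_nhds hz] with y hy
  exact h.map_add t ht s hs hts y hy

/-- The generator of the linearised flow, as seen by moving back to the initial point:
solutions `δ` of the linearised equation satisfy `d/dh dΦ_{-h}(δ(t + h)) = 0` at `h = 0`. -/
theorem IsFlow.hasDirDeriv_pullback (h : IsFlow ε W₀ W₁ Φ X) (hε : 0 < ε)
    (hΦ : IsC1On Φ dΦ (Ioo (-ε) ε ×ˢ W₀)) (hΦ2 : KellerOn 2 Φ (Ioo (-ε) ε ×ˢ W₀))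
    {dX : Z × Z → Z} (hX : IsC1On X dX W₀) {γ δ : ℝ → Z} {y : Z} (hy : y ∈ W₀) (hγ0 : γ 0 = y)
    (hγ : HasDirDeriv γ 0 1 (X y)) (hδ : HasDirDeriv δ 0 1 (dX (y, δ 0))) :
    HasDirDeriv (fun s => dΦ ((-s, γ s), (0, δ s))) 0 1 0 := by
  have h0 : (0 : ℝ) ∈ Ioo (-ε) ε := ⟨by linarith, hε⟩
  obtain ⟨ddΦ, hd, -⟩ := (KellerOn.deriv hΦ2 hΦ).exists_deriv (hΦ.isOpen.prod isOpen_univ)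
  have hmem : (((0 : ℝ), y) : ℝ × Z) ∈ Ioo (-ε) ε ×ˢ W₀ := ⟨h0, hy⟩
  have hneg : HasDirDeriv (fun s : ℝ => -s) 0 1 (-1) :=
    hasDirDeriv_clm (-ContinuousLinearMap.id ℝ ℝ) 0 1
  have h1 := hd.hasDirDeriv_comp (g := fun s : ℝ => ((-s, γ s), ((0 : ℝ), δ s)))
    ((hneg.prodMk hγ).prodMk ((hasDirDeriv_const (0 : ℝ) (0 : ℝ) 1).prodMk hδ))
    (by simpa [hγ0] using hmem)
  convert h1 using 1
  simp only [neg_zero, hγ0]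
  have hq : (((0, y), (0, δ 0)) : (ℝ × Z) × (ℝ × Z)) ∈ (Ioo (-ε) ε ×ˢ W₀) ×ˢ
    (univ : Set (ℝ × Z)) := ⟨hmem, trivial⟩
  -- the three components of the direction
  have e1 : ddΦ (((0, y), (0, δ 0)), ((1, 0), 0)) = dX (y, δ 0) := by
    have h2 := hΦ.second_deriv_symm hd hmem (0, δ 0) (1, 0)
    rw [← Prod.mk_zero_zero] at h2
    rw [← Prod.mk_zero_zero, h2]
    have h3 := hd.hasDirDeriv ((0, y), (1, 0)) ⟨hmem, trivial⟩ ((0, δ 0), 0)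
    have h4 := HasDirDeriv.comp_affine (((ContinuousLinearMap.inl ℝ (ℝ × Z) (ℝ × Z)).comp
      (ContinuousLinearMap.inr ℝ ℝ Z) : Z →L[ℝ] (ℝ × Z) × (ℝ × Z)) : Z →ₗ[ℝ] (ℝ × Z) × (ℝ × Z))
      (((0 : ℝ), (0 : Z)), ((1 : ℝ), (0 : Z))) (p := y) (v := δ 0) (f := dΦ) (by simpa using h3)
    refine h4.unique ((hX.hasDirDeriv y hy (δ 0)).congr_of_eventuallyEq ?_)
    filter_upwards [h.isOpen₀.mem_nhds hy] with x hx
    simpa using (h.deriv_zero_left hε hΦ hx).symm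
  have e2 : ddΦ (((0, y), (0, δ 0)), ((0, X y), 0)) = 0 := by
    have h3 := hd.hasDirDeriv ((0, y), (0, δ 0)) hq ((0, X y), 0)
    have h4 := HasDirDeriv.comp_affine (((ContinuousLinearMap.inl ℝ (ℝ × Z) (ℝ × Z)).comp
      (ContinuousLinearMap.inr ℝ ℝ Z) : Z →L[ℝ] (ℝ × Z) × (ℝ × Z)) : Z →ₗ[ℝ] (ℝ × Z) × (ℝ × Z))
      (((0 : ℝ), (0 : Z)), ((0 : ℝ), δ 0)) (p := y) (v := X y) (f := dΦ) (by simpa using h3)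
    refine h4.unique ((hasDirDeriv_const (δ 0) y (X y)).congr_of_eventuallyEq ?_)
    filter_upwards [h.isOpen₀.mem_nhds hy] with x hx
    simpa using (h.deriv_zero_right hε hΦ hx _).symm
  have e3 : ddΦ (((0, y), (0, δ 0)), (0, (0, dX (y, δ 0)))) = dX (y, δ 0) := by
    rw [hΦ.second_deriv_right hd hmem, h.deriv_zero_right hε hΦ hy]
  have hsplit : (((-1, X y), (0, dX (y, δ 0))) : (ℝ × Z) × (ℝ × Z)) =
      -((1, 0), 0) + ((0, X y), 0) + (0, (0, dX (y, δ 0))) := by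
    simp
  rw [hsplit, hd.deriv_add hq, hd.deriv_add hq, hd.deriv_neg hq, e1, e2, e3]
  simp

/-- Solutions of the linearised equation along a flow line are transported by the derivative of
the flow. In particular they are unique, although `Z` is merely locally convex. -/
theorem IsFlow.eq_deriv_of_linearised (h : IsFlow ε W₀ W₁ Φ X) (hε : 0 < ε)
    (hΦ : IsC1On Φ dΦ (Ioo (-ε) ε ×ˢ W₀)) (hΦ2 : KellerOn 2 Φ (Ioo (-ε) ε ×ˢ W₀))
    {dX : Z × Z → Z} (hX : IsC1On X dX W₀) {z : Z} (hz : z ∈ W₁)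
    (hzW : ∀ t ∈ Ioo (-ε) ε, Φ (t, z) ∈ W₁) {T : ℝ} (hT : T ∈ Ioo (-ε) ε) {δ : ℝ → Z}
    (hδ : ∀ t ∈ uIcc 0 T, HasDirDeriv δ t 1 (dX (Φ (t, z), δ t))) :
    δ T = dΦ ((T, z), (0, δ 0)) := by
  have hI : ∀ t ∈ uIcc 0 T, t ∈ Ioo (-ε) ε ∧ -t ∈ Ioo (-ε) ε := fun t ht =>
    have h1 := mem_Ioo_of_mem_uIcc hT ht
    ⟨h1, by linarith [h1.2], by linarith [h1.1]⟩
  have hI0 : (0 : ℝ) ∈ Ioo (-ε) ε := ⟨by linarith, hε⟩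
  have hTm : T ∈ uIcc 0 T := right_mem_uIcc
  have hback : ∀ t ∈ uIcc 0 T, Φ (-t, Φ (t, z)) = z := fun t ht => by
    rw [h.map_add _ (hI t ht).2 _ (hI t ht).1 (by simpa using hI0) z hz, neg_add_cancel,
      h.map_zero z (h.subset hz)]
  -- `δ`, moved back to the initial point, is constant
  have hu : ∀ t ∈ uIcc 0 T, HasDirDeriv (fun t => dΦ ((-t, Φ (t, z)), (0, δ t))) t 1 0 := by
    intro t ht
    have htI := hI t ht
    have h1 := h.hasDirDeriv_pullback hε hΦ hΦ2 hX (γ := fun s => Φ (t + s, z))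
      (δ := fun s => δ (t + s)) (y := Φ (t, z)) (h.subset (hzW t htI.1)) (by simp)
      (HasDirDeriv.unshift (h.hasDirDeriv hz htI.1))
      (by simpa using HasDirDeriv.unshift (hδ t ht))
    obtain ⟨L, hL⟩ := hΦ.exists_clm (x := (-t, Φ (t, z))) ⟨htI.2, h.mapsTo t htI.1 z hz⟩
    -- by the group law, this derivative at `t` is the image of the one at `s = 0` in
    -- `hasDirDeriv_pullback` under the derivative of the time `-t` map
    have h2 := h1.clm_comp (L.comp (ContinuousLinearMap.inr ℝ ℝ Z))
    rw [_root_.map_zero] at h2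
    refine HasDirDeriv.shift (h2.congr_of_eventuallyEq ?_)
    have n1 : ∀ᶠ s : ℝ in 𝓝 0, t + s ∈ Ioo (-ε) ε := by
      have : Tendsto (fun s : ℝ => t + s) (𝓝 0) (𝓝 t) := by
        simpa using (continuous_const_add t).tendsto (0 : ℝ)
      exact this.eventually (Ioo_mem_nhds htI.1.1 htI.1.2)
    filter_upwards [n1, Ioo_mem_nhds hI0.1 hI0.2] with s hs hs0
    have m1 : -s ∈ Ioo (-ε) ε := ⟨by linarith [hs0.2], by linarith [hs0.1]⟩
    have m2 : -t + -s ∈ Ioo (-ε) ε := ⟨by linarith [hs.2], by linarith [hs.1]⟩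
    have h5 := h.deriv_add hΦ htI.2 m1 m2 (hzW _ hs) (δ (t + s))
    have h6 : Φ (-s, Φ (t + s, z)) = Φ (t, z) := by
      have m3 : -s + (t + s) = t := by ring
      rw [h.map_add _ m1 _ hs (by rw [m3]; exact htI.1) z hz, m3]
    rw [h6] at h5
    rw [ContinuousLinearMap.comp_apply, hL, ContinuousLinearMap.inr_apply, neg_add, h5]
  have h3 := eq_of_hasDirDeriv_zero hu
  simp only [neg_zero] at h3
  rw [h.map_zero z (h.subset hz), h.deriv_zero_right hε hΦ (h.subset hz)] at h3
  have h4 := h.deriv_add hΦ (hI T hTm).1 (hI T hTm).2 (by simpa using hI0) (hzW T (hI T hTm).1) (δ T)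
  rw [hback T hTm, h3, add_neg_cancel,
    h.deriv_zero_right hε hΦ (h.subset (hzW T (hI T hTm).1))] at h4
  exact h4

end Flow

/-! ### Flows with parameters -/

section ParamFlow

variable {E : Type u} [AddCommGroup E] [Module ℝ E] [TopologicalSpace E]
  {B : Type v} [NormedAddCommGroup B] [NormedSpace ℝ B]

/-- `Φ` is a local flow with parameters in `V` of the vector fields `X (·, v)`, defined for times in
`(-ε, ε)` and initial values in `W₀`; the group law is required for initial values in `W₁`. -/
structure IsParamFlow (ε : ℝ) (W₀ W₁ : Set E) (V : Set B) (Φ : ℝ × E × B → E) (X : E × B → E) :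
    Prop where
  isOpen₀ : IsOpen W₀
  isOpen₁ : IsOpen W₁
  isOpen_param : IsOpen V
  subset : W₁ ⊆ W₀
  mapsTo : ∀ t ∈ Ioo (-ε) ε, ∀ x ∈ W₁, ∀ v ∈ V, Φ (t, x, v) ∈ W₀
  map_zero : ∀ x ∈ W₀, ∀ v ∈ V, Φ (0, x, v) = x
  map_add : ∀ t ∈ Ioo (-ε) ε, ∀ s ∈ Ioo (-ε) ε, t + s ∈ Ioo (-ε) ε → ∀ x ∈ W₁, ∀ v ∈ V,
    Φ (t, Φ (s, x, v), v) = Φ (t + s, x, v)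
  hasDirDeriv_zero : ∀ x ∈ W₀, ∀ v ∈ V, HasDirDeriv (fun t => Φ (t, x, v)) 0 1 (X (x, v))

variable {ε : ℝ} {W₀ W₁ : Set E} {V : Set B} {Φ : ℝ × E × B → E} {X : E × B → E}

/-- Parameters may be regarded as additional coordinates that do not move. -/
theorem IsParamFlow.isFlow (h : IsParamFlow ε W₀ W₁ V Φ X) :
    IsFlow ε (W₀ ×ˢ V) (W₁ ×ˢ V) (fun z : ℝ × E × B => (Φ z, z.2.2))
      (fun z : E × B => (X z, (0 : B))) where
  isOpen₀ := h.isOpen₀.prod h.isOpen_param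
  isOpen₁ := h.isOpen₁.prod h.isOpen_param
  subset := prod_mono h.subset Subset.rfl
  mapsTo t ht z hz := ⟨h.mapsTo t ht z.1 hz.1 z.2 hz.2, hz.2⟩
  map_zero z hz := by
    have := h.map_zero z.1 hz.1 z.2 hz.2
    simpa [Prod.ext_iff] using this
  map_add t ht s hs hts z hz := by
    have := h.map_add t ht s hs hts z.1 hz.1 z.2 hz.2
    simpa [Prod.ext_iff] using this
  hasDirDeriv_zero z hz :=
    (h.hasDirDeriv_zero z.1 hz.1 z.2 hz.2).prodMk (hasDirDeriv_const z.2 (0 : ℝ) 1)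

theorem IsParamFlow.hasDirDeriv (h : IsParamFlow ε W₀ W₁ V Φ X) {x : E} (hx : x ∈ W₁) {v : B}
    (hv : v ∈ V) {t : ℝ} (ht : t ∈ Ioo (-ε) ε) :
    HasDirDeriv (fun s => Φ (s, x, v)) t 1 (X (Φ (t, x, v), v)) :=
  (h.isFlow.hasDirDeriv (z := (x, v)) ⟨hx, hv⟩ ht).clm_comp (ContinuousLinearMap.fst ℝ E B)

variable [IsTopologicalAddGroup E] [ContinuousSMul ℝ E] [LocallyConvexSpace ℝ E] [T2Space E]
  {dΦ : (ℝ × E × B) × (ℝ × E × B) → E} {dX : (E × B) × (E × B) → E}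

/-- The vector field `X (·, 0)` vanishes, hence its flow is constant. -/
theorem IsParamFlow.apply_zero_param (h : IsParamFlow ε W₀ W₁ V Φ X)
    (hlin : ∀ x ∈ W₀, IsLinearMap ℝ fun v => X (x, v)) (hV0 : 0 ∈ V) {x : E} (hx : x ∈ W₁) {T : ℝ}
    (hT : T ∈ Ioo (-ε) ε) : Φ (T, x, 0) = x := by
  have h1 := eq_of_hasDirDeriv_zero (γ := fun t => Φ (t, x, 0)) (T := T) fun t ht => by
    have htI : t ∈ Ioo (-ε) ε := mem_Ioo_of_mem_uIcc hT ht
    have := h.hasDirDeriv hx hV0 htI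
    rwa [(hlin _ (h.mapsTo t htI x hx 0 hV0)).map_zero] at this
  rw [h1]
  exact h.map_zero x (h.subset hx) 0 hV0

/-- The derivative of the flow with respect to the parameter is the solution of the linearised
equation with initial value `0`. -/
theorem IsParamFlow.deriv_param_eq (h : IsParamFlow ε W₀ W₁ V Φ X) (hε : 0 < ε)
    (hΦ : IsC1On Φ dΦ (Ioo (-ε) ε ×ˢ (W₀ ×ˢ V))) (hΦ2 : KellerOn 2 Φ (Ioo (-ε) ε ×ˢ (W₀ ×ˢ V)))
    (hX : IsC1On X dX (W₀ ×ˢ univ)) {x : E} (hx : x ∈ W₁) {v : B} (hv : v ∈ V)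
    (hxW : ∀ t ∈ Ioo (-ε) ε, Φ (t, x, v) ∈ W₁) {T : ℝ} (hT : T ∈ Ioo (-ε) ε)
    {α : ℝ → E} (hα0 : α 0 = 0) {w₀ : B}
    (hα : ∀ t ∈ uIcc 0 T, HasDirDeriv α t 1 (dX ((Φ (t, x, v), v), (α t, w₀)))) :
    dΦ ((T, x, v), (0, 0, w₀)) = α T := by
  have hsnd : KellerOn 2 (fun z : ℝ × E × B => z.2.2) (Ioo (-ε) ε ×ˢ (W₀ ×ˢ V)) :=
    kellerOn_clm ((ContinuousLinearMap.snd ℝ E B).comp (ContinuousLinearMap.snd ℝ ℝ (E × B))) _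
  have hΦ' : IsC1On (fun z : ℝ × E × B => (Φ z, z.2.2)) (fun q => (dΦ q, q.2.2.2))
      (Ioo (-ε) ε ×ˢ (W₀ ×ˢ V)) :=
    ⟨hΦ.isOpen, hΦ.continuousOn.prodMk (by fun_prop), fun p hp u =>
      (hΦ.hasDirDeriv p hp u).prodMk (hasDirDeriv_clm ((ContinuousLinearMap.snd ℝ E B).comp
        (ContinuousLinearMap.snd ℝ ℝ (E × B))) p u),
      hΦ.continuousOn_deriv.prodMk (by fun_prop)⟩
  have hX' : IsC1On (fun z : E × B => (X z, (0 : B))) (fun q => (dX q, 0)) (W₀ ×ˢ V) :=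
    ⟨h.isFlow.isOpen₀, (hX.continuousOn.mono (prod_mono Subset.rfl (subset_univ _))).prodMk
      continuousOn_const, fun p hp u => (hX.hasDirDeriv p ⟨hp.1, trivial⟩ u).prodMk
        (hasDirDeriv_const _ _ _),
      (hX.continuousOn_deriv.mono (prod_mono (prod_mono Subset.rfl (subset_univ _))
        Subset.rfl)).prodMk continuousOn_const⟩
  have h1 := h.isFlow.eq_deriv_of_linearised hε hΦ' (hΦ2.prodMk hsnd) hX' (z := (x, v))
    ⟨hx, hv⟩ (fun t ht => ⟨hxW t ht, hv⟩) hT (δ := fun t => (α t, w₀))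
    (fun t ht => (hα t ht).prodMk (hasDirDeriv_const w₀ t 1))
  rw [hα0] at h1
  exact (congrArg Prod.fst h1).symm

/-- At the parameter `0`, where the flow is constant, the linearised equation has the solution
`t ↦ t • X (x, w₀)`. -/
theorem IsParamFlow.deriv_zero_param (h : IsParamFlow ε W₀ W₁ V Φ X) (hε : 0 < ε)
    (hΦ : IsC1On Φ dΦ (Ioo (-ε) ε ×ˢ (W₀ ×ˢ V))) (hΦ2 : KellerOn 2 Φ (Ioo (-ε) ε ×ˢ (W₀ ×ˢ V)))
    (hX : IsC1On X dX (W₀ ×ˢ univ)) (hlin : ∀ x ∈ W₀, IsLinearMap ℝ fun v => X (x, v))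
    (hV0 : 0 ∈ V) {x : E} (hx : x ∈ W₁) (hxW : ∀ t ∈ Ioo (-ε) ε, Φ (t, x, 0) ∈ W₁)
    {T : ℝ} (hT : T ∈ Ioo (-ε) ε) (w₀ : B) :
    dΦ ((T, x, 0), (0, 0, w₀)) = T • X (x, w₀) := by
  refine h.deriv_param_eq hε hΦ hΦ2 hX hx hV0 hxW hT (α := fun t => t • X (x, w₀))
    (by simp) (fun t ht => ?_)
  have hx0 := h.subset hx
  have hmem : ((x, (0 : B)) : E × B) ∈ W₀ ×ˢ (univ : Set B) := ⟨hx0, trivial⟩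
  rw [h.apply_zero_param hlin hV0 hx (mem_Ioo_of_mem_uIcc hT ht)]
  have h1 : dX ((x, 0), (t • X (x, w₀), w₀)) = X (x, w₀) := by
    have h2 := hX.deriv_add hmem (t • X (x, w₀), 0) (0, w₀)
    rw [hX.deriv_of_linear_right (hlin x hx0) hmem] at h2
    have h3 : dX ((x, 0), (t • X (x, w₀), 0)) = 0 := by
      have h4 := HasDirDeriv.comp_affine (ContinuousLinearMap.inl ℝ E B : E →ₗ[ℝ] E × B)
        ((0 : E), (0 : B)) (p := x) (v := t • X (x, w₀)) (f := X)
        (by simpa using hX.hasDirDeriv (x, 0) hmem (t • X (x, w₀), 0))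
      refine h4.unique ((hasDirDeriv_const (0 : E) x _).congr_of_eventuallyEq ?_)
      filter_upwards [h.isOpen₀.mem_nhds hx0] with y hy
      simpa using (hlin y hy).map_zero.symm
    rw [h3] at h2
    simpa using h2
  rw [h1]
  have := hasDirDeriv_clm ((ContinuousLinearMap.id ℝ ℝ).smulRight (X (x, w₀))) t 1
  have e : (ContinuousLinearMap.id ℝ ℝ).smulRight (X (x, w₀)) 1 = X (x, w₀) := by simp
  rw [e] at this
  exact this

variable [CompleteSpace B]

/-- If the Lie brackets of the vector fields `X (·, v)` are values of `X`, then so are the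
derivatives of the flow with respect to the parameter: with `[X_v, X_w] = X_{c(v, w)}`, the
derivative in the direction `w₀` is `X (·, w t)` for the solution of `w' = w₀ - c (v, w)`,
an equation in the Banach space of parameters. -/
theorem IsParamFlow.exists_deriv_param_eq (h : IsParamFlow ε W₀ W₁ V Φ X)
    (hΦ : IsC1On Φ dΦ (Ioo (-ε) ε ×ˢ (W₀ ×ˢ V))) (hΦ2 : KellerOn 2 Φ (Ioo (-ε) ε ×ˢ (W₀ ×ˢ V)))
    (hX : IsC1On X dX (W₀ ×ˢ univ)) (hlin : ∀ x ∈ W₀, IsLinearMap ℝ fun v => X (x, v))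
    {c : E × B × B → B} {K : ℝ} (hK : 0 ≤ K) (hKε : K * ε ≤ 1 / 2)
    (hc : ContinuousOn c (W₀ ×ˢ V ×ˢ univ))
    (hclin : ∀ x ∈ W₀, ∀ v ∈ V, IsLinearMap ℝ fun w => c (x, v, w))
    (hcK : ∀ x ∈ W₀, ∀ v ∈ V, ∀ w, ‖c (x, v, w)‖ ≤ K * ‖w‖)
    (hbr : ∀ x ∈ W₀, ∀ v ∈ V, ∀ w, dX ((x, w), (X (x, v), 0)) - dX ((x, v), (X (x, w), 0)) =
      X (x, c (x, v, w)))
    {x : E} (hx : x ∈ W₁) {v : B} (hv : v ∈ V) (hxW : ∀ t ∈ Ioo (-ε) ε, Φ (t, x, v) ∈ W₁)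
    {T : ℝ} (hT : T ∈ Ioo (-ε) ε) (w₀ : B) :
    ∃ w, dΦ ((T, x, v), (0, 0, w₀)) = X (Φ (T, x, v), w) := by
  have hε : 0 < ε := by linarith [hT.1, hT.2]
  -- a compact time interval around `T`, for the Picard–Lindelöf theorem
  obtain ⟨T', hTT', hT'ε⟩ := exists_between (abs_lt.2 hT)
  have hT'0 : 0 < T' := (abs_nonneg T).trans_lt hTT'
  have hI : ∀ t ∈ Icc (-T') T', t ∈ Ioo (-ε) ε := fun t ht =>
    ⟨by linarith [ht.1], by linarith [ht.2]⟩
  have hγc : ContinuousOn (fun t => Φ (t, x, v)) (Icc (-T') T') :=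
    hΦ.continuousOn.comp (by fun_prop) fun t ht => ⟨hI t ht, h.subset hx, hv⟩
  have hγ0 : ∀ t ∈ Icc (-T') T', Φ (t, x, v) ∈ W₀ := fun t ht => h.mapsTo t (hI t ht) x hx v hv
  obtain ⟨w, hw0, hw⟩ := exists_linear_ode_solution (c := fun t w => c (Φ (t, x, v), v, w))
    (T := T') (K := K) hT'0 hK (by nlinarith)
    (fun t ht => hclin _ (hγ0 t ht) v hv)
    (fun w => hc.comp (hγc.prodMk continuousOn_const) fun t ht => ⟨hγ0 t ht, hv, trivial⟩)
    (fun t ht w => hcK _ (hγ0 t ht) v hv w) w₀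
  refine ⟨w T, h.deriv_param_eq hε hΦ hΦ2 hX hx hv hxW hT
    (α := fun t => X (Φ (t, x, v), w t)) ?_ fun t ht => ?_⟩
  · simp [hw0, h.map_zero x (h.subset hx) v hv, (hlin x (h.subset hx)).map_zero]
  have htT : t ∈ Ioo (-T') T' := mem_Ioo_of_mem_uIcc (abs_lt.1 hTT') ht
  have htI := hI t (Ioo_subset_Icc_self htT)
  set y := Φ (t, x, v) with hy
  have hyW : y ∈ W₀ := h.mapsTo t htI x hx v hv
  have h1 := hX.hasDirDeriv_comp ((h.hasDirDeriv hx hv htI).prodMk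
    (hasDirDeriv_iff_hasDerivAt.2 (hw t htT))) ⟨hyW, trivial⟩
  convert h1 using 1
  -- the term `dX (X_w) X_v` of the chain rule and the bracket combine to the linearised equation
  have e1 := hX.deriv_add (x := (y, v)) ⟨hyW, trivial⟩ (X (y, w t), 0) (0, w₀)
  have e2 := hX.deriv_add (x := (y, w t)) ⟨hyW, trivial⟩ (X (y, v), 0) (0, w₀ - c (y, v, w t))
  rw [hX.deriv_of_linear_right (hlin y hyW) ⟨hyW, trivial⟩] at e1 e2
  rw [(hlin y hyW).map_sub, ← hbr y hyW v hv] at e2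
  simp only [Prod.mk_add_mk, add_zero, zero_add] at e1 e2
  rw [e1, e2]
  abel

end ParamFlow

/-! ### Straightening in the model space -/

section Shrink

variable {E : Type u} [AddCommGroup E] [Module ℝ E] [TopologicalSpace E]
  {B : Type v} [NormedAddCommGroup B] [NormedSpace ℝ B]
  {ε : ℝ} {W₀ W₁ : Set E} {V : Set B} {Φ : ℝ × E × B → E} {X : E × B → E}

omit [AddCommGroup E] [Module ℝ E] [NormedSpace ℝ B] in
theorem exists_nhds_mapsTo {Φ : ℝ × E × B → E} {x₀ : E} (hΦ : ContinuousAt Φ (0, x₀, 0))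
    (h0 : Φ (0, x₀, 0) = x₀) {S : Set E} (hS : S ∈ 𝓝 x₀) :
    ∃ η > 0, ∃ W : Set E, IsOpen W ∧ x₀ ∈ W ∧ ∃ ρ > 0, ∀ t ∈ Ioo (-η) η, ∀ x ∈ W,
      ∀ v ∈ Metric.ball (0 : B) ρ, Φ (t, x, v) ∈ S := by
  have h1 : ∀ᶠ z in 𝓝 ((0 : ℝ), x₀, (0 : B)), Φ z ∈ S := hΦ.eventually (by rwa [h0])
  rw [nhds_prod_eq, nhds_prod_eq] at h1
  obtain ⟨pa, ha, pb, hb, hab⟩ := eventually_prod_iff.1 h1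
  obtain ⟨pc, hc, pd, hd, hcd⟩ := eventually_prod_iff.1 hb
  obtain ⟨η, hη, hηa⟩ := Metric.eventually_nhds_iff.1 ha
  obtain ⟨ρ, hρ, hρd⟩ := Metric.eventually_nhds_iff.1 hd
  obtain ⟨W, hWc, hW, hxW⟩ := _root_.mem_nhds_iff.1 hc
  refine ⟨η, hη, W, hW, hxW, ρ, hρ, fun t ht x hx v hv => hab (hηa ?_) (hcd (hWc hx) (hρd hv))⟩
  rw [Real.dist_eq, sub_zero, abs_lt]
  exact ht

omit [NormedSpace ℝ B] in
/-- A local flow with parameters may be restricted to small times, initial values and parameters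
so that flow lines starting in `W₂` stay in the domain of the group law. -/
theorem IsParamFlow.shrink (h : IsParamFlow ε W₀ W₁ V Φ X) (hε : 0 < ε) {x₀ : E} (hx₀ : x₀ ∈ W₁)
    (hV0 : 0 ∈ V) (hΦ : ContinuousAt Φ (0, x₀, 0)) {S : Set E} (hS : IsOpen S) (hxS : x₀ ∈ S)
    {η : ℝ} (hη : 0 < η) :
    ∃ ε' > 0, ε' ≤ ε ∧ ε' ≤ η ∧ ∃ (W₁' W₂ : Set E) (V' : Set B),
      IsParamFlow ε' (W₀ ∩ S) W₁' V' Φ X ∧ V' ⊆ V ∧ V' ⊆ Metric.ball 0 η ∧ 0 ∈ V' ∧ x₀ ∈ W₂ ∧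
      IsOpen W₂ ∧ W₂ ⊆ W₁' ∧ ∀ t ∈ Ioo (-ε') ε', ∀ x ∈ W₂, ∀ v ∈ V', Φ (t, x, v) ∈ W₁' := by
  have h0 : Φ (0, x₀, 0) = x₀ := h.map_zero x₀ (h.subset hx₀) 0 hV0
  have hO : IsOpen (W₀ ∩ S) := h.isOpen₀.inter hS
  obtain ⟨η₁, hη₁, N₁, hN₁, hxN₁, ρ₁, hρ₁, hm₁⟩ := exists_nhds_mapsTo hΦ h0
    (hO.mem_nhds ⟨h.subset hx₀, hxS⟩)
  have hW₁' : IsOpen (N₁ ∩ W₁ ∩ S) := (hN₁.inter h.isOpen₁).inter hS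
  obtain ⟨η₂, hη₂, N₂, hN₂, hxN₂, ρ₂, hρ₂, hm₂⟩ := exists_nhds_mapsTo hΦ h0
    (hW₁'.mem_nhds ⟨⟨hxN₁, hx₀⟩, hxS⟩)
  set ε' := min (min ε η) (min η₁ η₂) with hε'
  have hε'0 : 0 < ε' := lt_min (lt_min hε hη) (lt_min hη₁ hη₂)
  have l1 : ε' ≤ ε := (min_le_left _ _).trans (min_le_left _ _)
  have l2 : ε' ≤ η := (min_le_left _ _).trans (min_le_right _ _)
  have l3 : ε' ≤ η₁ := (min_le_right _ _).trans (min_le_left _ _)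
  have l4 : ε' ≤ η₂ := (min_le_right _ _).trans (min_le_right _ _)
  have hI : ∀ {a t : ℝ}, ε' ≤ a → t ∈ Ioo (-ε') ε' → t ∈ Ioo (-a) a := fun ha ht =>
    ⟨by linarith [ht.1], by linarith [ht.2]⟩
  refine ⟨ε', hε'0, l1, l2, N₁ ∩ W₁ ∩ S, N₂ ∩ (N₁ ∩ W₁ ∩ S),
    V ∩ (Metric.ball 0 η ∩ (Metric.ball 0 ρ₁ ∩ Metric.ball 0 ρ₂)), ?_, inter_subset_left,
    fun v hv => hv.2.1, ?_, ?_, hN₂.inter hW₁', inter_subset_right, ?_⟩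
  · exact
    { isOpen₀ := hO
      isOpen₁ := hW₁'
      isOpen_param := h.isOpen_param.inter
        (Metric.isOpen_ball.inter (Metric.isOpen_ball.inter Metric.isOpen_ball))
      subset := fun x hx => ⟨h.subset hx.1.2, hx.2⟩
      mapsTo := fun t ht x hx v hv => hm₁ t (hI l3 ht) x hx.1.1 v hv.2.2.1
      map_zero := fun x hx v hv => h.map_zero x hx.1 v hv.1
      map_add := fun t ht s hs hts x hx v hv =>
        h.map_add t (hI l1 ht) s (hI l1 hs) (hI l1 hts) x hx.1.2 v hv.1
      hasDirDeriv_zero := fun x hx v hv => h.hasDirDeriv_zero x hx.1 v hv.1 }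
  · exact ⟨hV0, Metric.mem_ball_self hη, Metric.mem_ball_self hρ₁, Metric.mem_ball_self hρ₂⟩
  · exact ⟨hxN₂, ⟨hxN₁, hx₀⟩, hxS⟩
  · exact fun t ht x hx v hv => hm₂ t (hI l4 ht) x hx.1 v hv.2.2.2

end Shrink

section Local

variable {E : Type u} [AddCommGroup E] [Module ℝ E] [TopologicalSpace E]
  [IsTopologicalAddGroup E] [ContinuousSMul ℝ E] [LocallyConvexSpace ℝ E] [T2Space E]
  {B : Type v} [NormedAddCommGroup B] [NormedSpace ℝ B] [CompleteSpace B]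
  {ε : ℝ} {W₀ W₁ : Set E} {V : Set B} {Φ : ℝ × E × B → E} {X : E × B → E}
  {dX : (E × B) × (E × B) → E}

omit [IsTopologicalAddGroup E] [ContinuousSMul ℝ E] [LocallyConvexSpace ℝ E] [CompleteSpace B] in
theorem isLinearMap_deriv_of_linear [IsTopologicalAddGroup E] [ContinuousSMul ℝ E]
    (hW : IsOpen W₀) (hX : IsC1On X dX (W₀ ×ˢ univ))
    (hlin : ∀ x ∈ W₀, IsLinearMap ℝ fun v => X (x, v)) {x : E} (hx : x ∈ W₀) (e : E) :
    IsLinearMap ℝ fun w => dX ((x, w), (e, 0)) := by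
  have hd : ∀ w, HasDirDeriv (fun y => X (y, w)) x e (dX ((x, w), (e, 0))) := fun w => by
    have h1 := HasDirDeriv.comp_affine (ContinuousLinearMap.inl ℝ E B : E →ₗ[ℝ] E × B)
      ((0 : E), w) (p := x) (v := e) (f := X)
      (by simpa using hX.hasDirDeriv (x, w) ⟨hx, trivial⟩ (e, 0))
    simpa using h1
  refine ⟨fun v w => ?_, fun c w => ?_⟩
  · refine (hd _).unique (((hd v).add (hd w)).congr_of_eventuallyEq ?_)
    filter_upwards [hW.mem_nhds hx] with y hy using ((hlin y hy).map_add v w).symm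
  · refine (hd _).unique
      (((hd w).clm_comp (c • ContinuousLinearMap.id ℝ E)).congr_of_eventuallyEq ?_)
    filter_upwards [hW.mem_nhds hx] with y hy
    simpa using ((hlin y hy).map_smul c w).symm

/-- If the values of `X` contain the Lie brackets of the fields `X (·, v)`, then these brackets are
`X (·, c (v, w))` near `x₀`, with continuous coefficients `c` that are bounded by a multiple of
`w` for small `v`. The linear projection `α` makes `X (x, ·)` invertible near `x₀`. -/
theorem exists_bracket_coefficients (hW : IsOpen W₀) (hX : IsC1On X dX (W₀ ×ˢ univ))
    (hlin : ∀ x ∈ W₀, IsLinearMap ℝ fun v => X (x, v))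
    (hbr : ∀ x ∈ W₀, ∀ v w, ∃ u, dX ((x, w), (X (x, v), 0)) - dX ((x, v), (X (x, w), 0)) = X (x, u))
    {x₀ : E} (hx₀ : x₀ ∈ W₀) {α : E →L[ℝ] B} (hα : ∀ b, α (X (x₀, b)) = b) :
    ∃ S ⊆ W₀, IsOpen S ∧ x₀ ∈ S ∧ (∀ x ∈ S, ∀ b c, α (X (x, b)) = α (X (x, c)) → b = c) ∧
      ∃ ρ > 0, ∃ c : E × B × B → B, ContinuousOn c (S ×ˢ univ ×ˢ univ) ∧
      (∀ x ∈ S, ∀ v, IsLinearMap ℝ fun w => c (x, v, w)) ∧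
      (∀ x ∈ S, ∀ v ∈ Metric.ball (0 : B) ρ, ∀ w, ‖c (x, v, w)‖ ≤ ρ⁻¹ * ‖w‖) ∧
      ∀ x ∈ S, ∀ v w, dX ((x, w), (X (x, v), 0)) - dX ((x, v), (X (x, w), 0)) =
        X (x, c (x, v, w)) := by
  have hA : IsC1On (fun z => α (X z)) (fun q => α (dX q)) (W₀ ×ˢ univ) :=
    ⟨hX.isOpen, α.continuous.comp_continuousOn hX.continuousOn,
      fun p hp v => (hX.hasDirDeriv p hp v).clm_comp α,
      α.continuous.comp_continuousOn hX.continuousOn_deriv⟩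
  have hAk : KellerOn 1 (fun z => α (X z)) (W₀ ×ˢ univ) :=
    hA.kellerOn (n := 0) hA.continuousOn_deriv
  obtain ⟨S, hSW, hS, hxS, -, J, hJlin, hJ, hJk⟩ := exists_inverse_family hA
    (fun p hp => ⟨fun b c => by rw [(hlin p hp).map_add, map_add],
      fun r b => by rw [(hlin p hp).map_smul, map_smul]⟩) hx₀ hα
  have hJc : ContinuousOn J (S ×ˢ univ) := (hJk 0 hAk).continuousOn
  -- the bracket, and its coordinates
  set br : E × B × B → E := fun z =>
    dX ((z.1, z.2.2), (X (z.1, z.2.1), 0)) - dX ((z.1, z.2.1), (X (z.1, z.2.2), 0)) with hbrdef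
  set c : E × B × B → B := fun z => J (z.1, α (br z)) with hcdef
  have hXc : ∀ (i : E × B × B → B), Continuous i →
      ContinuousOn (fun z : E × B × B => X (z.1, i z)) (S ×ˢ univ ×ˢ univ) := fun i hi =>
    hX.continuousOn.comp (by fun_prop) fun z hz => ⟨hSW hz.1, trivial⟩
  have hdXc : ∀ (i j : E × B × B → B), Continuous i → Continuous j → ContinuousOn
      (fun z : E × B × B => dX ((z.1, i z), (X (z.1, j z), 0))) (S ×ˢ univ ×ˢ univ) :=
    fun i j hi hj => hX.continuousOn_deriv.comp
      (ContinuousOn.prodMk (by fun_prop) ((hXc j hj).prodMk continuousOn_const))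
      fun z hz => ⟨⟨hSW hz.1, trivial⟩, trivial⟩
  have hbrc : ContinuousOn br (S ×ˢ univ ×ˢ univ) :=
    (hdXc _ _ (by fun_prop) (by fun_prop)).sub (hdXc _ _ (by fun_prop) (by fun_prop))
  have hcc : ContinuousOn c (S ×ˢ univ ×ˢ univ) :=
    hJc.comp (continuousOn_fst.prodMk (α.continuous.comp_continuousOn hbrc))
      fun z hz => ⟨hz.1, trivial⟩
  have hclin : ∀ x ∈ S, ∀ v, IsLinearMap ℝ fun w => c (x, v, w) := by
    intro x hx v
    have hxW := hSW hx
    have h1 := isLinearMap_deriv_of_linear hW hX hlin hxW (X (x, v))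
    have h2 : ∀ w, br (x, v, w) =
      dX ((x, w), (X (x, v), 0)) - dX ((x, v), (X (x, w), 0)) := fun w => rfl
    have hm : ((x, v) : E × B) ∈ W₀ ×ˢ (univ : Set B) := ⟨hxW, trivial⟩
    refine ⟨fun w w' => ?_, fun r w => ?_⟩
    · have h3 : br (x, v, w + w') = br (x, v, w) + br (x, v, w') := by
        have h4 := hX.deriv_add hm (X (x, w), 0) (X (x, w'), 0)
        simp only [Prod.mk_add_mk, add_zero] at h4
        rw [h2, h2, h2, h1.map_add, (hlin x hxW).map_add, h4]
        abel
      simp only [hcdef]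
      rw [h3, map_add, (hJlin x hx).map_add]
    · have h3 : br (x, v, r • w) = r • br (x, v, w) := by
        have h4 := hX.deriv_smul hm r (X (x, w), 0)
        simp only [Prod.smul_mk, smul_zero] at h4
        rw [h2, h2, h1.map_smul, (hlin x hxW).map_smul, h4, smul_sub]
      simp only [hcdef]
      rw [h3, map_smul, (hJlin x hx).map_smul]
  have hmem : ((x₀, (0 : B), (0 : B)) : E × B × B) ∈ S ×ˢ (univ : Set B) ×ˢ (univ : Set B) :=
    ⟨hxS, trivial, trivial⟩
  have hsmall : ∀ᶠ z in 𝓝 (x₀, (0 : B), (0 : B)), ‖c z‖ ≤ 1 := by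
    have h1 := (hcc.continuousAt ((hS.prod (isOpen_univ.prod isOpen_univ)).mem_nhds
      hmem)).norm.tendsto
    have h2 : c (x₀, 0, 0) = 0 := (hclin x₀ hxS 0).map_zero
    rw [h2, norm_zero] at h1
    exact h1.eventually (eventually_le_nhds one_pos)
  rw [nhds_prod_eq, nhds_prod_eq] at hsmall
  obtain ⟨pa, ha, pb, hb, hab⟩ := eventually_prod_iff.1 hsmall
  obtain ⟨pc, hc, pd, hd, hcd⟩ := eventually_prod_iff.1 hb
  obtain ⟨ρ₁, hρ₁, hρc⟩ := Metric.eventually_nhds_iff.1 hc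
  obtain ⟨ρ₂, hρ₂, hρd⟩ := Metric.eventually_nhds_iff.1 hd
  obtain ⟨S', hS'a, hS', hxS'⟩ := _root_.mem_nhds_iff.1 ha
  set ρ := min ρ₁ (ρ₂ / 2) with hρ
  have hρ0 : 0 < ρ := lt_min hρ₁ (by positivity)
  refine ⟨S ∩ S', fun x hx => hSW hx.1, hS.inter hS', ⟨hxS, hxS'⟩, ?_, ρ, hρ0, c,
    hcc.mono (prod_mono inter_subset_left Subset.rfl), fun x hx => hclin x hx.1, ?_, ?_⟩
  · intro x hx b b' hbb
    rw [← (hJ x hx.1 b).2, hbb, (hJ x hx.1 b').2]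
  · intro x hx v hv w
    have hv1 : pc v := hρc (lt_of_lt_of_le hv (min_le_left _ _))
    rcases eq_or_ne w 0 with rfl | hw
    · have : c (x, v, 0) = 0 := (hclin x hx.1 v).map_zero
      simp [this]
    have hwn : 0 < ‖w‖ := norm_pos_iff.2 hw
    -- linearity in `w` turns the bound at `‖w‖ = ρ` into one for all `w`
    set s : ℝ := ρ / ‖w‖ with hs
    have hs0 : 0 < s := by positivity
    have h1 : ‖s • w‖ = ρ := by
      rw [norm_smul, Real.norm_eq_abs, abs_of_pos hs0, hs, div_mul_cancel₀ _ hwn.ne']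
    have h2 : pd (s • w) := hρd (by
      rw [dist_zero_right, h1]
      exact (min_le_right _ _).trans_lt (by linarith))
    have h3 : ‖c (x, v, s • w)‖ ≤ 1 := hab (hS'a hx.2) (hcd hv1 h2)
    have h4 : c (x, v, s • w) = s • c (x, v, w) := (hclin x hx.1 v).map_smul s w
    rw [h4, norm_smul, Real.norm_eq_abs, abs_of_pos hs0, hs, div_mul_eq_mul_div,
      div_le_iff₀ hwn, one_mul] at h3
    rwa [le_inv_mul_iff₀ hρ0]
  · intro x hx v w
    obtain ⟨u, hu⟩ := hbr x (hSW hx.1) v w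
    have h1 : c (x, v, w) = u := by
      simp only [hcdef, hbrdef]
      rw [hu]
      exact (hJ x hx.1 u).2
    rw [h1, hu]

/-- The local Frobenius theorem: the time-`τ` maps of the flows straighten the distribution spanned
by the vector fields `X (·, v)`. Here `α`, `σ`, `κ` are the projections and the inclusion of a
topological decomposition of `E` into the range of `X (x₀, ·)` and a copy of `H`. The inverse of the
chart is `(b, y) ↦ Φ (τ, x₀ + κ y, b)`. Its derivatives in the directions of `B` lie in the
distribution by `IsParamFlow.exists_deriv_param_eq`. The chart itself comes from the implicit
function theorem: as the flow is invertible, only the parameter `b` has to be found. -/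
theorem IsParamFlow.exists_straightening {H : Type w} [AddCommGroup H] [Module ℝ H]
    [TopologicalSpace H] [IsTopologicalAddGroup H] [ContinuousSMul ℝ H] {k : ℕ}
    (h : IsParamFlow ε W₀ W₁ V Φ X) (hε : 0 < ε) (hΦ : KellerOn (k + 2) Φ (Ioo (-ε) ε ×ˢ (W₀ ×ˢ V)))
    (hX : IsC1On X dX (W₀ ×ˢ univ)) (hlin : ∀ x ∈ W₀, IsLinearMap ℝ fun v => X (x, v))
    (hbr : ∀ x ∈ W₀, ∀ v w, ∃ u, dX ((x, w), (X (x, v), 0)) - dX ((x, v), (X (x, w), 0)) = X (x, u))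
    {x₀ : E} (hx₀ : x₀ ∈ W₁) (hV0 : 0 ∈ V) {α : E →L[ℝ] B} {σ : E →L[ℝ] H} {κ : H →L[ℝ] E}
    (hα : ∀ b, α (X (x₀, b)) = b) (hακ : ∀ y, α (κ y) = 0) (hσκ : ∀ y, σ (κ y) = y)
    (hκσ : ∀ u, α u = 0 → κ (σ u) = u) :
    ∃ θ : OpenPartialHomeomorph E (B × H), x₀ ∈ θ.source ∧ θ.source ⊆ W₀ ∧
      KellerOn (k + 2) θ θ.source ∧ KellerOn (k + 2) θ.symm θ.target ∧
      ∃ ρ > 0, ∃ V₂ : Set H, IsOpen V₂ ∧ θ.target = Metric.ball 0 ρ ×ˢ V₂ ∧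
      ∀ z ∈ θ.target, (∀ w, ∃ u, HasDirDeriv θ.symm z (w, 0) (X (θ.symm z, u))) ∧
        ∀ u, ∃ w, HasDirDeriv θ.symm z (w, 0) (X (θ.symm z, u)) := by
  obtain ⟨S, hSW, hS, hxS, hinj, ρ₀, hρ₀, c, hcc, hclin, hcK, hc⟩ :=
    exists_bracket_coefficients h.isOpen₀ hX hlin hbr (h.subset hx₀) hα
  have hdom : IsOpen (Ioo (-ε) ε ×ˢ (W₀ ×ˢ V)) :=
    isOpen_Ioo.prod (h.isOpen₀.prod h.isOpen_param)
  have hΦc : ContinuousAt Φ (0, x₀, 0) := hΦ.continuousOn.continuousAt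
    (hdom.mem_nhds ⟨⟨by linarith, hε⟩, h.subset hx₀, hV0⟩)
  obtain ⟨ε', hε'0, hε'ε, hε'η, W₁', W₂, V', h', hV'V, hV'b, hV'0, hxW₂, hW₂, hW₂₁, hstay⟩ :=
    h.shrink hε hx₀ hV0 hΦc hS hxS (η := ρ₀ / 2) (by positivity)
  have hsub : Ioo (-ε') ε' ×ˢ ((W₀ ∩ S) ×ˢ V') ⊆ Ioo (-ε) ε ×ˢ (W₀ ×ˢ V) :=
    prod_mono (Ioo_subset_Ioo (by linarith) hε'ε) (prod_mono inter_subset_left hV'V)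
  have hΦ' := hΦ.mono hsub
  have hdom' : IsOpen (Ioo (-ε') ε' ×ˢ ((W₀ ∩ S) ×ˢ V')) :=
    isOpen_Ioo.prod (h'.isOpen₀.prod h'.isOpen_param)
  have hX' : IsC1On X dX ((W₀ ∩ S) ×ˢ univ) :=
    hX.mono (h'.isOpen₀.prod isOpen_univ) (prod_mono inter_subset_left Subset.rfl)
  have hlin' : ∀ x ∈ W₀ ∩ S, IsLinearMap ℝ fun v => X (x, v) := fun x hx => hlin x hx.1
  obtain ⟨dΦ, hdΦ, hdΦk⟩ := hΦ'.exists_deriv (n := k + 1) hdom'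
  have hΦ2 : KellerOn 2 Φ (Ioo (-ε') ε' ×ˢ ((W₀ ∩ S) ×ˢ V')) := hΦ'.of_le (by omega)
  -- derivatives with respect to the parameter lie in the distribution
  have htan : ∀ T ∈ Ioo (-ε') ε', ∀ x ∈ W₂, ∀ v ∈ V', ∀ w, ∃ u,
      dΦ ((T, x, v), (0, 0, w)) = X (Φ (T, x, v), u) := fun T hT x hx v hv w =>
    h'.exists_deriv_param_eq hdΦ hΦ2 hX' hlin' (K := ρ₀⁻¹) (by positivity)
      (by rw [inv_mul_le_iff₀ hρ₀]; linarith)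
      (hcc.mono (prod_mono inter_subset_right (prod_mono (subset_univ _) Subset.rfl)))
      (fun x hx v _ => hclin x hx.2 v)
      (fun x hx v hv => hcK x hx.2 v (Metric.ball_subset_ball (by linarith) (hV'b hv)))
      (fun x hx v _ w => hc x hx.2 v w) (hW₂₁ hx) hv (fun t ht => hstay t ht x hx v hv) hT w
  have hzero : ∀ T ∈ Ioo (-ε') ε', ∀ w, dΦ ((T, x₀, 0), (0, 0, w)) = T • X (x₀, w) :=
    fun T hT w => h'.deriv_zero_param hε'0 hdΦ hΦ2 hX' hlin' hV'0 (hW₂₁ hxW₂)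
      (fun t ht => hstay t ht x₀ hxW₂ 0 hV'0) hT w
  set τ := ε' / 2 with hτ
  have hτ0 : 0 < τ := by positivity
  have hτI : τ ∈ Ioo (-ε') ε' := ⟨by linarith, by linarith⟩
  have hτI' : -τ ∈ Ioo (-ε') ε' := ⟨by linarith, by linarith⟩
  have h0I : (0 : ℝ) ∈ Ioo (-ε') ε' := ⟨by linarith, by linarith⟩
  have hfix : ∀ T ∈ Ioo (-ε') ε', Φ (T, x₀, 0) = x₀ := fun T hT =>
    h'.apply_zero_param hlin' hV'0 (hW₂₁ hxW₂) hT
  -- `lam z` is the parameter whose flow leads from `z` to `x₀ + κ H` in time `-τ`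
  obtain ⟨N, hN, hxN, ρ₁, hρ₁, hNU, lam, hlamk, hlam⟩ : ∃ N : Set E, IsOpen N ∧ x₀ ∈ N ∧ ∃ ρ > 0,
      N ×ˢ Metric.ball 0 ρ ⊆ W₂ ×ˢ V' ∧ ∃ lam : E → B, KellerOn (k + 2) lam N ∧ ∀ p ∈ N,
      lam p ∈ Metric.ball 0 ρ ∧ α (Φ (-τ, p, lam p) - x₀) = 0 ∧
        ∀ b ∈ Metric.ball (0 : B) ρ, α (Φ (-τ, p, b) - x₀) = 0 → b = lam p := by
    -- the derivative of `Φ (-τ, x₀, ·)` at `0` is `-τ • X (x₀, ·)`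
    let β : E →L[ℝ] B := (-τ⁻¹) • α
    have hβ : ∀ u, β u = 0 ↔ α u = 0 := fun u => by
      simp [β, hτ0.ne']
    have hUo : IsOpen (W₂ ×ˢ V') := hW₂.prod h'.isOpen_param
    have hUm : ∀ x ∈ W₂ ×ˢ V', ((-τ, (0 : E), (0 : B)) : ℝ × E × B) +
        ContinuousLinearMap.inr ℝ ℝ (E × B) x ∈ Ioo (-ε') ε' ×ˢ ((W₀ ∩ S) ×ˢ V') := by
      intro x hx
      simpa using (⟨hτI', h'.subset (hW₂₁ hx.1), hx.2⟩ :
        (-τ, x.1, x.2) ∈ Ioo (-ε') ε' ×ˢ ((W₀ ∩ S) ×ˢ V'))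
    have h1 := hdΦ.comp_affine (ContinuousLinearMap.inr ℝ ℝ (E × B)) (-τ, 0, 0) hUo hUm
    have h1k := hΦ'.comp_affine (ContinuousLinearMap.inr ℝ ℝ (E × B)) (-τ, 0, 0) hUm
    simp only [ContinuousLinearMap.inr_apply, Prod.mk_add_mk, add_zero, Prod.mk_zero_zero,
      zero_add] at h1 h1k
    have h2 : IsC1On (fun z : E × B => β (Φ (-τ, z) - x₀)) (fun q => β (dΦ ((-τ, q.1), (0, q.2))))
        (W₂ ×ˢ V') :=
      ⟨hUo, β.continuous.comp_continuousOn (h1.continuousOn.sub continuousOn_const),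
        fun p hp v => by
          have h3 := ((h1.hasDirDeriv p hp v).sub (hasDirDeriv_const x₀ p v)).clm_comp β
          simpa using h3, β.continuous.comp_continuousOn h1.continuousOn_deriv⟩
    have h2k : KellerOn (k + 2) (fun z : E × B => β (Φ (-τ, z) - x₀)) (W₂ ×ˢ V') :=
      (h1k.sub (kellerOn_const x₀ _)).clm_comp β
    obtain ⟨N, hN, hxN, ρ₁, hρ₁, hNU, lam, hlamk, hlam⟩ := exists_implicit_function h2 h2k
      (p₀ := x₀) ⟨hxW₂, hV'0⟩ (by simp [hfix _ hτI']) (fun w => by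
        rw [hzero _ hτI']
        simp [β, hα, smul_smul, hτ0.ne'])
    refine ⟨N, hN, hxN, ρ₁, hρ₁, hNU, lam, hlamk, fun p hp => ⟨(hlam p hp).1,
      (hβ _).1 (hlam p hp).2.1, fun b hb hb0 => (hlam p hp).2.2 b hb ((hβ _).2 hb0)⟩⟩
  have hNW₂ : ∀ z ∈ N, z ∈ W₂ := fun z hz => (hNU (show (z, (0 : B)) ∈ _ from
    ⟨hz, Metric.mem_ball_self hρ₁⟩)).1
  have hbV' : ∀ b ∈ Metric.ball (0 : B) ρ₁, b ∈ V' := fun b hb => (hNU (show (x₀, b) ∈ _ from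
    ⟨hxN, hb⟩)).2
  -- the inverse chart
  set ψ : B × H → E := fun z => Φ (τ, x₀ + κ z.2, z.1) with hψ
  set Q : Set (B × H) := {z | x₀ + κ z.2 ∈ W₂ ∧ z.1 ∈ V'} with hQ
  have hQo : IsOpen Q := (hW₂.preimage (f := fun z : B × H => x₀ + κ z.2) (by fun_prop)).inter
    (h'.isOpen_param.preimage continuous_fst)
  have hQ0 : (0 : B × H) ∈ Q := ⟨by simpa using hxW₂, hV'0⟩
  let Λ : B × H →L[ℝ] ℝ × E × B := (ContinuousLinearMap.inr ℝ ℝ (E × B)).comp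
    ((κ.comp (ContinuousLinearMap.snd ℝ B H)).prod (ContinuousLinearMap.fst ℝ B H))
  have hΛ : ∀ z, ((τ, x₀, (0 : B)) : ℝ × E × B) + Λ z = (τ, x₀ + κ z.2, z.1) := fun z => by
    simp [Λ]
  have hΛQ : ∀ z ∈ Q, ((τ, x₀, (0 : B)) : ℝ × E × B) + Λ z ∈
      Ioo (-ε') ε' ×ˢ ((W₀ ∩ S) ×ˢ V') := fun z hz => by
    rw [hΛ]; exact ⟨hτI, h'.subset (hW₂₁ hz.1), hz.2⟩
  have hψk : KellerOn (k + 2) ψ Q := by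
    have := hΦ'.comp_affine Λ (τ, x₀, 0) hΛQ
    simpa only [hΛ] using this
  have hψd : IsC1On ψ (fun q => dΦ ((τ, x₀ + κ q.1.2, q.1.1), (0, κ q.2.2, q.2.1))) Q := by
    have := hdΦ.comp_affine Λ (τ, x₀, 0) hQo hΛQ
    simp only [hΛ] at this
    exact this
  have hψ0 : ψ 0 = x₀ := by simpa [hψ] using hfix τ hτI
  -- the derivatives of `ψ` in the directions of `B` span the distribution
  obtain ⟨R, hRQ, hR, h0R, hsurj⟩ : ∃ R ⊆ Q, IsOpen R ∧ (0 : B × H) ∈ R ∧ ∀ z ∈ R, ∀ b, ∃ w,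
      α (dΦ ((τ, x₀ + κ z.2, z.1), (0, 0, w))) = b := by
    let β : E →L[ℝ] B := τ⁻¹ • α
    let A : (B × H) × B → B := fun q => β (dΦ ((τ, x₀ + κ q.1.2, q.1.1), (0, 0, q.2)))
    let Λ' : (B × H) × B →L[ℝ] (ℝ × E × B) × (ℝ × E × B) := Λ.prodMap
      ((ContinuousLinearMap.inr ℝ ℝ (E × B)).comp (ContinuousLinearMap.inr ℝ E B))
    have hΛ' : ∀ q, ((((τ, x₀, (0 : B)) : ℝ × E × B), (0 : ℝ × E × B)) :
        (ℝ × E × B) × (ℝ × E × B)) + Λ' q = ((τ, x₀ + κ q.1.2, q.1.1), (0, 0, q.2)) := fun q => by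
      simp [Λ', Prod.ext_iff, Λ]
    have hA1 : KellerOn 1 A (Q ×ˢ univ) := by
      have h1 := ((hdΦk.of_le (show 1 ≤ k + 1 by omega)).comp_affine Λ' ((τ, x₀, 0), 0)
        (V := Q ×ˢ univ) (fun q hq => by
          rw [hΛ', ← hΛ]; exact ⟨hΛQ q.1 hq.1, trivial⟩)).clm_comp β
      simpa only [hΛ'] using h1
    obtain ⟨dA, hdA, -⟩ := hA1.exists_deriv (hQo.prod isOpen_univ)
    obtain ⟨R, hRQ, hR, h0R, -, J, -, hJ, -⟩ := exists_inverse_family hdA (p₀ := (0 : B × H))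
      (fun z hz => by
        obtain ⟨L, hL⟩ := hdΦ.exists_clm (x := (τ, x₀ + κ z.2, z.1))
          (by rw [← hΛ]; exact hΛQ z hz)
        have : ∀ b, A (z, b) = (β.comp (L.comp ((ContinuousLinearMap.inr ℝ ℝ (E × B)).comp
          (ContinuousLinearMap.inr ℝ E B)))) b := fun b => by simp [A, hL]
        simp only [this]
        exact LinearMap.isLinear (ContinuousLinearMap.toLinearMap _))
      hQ0 (fun b => by
        simp only [A, Prod.snd_zero, Prod.fst_zero, _root_.map_zero, add_zero]
        rw [hzero τ hτI]
        simp [β, hα, smul_smul, hτ0.ne'])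
    refine ⟨R, hRQ, hR, h0R, fun z hz b => ⟨J (z, τ⁻¹ • b), ?_⟩⟩
    have h1 := (hJ z hz (τ⁻¹ • b)).1
    exact smul_right_injective B (inv_ne_zero hτ0.ne') h1
  -- shrink to a product
  have hT : ∀ᶠ z in 𝓝 (0 : B × H), z ∈ R ∧ z.1 ∈ Metric.ball (0 : B) ρ₁ ∧ ψ z ∈ N := by
    refine Filter.Eventually.and (hR.mem_nhds h0R) (Filter.Eventually.and
      ((Metric.isOpen_ball.preimage continuous_fst).mem_nhds (Metric.mem_ball_self hρ₁)) ?_)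
    exact (hψd.continuousAt hQ0).eventually (by rw [hψ0]; exact hN.mem_nhds hxN)
  rw [← Prod.mk_zero_zero, nhds_prod_eq] at hT
  obtain ⟨pa, ha, pb, hb, hab⟩ := eventually_prod_iff.1 hT
  obtain ⟨ρ, hρ, hρa⟩ := Metric.eventually_nhds_iff.1 ha
  obtain ⟨V₂, hV₂b, hV₂, h0V₂⟩ := _root_.mem_nhds_iff.1 hb
  have hgood : ∀ z ∈ Metric.ball (0 : B) ρ ×ˢ V₂, z ∈ R ∧ z.1 ∈ Metric.ball (0 : B) ρ₁ ∧ ψ z ∈ N :=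
    fun z hz => hab (hρa hz.1) (hV₂b hz.2)
  have hto : IsOpen (Metric.ball (0 : B) ρ ×ˢ V₂) := Metric.isOpen_ball.prod hV₂
  -- the chart
  set φ : E → B × H := fun z => (lam z, σ (Φ (-τ, z, lam z) - x₀)) with hφ
  have hφk : KellerOn (k + 2) φ N := by
    have h1 : KellerOn (k + 2) (fun z : E => ((-τ : ℝ), z, lam z)) N :=
      (kellerOn_const (-τ) N).prodMk ((kellerOn_clm (ContinuousLinearMap.id ℝ E) N).prodMk hlamk)
    have h2 := hΦ'.comp h1 hdom' (fun z hz =>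
      ⟨hτI', h'.subset (hW₂₁ (hNW₂ z hz)), hbV' _ (hlam z hz).1⟩)
    exact hlamk.prodMk ((h2.sub (kellerOn_const x₀ N)).clm_comp σ)
  have hφc : ContinuousOn φ N := hφk.continuousOn
  have hleft : ∀ z ∈ N, ψ (φ z) = z := by
    intro z hz
    have h1 : x₀ + κ (σ (Φ (-τ, z, lam z) - x₀)) = Φ (-τ, z, lam z) := by
      rw [hκσ _ (hlam z hz).2.1, add_sub_cancel]
    have hzW := hW₂₁ (hNW₂ z hz)
    simp only [hψ, hφ]
    rw [h1, h'.map_add τ hτI (-τ) hτI' (by simpa using h0I) z hzW _ (hbV' _ (hlam z hz).1),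
      add_neg_cancel, h'.map_zero z (h'.subset hzW) _ (hbV' _ (hlam z hz).1)]
  have hright : ∀ z ∈ Metric.ball (0 : B) ρ ×ˢ V₂, φ (ψ z) = z := by
    intro z hz
    obtain ⟨hzR, hzρ, hzN⟩ := hgood z hz
    have hzQ := hRQ hzR
    have h1 : Φ (-τ, ψ z, z.1) = x₀ + κ z.2 := by
      simp only [hψ]
      rw [h'.map_add (-τ) hτI' τ hτI (by simpa using h0I) _ (hW₂₁ hzQ.1) _ hzQ.2, neg_add_cancel,
        h'.map_zero _ (h'.subset (hW₂₁ hzQ.1)) _ hzQ.2]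
    have h2 : z.1 = lam (ψ z) := (hlam _ hzN).2.2 z.1 hzρ (by
      rw [h1, add_sub_cancel_left, hακ])
    simp only [hφ]
    rw [← h2, h1, add_sub_cancel_left, hσκ]
  have hψN : ∀ z ∈ Metric.ball (0 : B) ρ ×ˢ V₂, ψ z ∈ N := fun z hz => (hgood z hz).2.2
  have hsubQ : Metric.ball (0 : B) ρ ×ˢ V₂ ⊆ Q := fun z hz => hRQ (hgood z hz).1
  let θ : OpenPartialHomeomorph E (B × H) :=
    { toFun := φ
      invFun := ψ
      source := N ∩ φ ⁻¹' (Metric.ball (0 : B) ρ ×ˢ V₂)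
      target := Metric.ball (0 : B) ρ ×ˢ V₂
      map_source' := fun z hz => hz.2
      map_target' := fun z hz => ⟨hψN z hz, by rw [mem_preimage, hright z hz]; exact hz⟩
      left_inv' := fun z hz => hleft z hz.1
      right_inv' := fun z hz => hright z hz
      open_source := hφc.isOpen_inter_preimage hN hto
      open_target := hto
      continuousOn_toFun := hφc.mono inter_subset_left
      continuousOn_invFun := hψd.continuousOn.mono hsubQ }
  refine ⟨θ, ?_, fun z hz => (h'.subset (hW₂₁ (hNW₂ z hz.1))).1, hφk.mono inter_subset_left,
    hψk.mono hsubQ, ρ, hρ, V₂, hV₂, rfl, fun z hz => ?_⟩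
  · have h00 : (0 : B × H) ∈ Metric.ball (0 : B) ρ ×ˢ V₂ := ⟨Metric.mem_ball_self hρ, h0V₂⟩
    have : ψ 0 ∈ θ.source := θ.map_target h00
    rwa [hψ0] at this
  · have hzt : z ∈ Metric.ball (0 : B) ρ ×ˢ V₂ := hz
    have hzQ := hsubQ hzt
    have hd : ∀ w, HasDirDeriv θ.symm z (w, 0) (dΦ ((τ, x₀ + κ z.2, z.1), (0, 0, w))) := fun w => by
      have := hψd.hasDirDeriv z hzQ (w, 0)
      simp only [_root_.map_zero] at this
      exact this
    have ht : ∀ w, ∃ u, dΦ ((τ, x₀ + κ z.2, z.1), (0, 0, w)) = X (θ.symm z, u) := fun w =>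
      htan τ hτI _ hzQ.1 _ hzQ.2 w
    refine ⟨fun w => ?_, fun u => ?_⟩
    · obtain ⟨u, hu⟩ := ht w
      exact ⟨u, hu ▸ hd w⟩
    · -- vectors in the distribution are determined by their images under `α`
      obtain ⟨w, hw⟩ := hsurj z (hgood z hzt).1 (α (X (θ.symm z, u)))
      obtain ⟨u', hu'⟩ := ht w
      have hzS : θ.symm z ∈ S := (h'.subset (hW₂₁ (hNW₂ _ (hψN z hzt)))).2
      rw [hu'] at hw
      have := hinj _ hzS _ _ hw
      refine ⟨w, ?_⟩
      rw [← this, ← hu']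
      exact hd w

end Local

/-! ### Changes of charts -/

section Charts

variable {E : Type u} [AddCommGroup E] [Module ℝ E] [TopologicalSpace E]
  {M : Type v} [TopologicalSpace M]

/-- The derivative at `p` of the change of coordinates from the chart `e` to the chart `e'`. -/
noncomputable def coordChange (e e' : OpenPartialHomeomorph M E) (p : M) (v : E) : E :=
  dirDeriv (e' ∘ e.symm) (e p) v

omit [AddCommGroup E] [Module ℝ E] in
theorem isOpen_chartDomain (e e' : OpenPartialHomeomorph M E) :
    IsOpen (e.target ∩ e.symm ⁻¹' e'.source) :=
  e.isOpen_inter_preimage_symm e'.open_source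

omit [AddCommGroup E] [Module ℝ E] in
theorem mem_chartDomain {e e' : OpenPartialHomeomorph M E} {p : M} (hp : p ∈ e.source)
    (hp' : p ∈ e'.source) : e p ∈ e.target ∩ e.symm ⁻¹' e'.source :=
  ⟨e.map_source hp, by rwa [mem_preimage, e.left_inv hp]⟩

variable [ChartedSpace E M]

theorem IsCrManifold.isCrChart {r : ℕ} (hM : IsCrManifold r E M) {e : OpenPartialHomeomorph M E}
    (he : e ∈ atlas E M) : IsCrChart r e :=
  fun e' he' => ⟨hM e' he' e he, hM e he e' he'⟩

section
variable {k : ℕ} (hM : IsCrManifold (k + 1) E M) {e e' e'' : OpenPartialHomeomorph M E}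
include hM

theorem IsCrManifold.exists_isC1On (he : e ∈ atlas E M) (he' : e' ∈ atlas E M) :
    ∃ dκ, IsC1On (e' ∘ e.symm) dκ (e.target ∩ e.symm ⁻¹' e'.source) ∧
      KellerOn k dκ ((e.target ∩ e.symm ⁻¹' e'.source) ×ˢ univ) :=
  (hM e he e' he').exists_deriv (isOpen_chartDomain e e')

variable [IsTopologicalAddGroup E] [ContinuousSMul ℝ E] [LocallyConvexSpace ℝ E] [T2Space E]
  {p : M}

omit [IsTopologicalAddGroup E] [ContinuousSMul ℝ E] [LocallyConvexSpace ℝ E] in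
theorem IsCrManifold.hasDirDeriv_coordChange (he : e ∈ atlas E M) (he' : e' ∈ atlas E M)
    (hp : p ∈ e.source) (hp' : p ∈ e'.source) (v : E) :
    HasDirDeriv (e' ∘ e.symm) (e p) v (coordChange e e' p v) := by
  obtain ⟨dκ, hκ, -⟩ := hM.exists_isC1On he he'
  rw [coordChange, hκ.dirDeriv_eq (mem_chartDomain hp hp')]
  exact hκ.hasDirDeriv _ (mem_chartDomain hp hp') v

theorem IsCrManifold.isLinearMap_coordChange (he : e ∈ atlas E M) (he' : e' ∈ atlas E M)
    (hp : p ∈ e.source) (hp' : p ∈ e'.source) : IsLinearMap ℝ (coordChange e e' p) := by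
  obtain ⟨dκ, hκ, -⟩ := hM.exists_isC1On he he'
  have h1 : coordChange e e' p = fun v => dκ (e p, v) := by
    ext v
    rw [coordChange, hκ.dirDeriv_eq (mem_chartDomain hp hp')]
  rw [h1]
  exact hκ.isLinearMap (mem_chartDomain hp hp')

omit hM [LocallyConvexSpace ℝ E] [ChartedSpace E M] in
theorem coordChange_self (hp : p ∈ e.source) (v : E) : coordChange e e p v = v := by
  have h1 : HasDirDeriv (fun x : E => x) (e p) v v :=
    hasDirDeriv_clm (ContinuousLinearMap.id ℝ E) (e p) v
  refine (h1.congr_of_eventuallyEq ?_).dirDeriv_eq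
  filter_upwards [e.open_target.mem_nhds (e.map_source hp)] with x hx
  simp [e.right_inv hx]

/-- Derivatives in the chart `e` of a map into `M` are turned into derivatives in the chart `e'`
by the change of coordinates. -/
theorem IsCrManifold.hasDirDeriv_chart (he : e ∈ atlas E M) (he' : e' ∈ atlas E M)
    {P : Type w} [AddCommGroup P] [Module ℝ P] [TopologicalSpace P] [ContinuousAdd P]
    [ContinuousSMul ℝ P] {g : P → M} {x v : P} {y : E}
    (hg : HasDirDeriv (fun z => e (g z)) x v y) (hx : g x ∈ e.source) (hx' : g x ∈ e'.source)
    (hmem : ∀ᶠ z in 𝓝 x, g z ∈ e.source) :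
    HasDirDeriv (fun z => e' (g z)) x v (coordChange e e' (g x) y) := by
  obtain ⟨dκ, hκ, -⟩ := hM.exists_isC1On he he'
  rw [coordChange, hκ.dirDeriv_eq (mem_chartDomain hx hx')]
  refine (hκ.hasDirDeriv_comp hg (mem_chartDomain hx hx')).congr_of_eventuallyEq ?_
  filter_upwards [hmem] with z hz
  simp [e.left_inv hz]

theorem IsCrManifold.coordChange_coordChange (he : e ∈ atlas E M) (he' : e' ∈ atlas E M)
    (he'' : e'' ∈ atlas E M) (hp : p ∈ e.source) (hp' : p ∈ e'.source) (hp'' : p ∈ e''.source)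
    (v : E) : coordChange e' e'' p (coordChange e e' p v) = coordChange e e'' p v := by
  have h1 := hM.hasDirDeriv_chart he' he'' (g := e.symm) (x := e p) (v := v)
    (hM.hasDirDeriv_coordChange he he' hp hp' v) (by rwa [e.left_inv hp])
    (by rwa [e.left_inv hp]) (by
      filter_upwards [(isOpen_chartDomain e e').mem_nhds (mem_chartDomain hp hp')] with x hx
        using hx.2)
  rw [e.left_inv hp] at h1
  exact h1.unique (hM.hasDirDeriv_coordChange he he'' hp hp'' v)

theorem IsCrManifold.ofChart_toChart (he : e ∈ atlas E M) (hp : p ∈ e.source) (ξ : TSpace E p) :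
    ofChart e p (toChart e p ξ) = ξ :=
  (hM.coordChange_coordChange (chart_mem_atlas E p) he (chart_mem_atlas E p)
    (mem_chart_source E p) hp (mem_chart_source E p) ξ).trans
    (coordChange_self (mem_chart_source E p) ξ)

theorem IsCrManifold.localRep_coordChange (he : e ∈ atlas E M) (he' : e' ∈ atlas E M)
    (X : (p : M) → TSpace E p) {x : E} (hx : x ∈ e.target ∩ e.symm ⁻¹' e'.source) :
    localRep e' X ((e' ∘ e.symm) x) = coordChange e e' (e.symm x) (localRep e X x) := by
  have h1 : ∀ q, q = e.symm x → toChart e' q (X q) = toChart e' (e.symm x) (X (e.symm x)) := by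
    rintro q rfl
    rfl
  exact (h1 _ (e'.left_inv hx.2)).trans (hM.coordChange_coordChange (p := e.symm x)
    (chart_mem_atlas E (e.symm x)) he he' (mem_chart_source E (e.symm x))
    (e.map_target hx.1) hx.2 (X (e.symm x))).symm

end

variable [IsTopologicalAddGroup E] [ContinuousSMul ℝ E] [LocallyConvexSpace ℝ E] [T2Space E]

/-- The Lie bracket of vector fields does not depend on the chart. The second derivatives of
the change of coordinates cancel by symmetry. -/
theorem IsCrManifold.toChart_lieBracket {k : ℕ} (hM : IsCrManifold (k + 2) E M)
    {U : Set M} (hU : IsOpen U) {X Y : (p : M) → TSpace E p}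
    (hX : IsCrVectorFieldOn (k + 1) X U) (hY : IsCrVectorFieldOn (k + 1) Y U)
    {e : OpenPartialHomeomorph M E} (he : e ∈ atlas E M) {p : M} (hp : p ∈ U) (hpe : p ∈ e.source) :
    toChart e p (lieBracket X Y p) =
      dirDeriv (localRep e Y) (e p) (localRep e X (e p)) -
        dirDeriv (localRep e X) (e p) (localRep e Y (e p)) := by
  set e' := chartAt E p with he'def
  have he' : e' ∈ atlas E M := chart_mem_atlas E p
  have hpe' : p ∈ e'.source := mem_chart_source E p
  obtain ⟨dκ, hκ, hκk⟩ := hM.exists_isC1On he' he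
  obtain ⟨ddκ, hdκ, -⟩ := hκk.exists_deriv (hκ.isOpen.prod isOpen_univ)
  have hO := mem_chartDomain hpe' hpe
  have hopen : ∀ e₁ : OpenPartialHomeomorph M E, IsOpen (e₁.target ∩ e₁.symm ⁻¹' U) := fun e₁ =>
    e₁.isOpen_inter_preimage_symm hU
  have hmemU : ∀ e₁ : OpenPartialHomeomorph M E, p ∈ e₁.source → e₁ p ∈ e₁.target ∩ e₁.symm ⁻¹' U :=
    fun e₁ h₁ => ⟨e₁.map_source h₁, by rwa [mem_preimage, e₁.left_inv h₁]⟩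
  have hcc : ∀ x ∈ e'.target ∩ e'.symm ⁻¹' e.source, ∀ v,
      coordChange e' e (e'.symm x) v = dκ (x, v) := fun x hx v => by
    rw [coordChange, e'.right_inv hx.1, hκ.dirDeriv_eq hx]
  have hkp : (e ∘ e'.symm) (e' p) = e p := by simp [e'.left_inv hpe']
  -- the derivative of `Y` along `X` in the chart `e`, by the chain rule
  have key : ∀ X Y : (p : M) → TSpace E p, IsCrVectorFieldOn (k + 1) X U →
      IsCrVectorFieldOn (k + 1) Y U →
      dirDeriv (localRep e Y) (e p) (localRep e X (e p)) =
        ddκ ((e' p, localRep e' Y (e' p)), (localRep e' X (e' p), 0)) +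
          dκ (e' p, dirDeriv (localRep e' Y) (e' p) (localRep e' X (e' p))) := by
    intro X Y hX hY
    obtain ⟨dY, hdY, -⟩ := (hY e he).exists_deriv (hopen e)
    obtain ⟨dY', hdY', -⟩ := (hY e' he').exists_deriv (hopen e')
    rw [hdY.dirDeriv_eq (hmemU e hpe), hdY'.dirDeriv_eq (hmemU e' hpe')]
    have h1 := hdY.hasDirDeriv_comp (hκ.hasDirDeriv (e' p) hO (localRep e' X (e' p)))
      (by rw [hkp]; exact hmemU e hpe)
    have hXX : dκ (e' p, localRep e' X (e' p)) = localRep e X (e p) := by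
      rw [← hcc _ hO, ← hM.localRep_coordChange he' he X hO, hkp]
    rw [hkp, hXX] at h1
    have h2 := hdκ.hasDirDeriv_comp (g := fun x => (x, localRep e' Y x))
      ((hasDirDeriv_clm (ContinuousLinearMap.id ℝ E) (e' p) (localRep e' X (e' p))).prodMk
        (hdY'.hasDirDeriv (e' p) (hmemU e' hpe') (localRep e' X (e' p)))) ⟨hO, trivial⟩
    have h3 := hdκ.deriv_add (x := (e' p, localRep e' Y (e' p))) ⟨hO, trivial⟩
      (localRep e' X (e' p), 0) (0, dY' (e' p, localRep e' X (e' p)))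
    rw [hκ.second_deriv_right hdκ hO, Prod.mk_add_mk, add_zero, zero_add] at h3
    rw [← h3]
    refine h1.unique (h2.congr_of_eventuallyEq ?_)
    filter_upwards [hκ.isOpen.mem_nhds hO] with x hx
    rw [← hcc x hx, hM.localRep_coordChange he' he Y hx]
  rw [key X Y hX hY, key Y X hY hX, hκ.second_deriv_symm hdκ hO (localRep e' X (e' p))]
  have h1 : ∀ ξ : TSpace E p, toChart e p ξ = dκ (e' p, ξ) := fun ξ => by
    rw [toChart, hκ.dirDeriv_eq hO]
  rw [h1, lieBracket, hκ.deriv_sub hO]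
  abel

omit [T2Space E] in
/-- Composing a chart with a `C^r`-diffeomorphism between open sets of the model space gives
a chart. -/
theorem IsCrChart.trans {r : ℕ} {φ : OpenPartialHomeomorph M E} (hφ : IsCrChart r φ)
    {θ : OpenPartialHomeomorph E E} (hθ : KellerOn r θ θ.source)
    (hθ' : KellerOn r θ.symm θ.target) : IsCrChart r (φ.trans θ) := by
  intro e he
  obtain ⟨h1, h2⟩ := hφ e he
  refine ⟨?_, ?_⟩
  · rw [OpenPartialHomeomorph.coe_trans, Function.comp_assoc, OpenPartialHomeomorph.trans_source]
    exact hθ.comp (h1.mono fun x hx => ⟨hx.1, hx.2.1⟩) θ.open_source fun x hx => hx.2.2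
  · rw [OpenPartialHomeomorph.coe_trans_symm, ← Function.comp_assoc,
      OpenPartialHomeomorph.trans_target]
    exact h2.comp (hθ'.mono fun x hx => hx.1.1) (isOpen_chartDomain φ e)
      fun x hx => ⟨hx.1.2, hx.2⟩

end Charts

/-! ### Slices of a chart -/

section Slices

variable {E : Type u} [AddCommGroup E] [Module ℝ E] [TopologicalSpace E]
  [IsTopologicalAddGroup E]
  {M : Type v} [TopologicalSpace M]
  {F H : Submodule ℝ E} {φ : OpenPartialHomeomorph M E} {V₁ : Set F} {V₂ : Set H}

/-- The chart `φ⁻¹(x + y) ↦ x` of the slice through `y`, with values in `V₁`. It is defined on the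
whole slice; the point `q₀` only serves as the value of the inverse outside of `V₁`. -/
noncomputable def sliceChart (hFH : F.IsTopCompl H) (hV₁ : IsOpen V₁)
    (hφ : φ.target = {z | ∃ x ∈ V₁, ∃ y ∈ V₂, z = (x : E) + (y : E)}) {y : H} (hy : y ∈ V₂)
    (q₀ : slice φ V₁ (y : E)) : OpenPartialHomeomorph (slice φ V₁ (y : E)) F :=
  have hmem : ∀ x ∈ V₁, (x : E) + y ∈ φ.target := fun x hx => by
    rw [hφ]; exact ⟨x, hx, y, hy, rfl⟩
  have hproj : ∀ x : F, F.projectionOntoL H hFH ((x : E) + y) = x := fun x => by simp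
  have hval : ∀ q : slice φ V₁ (y : E), F.projectionOntoL H hFH (φ q) ∈ V₁ ∧
      (q : M) = φ.symm ((F.projectionOntoL H hFH (φ q) : E) + y) ∧ (q : M) ∈ φ.source := by
    rintro ⟨q, x, hx, rfl⟩
    simp only [φ.right_inv (hmem x hx), hproj]
    exact ⟨hx, trivial, φ.map_target (hmem x hx)⟩
  open Classical in
  { toFun := fun q => F.projectionOntoL H hFH (φ q)
    invFun := fun x => if hx : x ∈ V₁ then ⟨φ.symm ((x : E) + y), x, hx, rfl⟩ else q₀
    source := univ
    target := V₁
    map_source' := fun q _ => (hval q).1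
    map_target' := fun _ _ => trivial
    left_inv' := fun q _ => by
      rw [dif_pos (hval q).1]
      exact Subtype.ext (hval q).2.1.symm
    right_inv' := fun x hx => by
      rw [dif_pos hx, φ.right_inv (hmem x hx), hproj]
    open_source := isOpen_univ
    open_target := hV₁
    continuousOn_toFun := by
      refine (F.projectionOntoL H hFH).continuous.comp_continuousOn ?_
      exact φ.continuousOn.comp continuous_subtype_val.continuousOn fun q _ => (hval q).2.2
    continuousOn_invFun := by
      rw [Topology.IsInducing.subtypeVal.continuousOn_iff]
      have h1 : ContinuousOn (fun x : F => φ.symm ((x : E) + y)) V₁ :=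
        φ.continuousOn_symm.comp (by fun_prop) hmem
      refine h1.congr fun x hx => ?_
      simp [hx] }

variable (hFH : F.IsTopCompl H) (hV₁ : IsOpen V₁)
  (hφ : φ.target = {z | ∃ x ∈ V₁, ∃ y ∈ V₂, z = (x : E) + (y : E)}) {y : H} (hy : y ∈ V₂)
  (q₀ : slice φ V₁ (y : E))

theorem sliceChart_symm_apply {x : F} (hx : x ∈ V₁) :
    ((sliceChart hFH hV₁ hφ hy q₀).symm x : M) = φ.symm ((x : E) + y) :=
  congrArg Subtype.val (dif_pos hx)

variable [ContinuousSMul ℝ E] [LocallyConvexSpace ℝ E] [T2Space E] [ChartedSpace E M]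

/-- A chart with product image is a Frobenius chart if its derivatives in the directions of `F`
span the distribution. -/
theorem IsCrChart.isFrobeniusChart {r : ℕ} {D : (p : M) → Submodule ℝ (TSpace E p)}
    (hφr : IsCrChart r φ) (hFH : F.IsTopCompl H) (hV₁ : IsOpen V₁) (hV₁c : IsConnected V₁)
    (hV₂ : IsOpen V₂) (hφ : φ.target = {z | ∃ x ∈ V₁, ∃ y ∈ V₂, z = (x : E) + (y : E)})
    (htan : ∀ z ∈ φ.target,
      (∀ ξ : F, ∃ η ∈ D (φ.symm z),
        HasDirDeriv (chartAt E (φ.symm z) ∘ φ.symm) z (ξ : E) η) ∧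
      ∀ η ∈ D (φ.symm z), ∃ ξ : F,
        HasDirDeriv (chartAt E (φ.symm z) ∘ φ.symm) z (ξ : E) η) :
    IsFrobeniusChart r F H D φ := by
  refine ⟨hφr, V₁, V₂, hV₁, hV₂, hφ, fun y hy => ?_⟩
  have hmem : ∀ x ∈ V₁, (x : E) + y ∈ φ.target := fun x hx => by
    rw [hφ]; exact ⟨x, hx, y, hy, rfl⟩
  obtain ⟨x₀, hx₀⟩ := hV₁c.nonempty
  let q₀ : slice φ V₁ (y : E) := ⟨φ.symm ((x₀ : E) + y), x₀, hx₀, rfl⟩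
  let c := sliceChart hFH hV₁ hφ hy q₀
  have hc : ∀ x ∈ V₁, (c.symm x : M) = φ.symm ((x : E) + y) := fun x hx =>
    sliceChart_symm_apply hFH hV₁ hφ hy q₀ hx
  let _ : ChartedSpace F (slice φ V₁ (y : E)) := c.singletonChartedSpace rfl
  have hatlas : ∀ e ∈ atlas F (slice φ V₁ (y : E)), e = c := fun e he => he
  have hman : IsCrManifold r F (slice φ V₁ (y : E)) := by
    intro e he e' he'
    rw [hatlas e he, hatlas e' he']
    refine (kellerOn_clm (ContinuousLinearMap.id ℝ F) _).congr (isOpen_chartDomain c c) ?_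
    intro x hx
    simp [c.right_inv hx.1]
  refine ⟨inferInstance, ⟨hman, Subtype.val_injective, continuous_subtype_val, fun p => ?_⟩, ?_, fun p => ?_⟩
  · -- a translate of `φ` restricts to the chart of the slice
    let τ : OpenPartialHomeomorph E E := (Homeomorph.addRight (-(y : E))).toOpenPartialHomeomorph
    have htr : ∀ (a : E) (S : Set E), KellerOn r (fun x => x + a) S := fun a S =>
      (kellerOn_clm (ContinuousLinearMap.id ℝ E) S).add (kellerOn_const a S)
    refine ⟨c, φ.trans τ, hman.isCrChart rfl, hφr.trans (θ := τ) (htr _ _) ?_, trivial, ?_, ?_, ?_⟩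
    · refine (htr (y : E) _).congr τ.open_target fun x _ => ?_
      change x + y = x + -(-(y : E))
      rw [neg_neg]
    · obtain ⟨q, x, hx, rfl⟩ := p
      simpa [τ] using φ.map_target (hmem x hx)
    · rintro ⟨q, x, hx, rfl⟩ -
      simpa [τ] using φ.map_target (hmem x hx)
    · intro x hx
      have : φ (c.symm x) = (x : E) + y := by rw [hc x hx, φ.right_inv (hmem x hx)]
      simp [τ, this]
  · have h1 : IsConnected (slice φ V₁ (y : E)) := by
      have h2 : slice φ V₁ (y : E) = (fun x : F => φ.symm ((x : E) + y)) '' V₁ := by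
        ext q
        simp only [slice, mem_ofPred_eq, mem_image]
        exact ⟨fun ⟨x, hx, h⟩ => ⟨x, hx, h.symm⟩, fun ⟨x, hx, h⟩ => ⟨x, hx, h.symm⟩⟩
      rw [h2]
      exact hV₁c.image _ (φ.continuousOn_symm.comp (by fun_prop) hmem)
    exact isConnected_iff_connectedSpace.1 h1
  · obtain ⟨x, hx, rfl⟩ : ∃ x ∈ V₁, p = c.symm x :=
      ⟨c p, c.map_source trivial, (c.left_inv trivial).symm⟩
    have hp : ((c.symm x : slice φ V₁ (y : E)) : M) = φ.symm ((x : E) + y) := hc x hx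
    obtain ⟨h1, h2⟩ := htan _ (hmem x hx)
    rw [← hp] at h1 h2
    have hcx : c (c.symm x) = x := c.right_inv hx
    have key : ∀ (ξ : F) (η : E),
        HasDirDeriv (chartAt E ((c.symm x : slice φ V₁ (y : E)) : M) ∘ φ.symm) ((x : E) + y) (ξ : E) η →
        tangentMapIncl F Subtype.val (c.symm x) ξ = η := by
      intro ξ η h3
      rw [add_comm] at h3
      have h4 := HasDirDeriv.comp_affine F.subtype (y : E) (p := x) (v := ξ) h3
      have h5 : HasDirDeriv (chartAt E ((c.symm x : slice φ V₁ (y : E)) : M) ∘ Subtype.val ∘ c.symm)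
          x ξ η := by
        refine h4.congr_of_eventuallyEq ?_
        filter_upwards [hV₁.mem_nhds hx] with x' hx'
        simp only [Function.comp, hc x' hx', Submodule.subtype_apply, add_comm]
      have h6 := h5.dirDeriv_eq
      rw [← hcx] at h6
      simp only [c.right_inv hx] at h6
      rw [tangentMapIncl]
      change dirDeriv (chartAt E ((c.symm x : slice φ V₁ (y : E)) : M) ∘ Subtype.val ∘ c.symm)
        (c (c.symm x)) ξ = η
      rw [hcx]
      exact h6
    ext η
    constructor
    · rintro ⟨ξ, rfl⟩
      obtain ⟨η, hη, h3⟩ := h1 ξ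
      rw [key ξ η h3]
      exact hη
    · intro hη
      obtain ⟨ξ, h3⟩ := h2 η hη
      exact ⟨ξ, key ξ η h3⟩

end Slices

/-! ### From the manifold to a chart -/

section Frobenius

variable {E : Type u} [AddCommGroup E] [Module ℝ E] [TopologicalSpace E]
  [IsTopologicalAddGroup E] [ContinuousSMul ℝ E] [LocallyConvexSpace ℝ E] [T2Space E]
  {M : Type v} [TopologicalSpace M] [ChartedSpace E M]
  {P : Type u} [AddCommGroup P] [Module ℝ P] [TopologicalSpace P] [ContinuousAdd P]
  {B : Type u} [NormedAddCommGroup B] [NormedSpace ℝ B]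

omit [IsTopologicalAddGroup E] [ContinuousSMul ℝ E] [LocallyConvexSpace ℝ E] [T2Space E] in
/-- Reparametrization by a continuous linear map. -/
theorem IsCrParamVectorFieldOn.comp_clm [ContinuousAdd E] {k : ℕ} {X : (p : M) → P → TSpace E p}
    {U : Set M} (hX : IsCrParamVectorFieldOn k X U) (L : B →L[ℝ] P) :
    IsCrParamVectorFieldOn k (fun p b => X p (L b)) U := fun e he =>
  (hX e he).comp_clm ((ContinuousLinearMap.id ℝ E).prodMap L) fun _ hz => ⟨hz.1, trivial⟩

omit [IsTopologicalAddGroup E] [ContinuousSMul ℝ E] [LocallyConvexSpace ℝ E] [T2Space E] in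
/-- Reparametrization by a continuous linear map. -/
theorem ProvidesLocalFlow.comp_clm [ContinuousAdd E] {r : ℕ} {X : (p : M) → P → TSpace E p}
    {U : Set M} (hX : ProvidesLocalFlow r U X) (L : B →L[ℝ] P) :
    ProvidesLocalFlow r U (fun p b => X p (L b)) := by
  obtain ⟨Φ, Ω, h, hd⟩ := hX
  have hc : Continuous fun z : ℝ × M × B => (z.1, z.2.1, L z.2.2) := by fun_prop
  refine ⟨fun z => Φ (z.1, z.2.1, L z.2.2), {z | (z.1, z.2.1, L z.2.2) ∈ Ω},
    ⟨h.isOpen.preimage hc, fun z hz => h.subset _ hz, fun z hz => h.mapsTo _ hz,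
      ⟨h.contDiff.1.comp hc.continuousOn fun z hz => hz, fun e he e' he' => ?_⟩,
      fun x hx b => h.zero_mem x hx _, fun x hx b => h.map_zero x hx _, fun x hx b => ?_⟩,
    fun x hx b => hd x hx _⟩
  · exact (h.contDiff.2 e he e' he').comp_clm
      ((ContinuousLinearMap.id ℝ ℝ).prodMap ((ContinuousLinearMap.id ℝ E).prodMap L))
      fun z hz => hz
  · obtain ⟨ε, hε, W, hW, V, hV, h1, h2, h3⟩ := h.map_add x hx (L b)
    exact ⟨ε, hε, W, hW, L ⁻¹' V, L.continuous.continuousAt hV,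
      fun t ht y hy q hq => h1 t ht y hy _ hq, fun t ht s hs y hy q hq => h2 t ht s hs y hy _ hq,
      fun t ht s hs hts y hy q hq => h3 t ht s hs hts y hy _ hq⟩

/-- In a chart, the local flow of a family of vector fields is a local flow with parameters. -/
theorem ProvidesLocalFlow.exists_isParamFlow {k : ℕ} (hM : IsCrManifold (k + 1) E M)
    {X : (p : M) → B → TSpace E p} {U : Set M} (hX : ProvidesLocalFlow (k + 1) U X)
    {e : OpenPartialHomeomorph M E} (he : e ∈ atlas E M) {S : Set M} (hS : IsOpen S) (hSU : S ⊆ U)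
    (hSe : S ⊆ e.source) {p₀ : M} (hp₀ : p₀ ∈ S) :
    ∃ ε > 0, ∃ (W₀ W₁ : Set E) (V : Set B) (Φ : ℝ × E × B → E),
      IsParamFlow ε W₀ W₁ V Φ (fun z => toChart e (e.symm z.1) (X (e.symm z.1) z.2)) ∧
      KellerOn (k + 1) Φ (Ioo (-ε) ε ×ˢ (W₀ ×ˢ V)) ∧ e p₀ ∈ W₁ ∧ 0 ∈ V ∧
      W₀ ⊆ e.target ∩ e.symm ⁻¹' S := by
  obtain ⟨Φ, Ω, h, hd⟩ := hX
  obtain ⟨ε₀, hε₀, W, hW, V, hV, hΩ, -, hadd⟩ := h.map_add p₀ (hSU hp₀) 0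
  have hΦc : ContinuousAt Φ (0, p₀, 0) :=
    h.contDiff.1.continuousAt (h.isOpen.mem_nhds (h.zero_mem p₀ (hSU hp₀) 0))
  have hΦ0 : Φ (0, p₀, 0) = p₀ := h.map_zero p₀ (hSU hp₀) 0
  obtain ⟨η₁, hη₁, N₁, hN₁, hpN₁, ρ₁, hρ₁, hm₁⟩ := exists_nhds_mapsTo hΦc hΦ0
    (e.open_source.mem_nhds (hSe hp₀))
  -- initial values in `Y` stay in the chart, and those in `N₂` stay in `Y`
  obtain ⟨W', hW'W, hW', hpW'⟩ := _root_.mem_nhds_iff.1 hW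
  obtain ⟨V', hV'V, hV', h0V'⟩ := _root_.mem_nhds_iff.1 hV
  set Y : Set M := S ∩ (N₁ ∩ W') with hY
  have hYo : IsOpen Y := hS.inter (hN₁.inter hW')
  have hpY : p₀ ∈ Y := ⟨hp₀, hpN₁, hpW'⟩
  obtain ⟨η₂, hη₂, N₂, hN₂, hpN₂, ρ₂, hρ₂, hm₂⟩ := exists_nhds_mapsTo hΦc hΦ0 (hYo.mem_nhds hpY)
  set ε := min ε₀ (min η₁ η₂) with hε
  have l1 : ε ≤ ε₀ := min_le_left _ _
  have l2 : ε ≤ η₁ := (min_le_right _ _).trans (min_le_left _ _)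
  have l3 : ε ≤ η₂ := (min_le_right _ _).trans (min_le_right _ _)
  have hI : ∀ {a t : ℝ}, ε ≤ a → t ∈ Ioo (-ε) ε → t ∈ Ioo (-a) a := fun ha ht =>
    ⟨by linarith [ht.1], by linarith [ht.2]⟩
  set V₀ : Set B := V' ∩ (Metric.ball 0 ρ₁ ∩ Metric.ball 0 ρ₂) with hV₀
  have hdom : ∀ t ∈ Ioo (-ε) ε, ∀ p ∈ Y, ∀ b ∈ V₀, (t, p, b) ∈ Ω ∧ Φ (t, p, b) ∈ e.source :=
    fun t ht p hp b hb => ⟨hΩ t (hI l1 ht) p (hW'W hp.2.2) b (hV'V hb.1),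
      hm₁ t (hI l2 ht) p hp.2.1 b hb.2.1⟩
  refine ⟨ε, lt_min hε₀ (lt_min hη₁ hη₂), e.target ∩ e.symm ⁻¹' Y, e.target ∩ e.symm ⁻¹' (Y ∩ N₂),
    V₀, fun z => e (Φ (z.1, e.symm z.2.1, z.2.2)), ?_, ?_, ?_, ?_, ?_⟩
  · exact
    { isOpen₀ := e.isOpen_inter_preimage_symm hYo
      isOpen₁ := e.isOpen_inter_preimage_symm (hYo.inter hN₂)
      isOpen_param := hV'.inter (Metric.isOpen_ball.inter Metric.isOpen_ball)
      subset := fun x hx => ⟨hx.1, hx.2.1⟩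
      mapsTo := fun t ht x hx v hv => by
        have h1 := (hdom t ht _ hx.2.1 v hv).2
        refine ⟨e.map_source h1, ?_⟩
        rw [mem_preimage, e.left_inv h1]
        exact hm₂ t (hI l3 ht) _ hx.2.2 v hv.2.2
      map_zero := fun x hx v hv => by
        rw [h.map_zero _ (hSU hx.2.1), e.right_inv hx.1]
      map_add := fun t ht s hs hts x hx v hv => by
        have h1 := (hdom s hs _ hx.2.1 v hv).2
        simp only [e.left_inv h1]
        rw [hadd t (hI l1 ht) s (hI l1 hs) (hI l1 hts) _ (hW'W hx.2.1.2.2) v (hV'V hv.1)]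
      hasDirDeriv_zero := fun x hx v hv => by
        set p := e.symm x with hp
        have hpU : p ∈ U := hSU hx.2.1
        have h0 : Φ (0, p, v) = p := h.map_zero p hpU v
        have h1 : HasDirDeriv (fun t => chartAt E p (Φ (t, p, v))) 0 1 (X p v) := by
          have := hd p hpU v
          simpa [HasDirDeriv, h0] using this
        have h2 : ContinuousAt (fun t => Φ (t, p, v)) 0 := by
          have h3 : ContinuousAt Φ (0, p, v) :=
            h.contDiff.1.continuousAt (h.isOpen.mem_nhds (h.zero_mem p hpU v))
          have h4 : ContinuousAt (fun t : ℝ => (t, p, v)) 0 := by fun_prop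
          exact ContinuousAt.comp (f := fun t : ℝ => (t, p, v)) h3 h4
        have h5 := hM.hasDirDeriv_chart (chart_mem_atlas E p) he (g := fun t => Φ (t, p, v)) h1
          (by rw [h0]; exact mem_chart_source E p) (by rw [h0]; exact hSe hx.2.1)
          (h2.eventually ((chartAt E p).open_source.mem_nhds (by
            change Φ (0, p, v) ∈ _; rw [h0]; exact mem_chart_source E p)))
        beta_reduce at h5
        rw [h0] at h5
        exact h5 }
  · refine (h.contDiff.2 e he e he).mono ?_
    rintro ⟨t, x, b⟩ ⟨ht, hx, hb⟩
    exact ⟨hx.1, hdom t ht _ hx.2 b hb⟩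
  · have hpe := hSe hp₀
    refine ⟨e.map_source hpe, ?_⟩
    rw [mem_preimage, e.left_inv hpe]
    exact ⟨hpY, hpN₂⟩
  · exact ⟨h0V', Metric.mem_ball_self hρ₁, Metric.mem_ball_self hρ₂⟩
  · exact fun x hx => ⟨hx.1, hx.2.1⟩

variable [CompleteSpace B]

/-- Near `p₀`, the distribution is spanned by the vector fields `X (·, b)`, since operators close to
an invertible one on a Banach space are invertible. Moreover, the trivialization of the distribution
at `p₀` splits the tangent space at `p₀` into `D p₀` and a copy of `H`. -/
theorem IsSubbundle.exists_splitting {k : ℕ} (hM : IsCrManifold (k + 2) E M) {F H : Submodule ℝ E}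
    (hFH : F.IsTopCompl H) {D : (p : M) → Submodule ℝ (TSpace E p)}
    (hD : IsSubbundle (k + 1) F D) {U : Set M} (hU : IsOpen U) {X : (p : M) → B → TSpace E p}
    (hX : IsCrParamVectorFieldOn (k + 1) X U) (hXlin : ∀ p ∈ U, IsLinearMap ℝ (X p))
    (hXD : ∀ p ∈ U, ∀ b, X p b ∈ D p) {p₀ : M} (hp₀ : p₀ ∈ U) (L : B ≃L[ℝ] D p₀)
    (hL : ∀ b, ((L b : D p₀) : TSpace E p₀) = X p₀ b) :
    (∃ S ⊆ U, IsOpen S ∧ p₀ ∈ S ∧ ∀ p ∈ S, ∀ ξ ∈ D p, ∃ b, X p b = ξ) ∧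
    ∃ (α : E →L[ℝ] B) (σ : E →L[ℝ] H) (κ : H →L[ℝ] E), (∀ b, α (X p₀ b) = b) ∧
      (∀ y, α (κ y) = 0) ∧ (∀ y, σ (κ y) = y) ∧ ∀ u, α u = 0 → κ (σ u) = u := by
  obtain ⟨U', hU', hp₀U', ψ, hψ, hψD⟩ := hD p₀
  set ψ₀ : E ≃L[ℝ] E := ψ p₀ with hψ₀
  have hmemD : ∀ f : F, ψ₀.symm f ∈ D p₀ := fun f => (hψD p₀ hp₀U' _).2 (by
    rw [← hψ₀, ContinuousLinearEquiv.apply_symm_apply]; exact f.2)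
  -- the projection onto `D p₀`, in terms of the parameters
  let α₁ : F →L[ℝ] B := (L.symm : D p₀ →L[ℝ] B).comp
    (((ψ₀.symm : E →L[ℝ] E).comp F.subtypeL).codRestrict (D p₀) hmemD)
  have hα₁ : ∀ f, X p₀ (α₁ f) = ψ₀.symm f := fun f => by
    rw [← hL]
    simp [α₁]
    rfl
  have hα₁' : ∀ b (hb : ψ₀ (X p₀ b) ∈ F), α₁ ⟨ψ₀ (X p₀ b), hb⟩ = b := fun b hb => by
    have h1 : L (α₁ ⟨ψ₀ (X p₀ b), hb⟩) = L b := Subtype.ext (by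
      rw [hL, hL, hα₁]; simp)
    exact L.injective h1
  have hα₁inj : Function.Injective α₁ := fun f g hfg => by
    have h1 := hα₁ f
    rw [hfg, hα₁] at h1
    exact Subtype.ext (ψ₀.symm.injective h1.symm)
  have hXF : ∀ b, ψ₀ (X p₀ b) ∈ F := fun b => (hψD p₀ hp₀U' _).1 (hXD p₀ hp₀ b)
  refine ⟨?_, α₁.comp ((F.projectionOntoL H hFH).comp (ψ₀ : E →L[ℝ] E)),
    (H.projectionOntoL F hFH.symm).comp (ψ₀ : E →L[ℝ] E),
    (ψ₀.symm : E →L[ℝ] E).comp H.subtypeL, fun b => ?_, fun y => ?_, fun y => ?_, fun u hu => ?_⟩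
  · -- the coordinates of `X (p, b)` in the trivialization
    set e := chartAt E p₀ with he
    have hea : e ∈ atlas E M := chart_mem_atlas E p₀
    have hpe : p₀ ∈ e.source := mem_chart_source E p₀
    set O := e.target ∩ e.symm ⁻¹' (U ∩ U') with hO
    have hOo : IsOpen O := e.isOpen_inter_preimage_symm (hU.inter hU')
    have hxO : e p₀ ∈ O :=
      ⟨e.map_source hpe, by rw [mem_preimage, e.left_inv hpe]; exact ⟨hp₀, hp₀U'⟩⟩
    let A : E × B → B := fun z =>
      α₁ (F.projectionOntoL H hFH (ψ (e.symm z.1) (X (e.symm z.1) z.2)))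
    -- points enter through the types of tangent vectors, so `e.left_inv` is used via an equation
    have hAe : ∀ p ∈ e.source, ∀ b, A (e p, b) = α₁ (F.projectionOntoL H hFH (ψ p (X p b))) :=
      fun p hp b => by
        have h : ∀ q, q = p → α₁ (F.projectionOntoL H hFH (ψ q (X q b))) =
            α₁ (F.projectionOntoL H hFH (ψ p (X p b))) := by
          rintro q rfl
          rfl
        exact h _ (e.left_inv hp)
    have hA1 : KellerOn 1 A (O ×ˢ univ) := by
      have h1 : KellerOn (k + 1) (fun z : E × B =>
          (z.1, toChart e (e.symm z.1) (X (e.symm z.1) z.2))) (O ×ˢ univ) :=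
        (kellerOn_clm (ContinuousLinearMap.fst ℝ E B) _).prodMk
          ((hX e hea).mono fun z hz => ⟨⟨hz.1.1, hz.1.2.1⟩, trivial⟩)
      have h2 := ((hψ e hea).1.comp h1 ((e.isOpen_inter_preimage_symm hU').prod isOpen_univ)
        (fun z hz => ⟨⟨hz.1.1, hz.1.2.2⟩, trivial⟩)).clm_comp
          (α₁.comp (F.projectionOntoL H hFH))
      refine (h2.of_le (show 1 ≤ k + 1 by omega)).congr (hOo.prod isOpen_univ) fun z hz => ?_
      have hz1 : e.symm z.1 ∈ e.source := e.map_target hz.1.1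
      simp only [A, ContinuousLinearMap.comp_apply]
      rw [hM.ofChart_toChart hea hz1]
    obtain ⟨dA, hdA, -⟩ := hA1.exists_deriv (hOo.prod isOpen_univ)
    obtain ⟨R, hRO, hR, hxR, -, J, -, hJ, -⟩ := exists_inverse_family hdA
      (fun x hx => ⟨fun b c => by simp only [A, (hXlin _ hx.2.1).map_add, map_add],
        fun s b => by simp only [A, (hXlin _ hx.2.1).map_smul, map_smul]⟩) hxO (fun b => by
        rw [hAe p₀ hpe]
        have h1 : F.projectionOntoL H hFH (ψ p₀ (X p₀ b)) = ⟨ψ₀ (X p₀ b), hXF b⟩ :=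
          Submodule.projectionOntoL_apply_left hFH ⟨ψ₀ (X p₀ b), hXF b⟩
        rw [h1, hα₁'])
    refine ⟨e.source ∩ e ⁻¹' R, fun p hp => ?_, e.isOpen_inter_preimage hR, ⟨hpe, hxR⟩,
      fun p hp ξ hξ => ?_⟩
    · have := (hRO hp.2).2.1
      rwa [e.left_inv hp.1] at this
    · have hpUU' : p ∈ U ∩ U' := by
        have := (hRO hp.2).2
        rwa [mem_preimage, e.left_inv hp.1] at this
      have hξF := (hψD p hpUU'.2 ξ).1 hξ
      have hX' : ∀ b, ψ p (X p b) ∈ F := fun b => (hψD p hpUU'.2 _).1 (hXD p hpUU'.1 b)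
      refine ⟨J (e p, α₁ ⟨ψ p ξ, hξF⟩), ?_⟩
      have h1 := (hJ (e p) hp.2 (α₁ ⟨ψ p ξ, hξF⟩)).1
      rw [hAe p hp.1] at h1
      have h2 := hα₁inj h1
      rw [show F.projectionOntoL H hFH (ψ p (X p (J (e p, α₁ ⟨ψ p ξ, hξF⟩)))) = ⟨_, hX' _⟩ from
        Submodule.projectionOntoL_apply_left hFH ⟨_, hX' _⟩] at h2
      exact (ψ p).injective (congrArg Subtype.val h2)
  · simp only [ContinuousLinearMap.comp_apply, ContinuousLinearEquiv.coe_coe]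
    have h1 : F.projectionOntoL H hFH (ψ₀ (X p₀ b)) = ⟨ψ₀ (X p₀ b), hXF b⟩ :=
      Submodule.projectionOntoL_apply_left hFH ⟨ψ₀ (X p₀ b), hXF b⟩
    rw [h1, hα₁']
  · simp
  · simp
  · have h1 : F.projectionOntoL H hFH (ψ₀ u) = 0 := hα₁inj (by simpa using hu)
    rw [Submodule.projectionOntoL_apply_eq_zero_iff] at h1
    have h2 : H.projectionOntoL F hFH.symm (ψ₀ u) = ⟨ψ₀ u, h1⟩ :=
      Submodule.projectionOntoL_apply_left hFH.symm ⟨ψ₀ u, h1⟩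
    simp [h2]

end Frobenius

/-! ### Frobenius charts -/

section Existence

variable {E : Type u} [AddCommGroup E] [Module ℝ E] [TopologicalSpace E]
  [IsTopologicalAddGroup E] [ContinuousSMul ℝ E] [LocallyConvexSpace ℝ E] [T2Space E]
  {M : Type v} [TopologicalSpace M] [ChartedSpace E M]
  {B : Type u} [NormedAddCommGroup B] [NormedSpace ℝ B]

/-- In a chart, involutivity says that the bracket of the vector fields given by two parameters
is again given by a parameter. -/
theorem IsInvolutive.exists_bracket_eq {k : ℕ} (hM : IsCrManifold (k + 2) E M)
    {D : (p : M) → Submodule ℝ (TSpace E p)} (hinv : IsInvolutive (k + 1) D) {U S : Set M}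
    (hU : IsOpen U) (hSU : S ⊆ U) {X : (p : M) → B → TSpace E p}
    (hX : IsCrParamVectorFieldOn (k + 1) X U) (hXD : ∀ p ∈ U, ∀ b, X p b ∈ D p)
    (hDX : ∀ p ∈ S, ∀ ξ ∈ D p, ∃ b, X p b = ξ) {e : OpenPartialHomeomorph M E}
    (he : e ∈ atlas E M) {dX : (E × B) × (E × B) → E} {W : Set E} (hW : W ⊆ e.target ∩ e.symm ⁻¹' S)
    (hdX : IsC1On (fun z : E × B => toChart e (e.symm z.1) (X (e.symm z.1) z.2)) dX (W ×ˢ univ))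
    {x : E} (hx : x ∈ W) (v w : B) :
    ∃ u, dX ((x, w), (toChart e (e.symm x) (X (e.symm x) v), 0)) -
      dX ((x, v), (toChart e (e.symm x) (X (e.symm x) w), 0)) =
        toChart e (e.symm x) (X (e.symm x) u) := by
  have hxS : e.symm x ∈ S := (hW hx).2
  have hloc : ∀ (e : OpenPartialHomeomorph M E) (b : B) (y : E) (z : E × B), z = (y, b) →
      localRep e (fun q => X q b) y = toChart e (e.symm z.1) (X (e.symm z.1) z.2) := by
    rintro e b y _ rfl
    rfl
  have hfield : ∀ b, IsCrVectorFieldOn (k + 1) (fun q => X q b) U := fun b e' he' => by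
    have h1 := (hX e' he').comp_affine (ContinuousLinearMap.inl ℝ E B) ((0 : E), b)
      (V := e'.target ∩ e'.symm ⁻¹' U) (fun y hy => ⟨by simpa using hy, trivial⟩)
    convert h1 using 1
    ext y
    exact hloc e' b y _ (by simp)
  have hrep : ∀ b y, dirDeriv (localRep e fun q => X q b) x y = dX ((x, b), (y, 0)) :=
    fun b y => by
      have h1 := HasDirDeriv.comp_affine (ContinuousLinearMap.inl ℝ E B : E →ₗ[ℝ] E × B)
        ((0 : E), b) (p := x) (v := y) (y := dX ((x, b), (y, 0)))
        (f := fun z : E × B => toChart e (e.symm z.1) (X (e.symm z.1) z.2))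
        (by simpa using hdX.hasDirDeriv (x, b) ⟨hx, trivial⟩ (y, 0))
      have h2 : HasDirDeriv (localRep e fun q => X q b) x y (dX ((x, b), (y, 0))) := by
        convert h1 using 1
        ext y
        exact hloc e b y _ (by simp)
      exact h2.dirDeriv_eq
  obtain ⟨u, hu⟩ := hDX _ hxS _ (hinv U _ _ hU (hfield v) (hfield w) (fun p hp => hXD p hp v)
    (fun p hp => hXD p hp w) _ (hSU hxS))
  have h1 := hM.toChart_lieBracket hU (hfield v) (hfield w) he (hSU hxS) (e.map_target (hW hx).1)
  rw [e.right_inv (hW hx).1, hrep, hrep] at h1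
  exact ⟨u, by rw [hu]; exact h1.symm⟩

variable [CompleteSpace B]

/-- An involutive subbundle has a Frobenius chart at every point at which it is spanned by a family
of vector fields that provides a local flow. -/
theorem IsInvolutive.exists_isFrobeniusChart {k : ℕ} (hM : IsCrManifold (k + 2) E M)
    {F H : Submodule ℝ E} (hFH : F.IsTopCompl H) (LB : B ≃L[ℝ] F)
    {D : (p : M) → Submodule ℝ (TSpace E p)} (hD : IsSubbundle (k + 1) F D)
    (hinv : IsInvolutive (k + 1) D) {U : Set M} (hU : IsOpen U) {X : (p : M) → B → TSpace E p}
    (hX : IsCrParamVectorFieldOn (k + 1) X U) (hXlin : ∀ p ∈ U, IsLinearMap ℝ (X p))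
    (hXD : ∀ p ∈ U, ∀ b, X p b ∈ D p) {p₀ : M} (hp₀ : p₀ ∈ U) (L : B ≃L[ℝ] D p₀)
    (hL : ∀ b, ((L b : D p₀) : TSpace E p₀) = X p₀ b) (hflow : ProvidesLocalFlow (k + 2) U X) :
    ∃ φ : OpenPartialHomeomorph M E, IsFrobeniusChart (k + 2) F H D φ ∧ p₀ ∈ φ.source := by
  obtain ⟨⟨S₀, hS₀U, hS₀, hp₀S₀, hDX⟩, α, σ, κ, hα, hακ, hσκ, hκσ⟩ :=
    hD.exists_splitting hM hFH hU hX hXlin hXD hp₀ L hL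
  set e := chartAt E p₀ with he_def
  have he : e ∈ atlas E M := chart_mem_atlas E p₀
  have hpe : p₀ ∈ e.source := mem_chart_source E p₀
  obtain ⟨ε, hε, W₀, W₁, V, Φ, hΦ, hΦk, hpW₁, hV0, hW₀⟩ :=
    hflow.exists_isParamFlow hM he (hS₀.inter e.open_source) (inter_subset_left.trans hS₀U)
      inter_subset_right ⟨hp₀S₀, hpe⟩
  have hW₀S : W₀ ⊆ e.target ∩ e.symm ⁻¹' S₀ := fun x hx => ⟨(hW₀ hx).1, (hW₀ hx).2.1⟩
  obtain ⟨dX, hdX, -⟩ := ((hX e he).mono (V := W₀ ×ˢ univ) fun z hz =>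
    ⟨⟨(hW₀S hz.1).1, hS₀U (hW₀S hz.1).2⟩, trivial⟩).exists_deriv (hΦ.isOpen₀.prod isOpen_univ)
  have hlin : ∀ x ∈ W₀, IsLinearMap ℝ fun v => toChart e (e.symm x) (X (e.symm x) v) :=
    fun x hx => by
      have h1 := hM.isLinearMap_coordChange (chart_mem_atlas E (e.symm x)) he
        (mem_chart_source E _) (e.map_target (hW₀S hx).1)
      have h2 := hXlin (e.symm x) (hS₀U (hW₀S hx).2)
      exact ⟨fun a b => by rw [h2.map_add]; exact h1.map_add _ _,
        fun s b => by rw [h2.map_smul]; exact h1.map_smul _ _⟩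
  have hX₀ : ∀ b, toChart e (e.symm (e p₀)) (X (e.symm (e p₀)) b) = X p₀ b := fun b => by
    have h1 : ∀ q, q = p₀ → toChart e q (X q b) = X p₀ b := by
      rintro q rfl
      exact coordChange_self hpe _
    exact h1 _ (e.left_inv hpe)
  obtain ⟨θ, hpθ, hθW, hθk, hθk', ρ, hρ, V₂, hV₂, hθt, htan⟩ :=
    hΦ.exists_straightening hε hΦk hdX hlin
      (fun x hx v w => hinv.exists_bracket_eq hM hU hS₀U hX hXD hDX he hW₀S hdX hx v w)
      hpW₁ hV0 (α := α) (σ := σ) (κ := κ) (fun b => by rw [hX₀, hα]) hακ hσκ hκσ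
  let Λ : (B × H) ≃L[ℝ] E := (LB.prodCongr (ContinuousLinearEquiv.refl ℝ H)).trans
    (Submodule.prodEquivOfIsTopCompl F H hFH)
  have hΛ : ∀ b h, Λ (b, h) = (LB b : E) + h := fun b h => by simp [Λ]
  have hΛs : ∀ ξ : F, Λ.symm (ξ : E) = (LB.symm ξ, 0) := fun ξ => by
    rw [ContinuousLinearEquiv.symm_apply_eq, hΛ]
    simp
  let τ : OpenPartialHomeomorph E E := θ.transHomeomorph Λ.toHomeomorph
  have hτs : ∀ z, τ.symm z = θ.symm (Λ.symm z) := fun z => rfl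
  have hτ : KellerOn (k + 2) τ τ.source := hθk.clm_comp (Λ : B × H →L[ℝ] E)
  have hτ' : KellerOn (k + 2) τ.symm τ.target :=
    hθk'.comp_clm (Λ.symm : E →L[ℝ] B × H) fun z hz => hz
  have hτe : ∀ z ∈ τ.target, τ.symm z ∈ W₀ := fun z hz => hθW (θ.map_target hz)
  have hφt : (e.trans τ).target = τ.target := by
    rw [OpenPartialHomeomorph.trans_target]
    exact inter_eq_left.2 fun z hz => (hW₀S (hτe z hz)).1
  refine ⟨e.trans τ, ?_, ?_⟩
  swap
  · rw [OpenPartialHomeomorph.trans_source]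
    exact ⟨hpe, hpθ⟩
  refine ((hM.isCrChart he).trans hτ hτ').isFrobeniusChart hFH (V₁ := LB '' Metric.ball 0 ρ)
    (V₂ := V₂) (LB.toHomeomorph.isOpenMap _ Metric.isOpen_ball)
    (((convex_ball (0 : B) ρ).isConnected (Metric.nonempty_ball.2 hρ)).image _
      LB.continuous.continuousOn) hV₂ ?_ ?_
  · rw [hφt]
    ext z
    change Λ.symm z ∈ θ.target ↔ _
    rw [hθt]
    constructor
    · intro hz
      exact ⟨_, ⟨_, hz.1, rfl⟩, _, hz.2, by rw [← hΛ]; simp⟩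
    · rintro ⟨_, ⟨b, hb, rfl⟩, h, hh, rfl⟩
      rw [← hΛ, Λ.symm_apply_apply]
      exact ⟨hb, hh⟩
  · rw [hφt]
    intro z hz
    set x := θ.symm (Λ.symm z) with hx
    have hxW : x ∈ W₀ := hτe z hz
    have hxe : e.symm x ∈ e.source := e.map_target (hW₀S hxW).1
    have hq : (e.trans τ).symm z = e.symm x := rfl
    -- the derivatives of the straightening map, in the preferred chart
    have hder : ∀ (ξ : F) (u : B), HasDirDeriv θ.symm (Λ.symm z) (LB.symm ξ, 0)
        (toChart e (e.symm x) (X (e.symm x) u)) →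
        HasDirDeriv (chartAt E (e.symm x) ∘ (e.trans τ).symm) z (ξ : E) (X (e.symm x) u) := by
      intro ξ u h
      have h1 := HasDirDeriv.comp_affine (Λ.symm : E →ₗ[ℝ] B × H) 0 (p := z) (v := (ξ : E))
        (f := θ.symm) (y := toChart e (e.symm x) (X (e.symm x) u)) (by simpa [hΛs] using h)
      have hev : ∀ᶠ z' in 𝓝 z, τ.symm z' ∈ e.target := by
        filter_upwards [τ.open_target.mem_nhds hz] with z' hz' using (hW₀S (hτe z' hz')).1
      have h2 : HasDirDeriv (fun z' => e (e.symm (τ.symm z'))) z (ξ : E)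
          (toChart e (e.symm x) (X (e.symm x) u)) := by
        refine h1.congr_of_eventuallyEq ?_
        filter_upwards [hev] with z' hz'
        rw [e.right_inv hz', hτs]
        simp
      have h3 := hM.hasDirDeriv_chart he (chart_mem_atlas E (e.symm x))
        (g := fun z' => e.symm (τ.symm z')) h2 hxe (mem_chart_source E (e.symm x))
        (hev.mono fun z' hz' => e.map_target hz')
      rwa [show coordChange e (chartAt E (e.symm x)) (e.symm (τ.symm z))
        (toChart e (e.symm x) (X (e.symm x) u)) = X (e.symm x) u from
          hM.ofChart_toChart he hxe _] at h3
    rw [hq]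
    obtain ⟨ht1, ht2⟩ := htan (Λ.symm z) hz
    refine ⟨fun ξ => ?_, fun η hη => ?_⟩
    · obtain ⟨u, hu⟩ := ht1 (LB.symm ξ)
      exact ⟨_, hXD _ (hS₀U (hW₀S hxW).2) u, hder ξ u hu⟩
    · obtain ⟨u, rfl⟩ := hDX _ (hW₀S hxW).2 η hη
      obtain ⟨w, hw⟩ := ht2 u
      exact ⟨LB w, hder (LB w) u (by rwa [LB.symm_apply_apply])⟩

end Existence

end KellerFrobenius

open KellerFrobenius

theorem theorem2p9 {E : Type*} [AddCommGroup E] [Module ℝ E] [TopologicalSpace E]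
    [IsTopologicalAddGroup E] [ContinuousSMul ℝ E] [LocallyConvexSpace ℝ E] [T2Space E]
    {M : Type*} [TopologicalSpace M] [T2Space M] [ChartedSpace E M]
    (r : ℕ) (hr : 2 ≤ r) (hM : IsCrManifold r E M)
    (F H : Submodule ℝ E) (hFH : F.IsTopCompl H) (hF : IsBanach F)
    (D : (p : M) → Submodule ℝ (TSpace E p))
    (hD : IsSubbundle (r - 1) F D) (hinv : IsInvolutive (r - 1) D)
    (hX : ∀ p₀ : M, ∃ U : Set M, IsOpen U ∧ p₀ ∈ U ∧ ∃ X : (p : M) → F → TSpace E p,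
      IsCrParamVectorFieldOn (r - 1) X U ∧
      (∀ p ∈ U, IsLinearMap ℝ (X p)) ∧
      (∀ p ∈ U, ∀ v : F, X p v ∈ D p) ∧
      (∃ L : F ≃L[ℝ] D p₀, ∀ v : F, ((L v : D p₀) : TSpace E p₀) = X p₀ v) ∧
      ProvidesLocalFlow r U X) :
    IsFrobeniusDistribution r F H D := by
  obtain ⟨k, rfl⟩ := Nat.exists_eq_add_of_le' hr
  obtain ⟨B, _, _, _, ⟨LB⟩⟩ := hF
  refine ⟨{φ | IsFrobeniusChart (k + 2) F H D φ}, fun _ h => h, fun p₀ => ?_⟩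
  obtain ⟨U, hU, hp₀, X, hXk, hXlin, hXD, ⟨L, hL⟩, hflow⟩ := hX p₀
  exact IsInvolutive.exists_isFrobeniusChart hM hFH LB (X := fun p b => X p (LB b)) hD hinv hU
    (hXk.comp_clm (LB : B →L[ℝ] F))
    (fun p hp => (hXlin p hp).mk'.comp (LB : B →ₗ[ℝ] F) |>.isLinear)
    (fun p hp b => hXD p hp _) hp₀ (LB.trans L) (fun b => hL _)
    (hflow.comp_clm (LB : B →L[ℝ] F))
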